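/- **Notation.** On $\mathbb R^4$ with Cartesian coordinates $x=(x^0,\dots,x^3)$, $t=x^0$, $r=|(x^1,x^2,x^3)|$, $q=r-t$, $\omega^i=x^i/r$, $\partial_r=\omega^i\partial_i$, let $m=\mathrm{diag}(-1,1,1,1)$. Repeated indices are summed from $0$ to $3$ (Latin ones from $1$ to $3$), $h$ is a symmetric 2-tensor field, $A$ a 1-form, $g=m+h$, $(g^{\alpha\beta})=(g_{\alpha\beta})^{-1}$, and $h^{\alpha\beta}=m^{\alpha\alpha'}m^{\beta\beta'}h_{\alpha'\beta'}$. Let $\mathfrak L$ consist of the eleven vector fields $\partial_\alpha$, $\Omega_{\alpha\beta}=-x_\alpha\partial_\beta+x_\beta\partial_\alpha$ ($\alpha<\beta$, $x_\alpha=m_{\alpha\beta}x^\beta$) and $x^\alpha\partial_\alpha$. For a multi-index $I=(\iota_1,\dots,\iota_k)$ of length $|I|=k$, $Z^I=Z^{\iota_1}\cdots Z^{\iota_k}$ is the corresponding product of $k$ fields of $\mathfrak L$, acting on Cartesian components. $|\cdot|$ is the Euclidean norm of all Cartesian components, $\partial p$ is the full gradient (index of differentiation last), and $\bar\partial p=\partial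 p-\partial_r p\otimes dq$. At a point with $r\neq0$ put $L=\partial_t+\partial_r$, $\underline L=\partial_t-\partial_r$, let $S_1,S_2$ be any orthonormal pair of vectors tangent to the sphere of constant $t$ and $r$, and $\mathcal L=\{L\}$, $\mathcal T=\{L,S_1,S_2\}$, $\mathcal U=\{\underline L,L,S_1,S_2\}$. For a 2-tensor $p$, $$|\partial p|_{\mathcal V\mathcal W}^2=\sum_{V\in\mathcal V,\,W\in\mathcal W}\ \sum_{\alpha=0}^3 c_Vc_W\,\big((\partial_\alpha p)(V,W)\big)^2,\qquad c_L=c_{\underline L}=\tfrac12,\quad c_{S_1}=c_{S_2}=1 .$$ **Sources.** For a symmetric matrix field $(\gamma^{\alpha\beta})$ let $$P^\gamma_{\mu\nu}=\gamma^{\alpha\alpha'}\gamma^{\beta\beta'}\big(\tfrac14\partial_\mu h_{\beta\beta'}\partial_\nu h_{\alpha\alpha'}-\tfrac12\partial_\nu h_{\alpha\beta}\partial_\mu h_{\alpha'\beta'}\big),$$ $$\begin{aligned}Q^\gamma_{\mu\nu}=\gamma^{\alpha\alpha'}\gamma^{\beta\beta'}\Big\{&\partial_\alpha h_{\beta\mu}\partial_{\alpha'}h_{\beta'\nu}-(\partial_\alpha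 h_{\beta\mu}\partial_{\beta'}h_{\alpha'\nu}-\partial_{\beta'}h_{\beta\mu}\partial_\alpha h_{\alpha'\nu})\\&+(\partial_\mu h_{\alpha'\beta'}\partial_\alpha h_{\beta\nu}-\partial_\alpha h_{\alpha'\beta'}\partial_\mu h_{\beta\nu})+(\partial_\nu h_{\alpha'\beta'}\partial_\alpha h_{\beta\mu}-\partial_\alpha h_{\alpha'\beta'}\partial_\nu h_{\beta\mu})\\&+\tfrac12(\partial_{\beta'}h_{\alpha\alpha'}\partial_\mu h_{\beta\nu}-\partial_\mu h_{\alpha\alpha'}\partial_{\beta'}h_{\beta\nu})+\tfrac12(\partial_{\beta'}h_{\alpha\alpha'}\partial_\nu h_{\beta\mu}-\partial_\nu h_{\alpha\alpha'}\partial_{\beta'}h_{\beta\mu})\Big\}.\end{aligned}$$ Put $\tilde F_{\alpha\beta}=\partial_\alpha A_\beta-\partial_\beta A_\alpha$ and define the exact remainders $G_{\mu\nu}=(P^{g^{-1}}+Q^{g^{-1}})_{\mu\nu}-(P^{m^{-1}}+Q^{m^{-1}})_{\mu\nu}$, $O^{\alpha\beta}=g^{\alpha\beta}-m^{\alpha\beta}+h^{\alpha\beta}$,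 $$O^{\alpha\beta\gamma\delta}=g^{\alpha\beta}g^{\gamma\delta}-(-m^{\alpha\beta}h^{\gamma\delta}-h^{\alpha\beta}m^{\gamma\delta}+m^{\alpha\beta}m^{\gamma\delta}),$$ $$O^{\alpha\rho\beta\sigma}_{\mu\nu}=g_{\mu\nu}g^{\alpha\rho}g^{\beta\sigma}-(m^{\alpha\rho}m^{\beta\sigma}h_{\mu\nu}+m^{\alpha\rho}m^{\beta\sigma}m_{\mu\nu}-h^{\alpha\rho}m^{\beta\sigma}m_{\mu\nu}-m^{\alpha\rho}h^{\beta\sigma}m_{\mu\nu}).$$ The Einstein and Maxwell source terms are $$\begin{aligned}F_{\mu\nu}={}&P^{m^{-1}}_{\mu\nu}+Q^{m^{-1}}_{\mu\nu}+G_{\mu\nu}+2(h^{\alpha\beta}-m^{\alpha\beta})\tilde F_{\alpha\mu}\tilde F_{\beta\nu}-2O^{\alpha\beta}\tilde F_{\alpha\mu}\tilde F_{\beta\nu}\\&+\tfrac12\{m^{\alpha\rho}m^{\beta\sigma}h_{\mu\nu}+m^{\alpha\rho}m^{\beta\sigma}m_{\mu\nu}-h^{\alpha\rho}m^{\beta\sigma}m_{\mu\nu}-m^{\alpha\rho}h^{\beta\sigma}m_{\mu\nu}+O^{\alpha\rho\beta\sigma}_{\mu\nu}\}\tilde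 F_{\alpha\beta}\tilde F_{\rho\sigma},\end{aligned}$$ $$\begin{aligned}J_\beta={}&\{-m^{\alpha\theta}h^{\mu\lambda}-h^{\alpha\theta}m^{\mu\lambda}+m^{\alpha\theta}m^{\mu\lambda}+O^{\alpha\theta\mu\lambda}\}\,\partial_\beta h_{\theta\mu}\,\partial_\lambda A_\alpha\\&+\tfrac12\{-m^{\alpha\lambda}h^{\theta\mu}-h^{\alpha\lambda}m^{\theta\mu}+m^{\alpha\lambda}m^{\theta\mu}+O^{\alpha\lambda\theta\mu}\}(\partial_\lambda h_{\mu\beta}+\partial_\beta h_{\mu\lambda}-\partial_\mu h_{\lambda\beta})\tilde F_{\alpha\theta}.\end{aligned}$$ (The reduced Einstein–Maxwell equations in wave and Lorenz gauge are $g^{\alpha\beta}\partial_\alpha\partial_\beta h_{\mu\nu}=F_{\mu\nu}$, $g^{\alpha\beta}\partial_\alpha\partial_\beta A_\lambda=J_\lambda$.) **Proposition 5.3.** For every integer $k\ge0$ and every $\tilde C<1$ there is a constant $C$ such that the following holds. Let $U\subset\mathbb R^4$ be open, let the symmetric 2-tensor field $h$ and the 1-form $A$ be of class $C^{k+1}$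 on $U$, suppose that $g=m+h$ satisfies the wave gauge condition $g^{\alpha\beta}\Gamma^\lambda_{\alpha\beta}=0$ on $U$, where $\Gamma$ are the Christoffel symbols of $g$, and that $|Z^Jh|\le\tilde C$ on $U$ for all multi-indices $J$ with $|J|\le k$. Let $|I|=k$. Then at every point of $U$ with $r\ne0$ $$\begin{aligned}|Z^IF|\le C\Big(&\sum_{|J|+|K|\le|I|}\big(|\partial Z^Jh|_{\mathcal T\mathcal U}\,|\partial Z^Kh|_{\mathcal T\mathcal U}+|\bar\partial Z^Jh|\,|\partial Z^Kh|\big)+\sum_{|J|+|K|\le|I|-1}|\partial Z^Jh|_{\mathcal L\mathcal T}\,|\partial Z^Kh|\\&+\sum_{|J|+|K|\le|I|-2}|\partial Z^Jh|\,|\partial Z^Kh|+\sum_{|J_1|+|J_2|+|J_3|\le|I|}|Z^{J_3}h|\,|\partial Z^{J_2}h|\,|\partial Z^{J_1}h|\\&+\sum_{|J_1|+|J_2|\le|I|}|\partial Z^{J_1}A|\,|\partial Z^{J_2}A|\Big),\end{aligned}$$ and at every point of $U$ $$|Z^IJ|\le C\sum_{|I_1|+|I_2|\le|I|}|\partial Z^{I_1}h|\,|\partial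 Z^{I_2}A| .$$ -/

import Mathlib

open scoped Matrix

noncomputable section

namespace EinsteinMaxwell

/-- `ℝ⁴` with its Cartesian coordinates `x = (x⁰, x¹, x², x³)`, where `x⁰ = t`. -/
abbrev Spacetime : Type := Fin 4 → ℝ

/-- The Minkowski metric `m = diag(-1, 1, 1, 1)`. As a matrix it is its own inverse, so `mink α β`
stands both for `m_{αβ}` and for `m^{αβ}`. -/
def mink : Matrix (Fin 4) (Fin 4) ℝ := Matrix.diagonal ![-1, 1, 1, 1]

theorem mink_mul_mink : mink * mink = 1 := by
  rw [mink, Matrix.diagonal_mul_diagonal, ← Matrix.diagonal_one]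
  congr 1
  funext i
  fin_cases i <;> simp

/-! ### Differentiation and the vector fields `Z` -/

/-- The coordinate derivative `∂_α f`. -/
def pd (α : Fin 4) (f : Spacetime → ℝ) : Spacetime → ℝ :=
  fun x => fderiv ℝ f x (Pi.single α 1)

/-- Labels of the eleven vector fields: the translations `∂_α`, the `Ω_{αβ}` with `α < β`, and
the scaling field. -/
abbrev ZLabel : Type := Fin 4 ⊕ {p : Fin 4 × Fin 4 // p.1 < p.2} ⊕ Unit

theorem card_ZLabel : Fintype.card ZLabel = 11 := by decide

/-- The vector fields `∂_α`, `Ω_{αβ} = -x_α ∂_β + x_β ∂_α` (indices lowered with `m`) and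
`S = t ∂_t + r ∂_r = x^α ∂_α`. -/
def zField : ZLabel → Spacetime → Spacetime
  | .inl α, _ => Pi.single α 1
  | .inr (.inl p), x =>
      -((mink *ᵥ x) p.1.1 • Pi.single p.1.2 (1 : ℝ)) + (mink *ᵥ x) p.1.2 • Pi.single p.1.1 (1 : ℝ)
  | .inr (.inr _), x => x

/-- The action of one of the vector fields on a function. -/
def zApply (a : ZLabel) (f : Spacetime → ℝ) : Spacetime → ℝ :=
  fun x => fderiv ℝ f x (zField a x)

/-- A multi-index `I = (ι₁, …, ι_k)`; its length `|I|` is the length of the list. -/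
abbrev MultiIndex : Type := List ZLabel

/-- `Z^I f = Z^{ι₁} (Z^{ι₂} (⋯ (Z^{ι_k} f)))`. -/
def zPow (I : MultiIndex) (f : Spacetime → ℝ) : Spacetime → ℝ :=
  I.foldr zApply f

/-- All multi-indices of length at most `k`. -/
def multiIndices (k : ℕ) : Finset MultiIndex := (List.finite_length_le ZLabel k).toFinset

theorem mem_multiIndices {k : ℕ} {I : MultiIndex} : I ∈ multiIndices k ↔ I.length ≤ k := by
  simp [multiIndices]

/-- The pairs `(J, K)` with `|J| + |K| ≤ k - s`; there are none if `k < s`. -/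
def indexPairs (k s : ℕ) : Finset (MultiIndex × MultiIndex) :=
  (multiIndices k ×ˢ multiIndices k).filter fun p => p.1.length + p.2.length + s ≤ k

/-- The triples `(J₁, J₂, J₃)` with `|J₁| + |J₂| + |J₃| ≤ k`. -/
def indexTriples (k : ℕ) : Finset (MultiIndex × MultiIndex × MultiIndex) :=
  (multiIndices k ×ˢ multiIndices k ×ˢ multiIndices k).filter
    fun p => p.1.length + p.2.1.length + p.2.2.length ≤ k

/-! ### Tensor fields, given by their Cartesian components -/

abbrev OneFormField : Type := Fin 4 → Spacetime → ℝ

abbrev TwoTensorField : Type := Fin 4 → Fin 4 → Spacetime → ℝ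

/-- `Z^I` acts on the Cartesian components. -/
def zPow₁ (I : MultiIndex) (A : OneFormField) : OneFormField := fun β => zPow I (A β)

def zPow₂ (I : MultiIndex) (h : TwoTensorField) : TwoTensorField := fun μ ν => zPow I (h μ ν)

/-- The value of a 2-tensor field at a point. -/
def val₂ (h : TwoTensorField) (x : Spacetime) : Matrix (Fin 4) (Fin 4) ℝ :=
  Matrix.of fun μ ν => h μ ν x

/-- `∂A`, with the index of differentiation last: `grad₁ A x β α = ∂_α A_β (x)`. -/
def grad₁ (A : OneFormField) (x : Spacetime) : Fin 4 → Fin 4 → ℝ :=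
  fun β α => pd α (A β) x

/-- `∂h`, with the index of differentiation last: `grad₂ h x μ ν α = ∂_α h_{μν} (x)`. -/
def grad₂ (h : TwoTensorField) (x : Spacetime) : Fin 4 → Fin 4 → Fin 4 → ℝ :=
  fun μ ν α => pd α (h μ ν) x

/-! ### The Euclidean norms of the components -/

def norm₁ (p : Fin 4 → ℝ) : ℝ := √(∑ α, p α ^ 2)

def norm₂ (p : Fin 4 → Fin 4 → ℝ) : ℝ := √(∑ α, ∑ β, p α β ^ 2)

def norm₃ (p : Fin 4 → Fin 4 → Fin 4 → ℝ) : ℝ := √(∑ α, ∑ β, ∑ γ, p α β γ ^ 2)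

/-! ### The null frame -/

/-- `r = |(x¹, x², x³)|`. -/
def rad (x : Spacetime) : ℝ := √(x 1 ^ 2 + x 2 ^ 2 + x 3 ^ 2)

/-- The components of the radial vector field `∂_r = ω^i ∂_i`, `ω^i = x^i / r` (for `r ≠ 0`). -/
def radial (x : Spacetime) : Spacetime := fun α => if α = 0 then 0 else x α / rad x

/-- The components of the differential of `q = r - t`. -/
def dq (x : Spacetime) : Fin 4 → ℝ := fun β => if β = 0 then -1 else x β / rad x

/-- `∂̄h = ∂h - ∂_r h ⊗ dq`, index of differentiation last. -/
def goodGrad₂ (h : TwoTensorField) (x : Spacetime) : Fin 4 → Fin 4 → Fin 4 → ℝ :=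
  fun μ ν β => pd β (h μ ν) x - fderiv ℝ (h μ ν) x (radial x) * dq x β

/-- The labels of the null frame `L`, `L̲`, `S₁`, `S₂`. -/
inductive NullLabel : Type
  | L
  | Lbar
  | S₁
  | S₂
  deriving DecidableEq

/-- `S₁, S₂` are, at the point `x`, an orthonormal pair of vectors tangent to the sphere of constant
`t` and `r` through `x`. -/
structure IsSphereFrame (x S₁ S₂ : Spacetime) : Prop where
  time₁ : S₁ 0 = 0
  time₂ : S₂ 0 = 0
  radial₁ : S₁ ⬝ᵥ radial x = 0
  radial₂ : S₂ ⬝ᵥ radial x = 0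
  unit₁ : S₁ ⬝ᵥ S₁ = 1
  unit₂ : S₂ ⬝ᵥ S₂ = 1
  orth : S₁ ⬝ᵥ S₂ = 0

/-- The vectors of the null frame at `x`: `L = ∂_t + ∂_r`, `L̲ = ∂_t - ∂_r`, `S₁`, `S₂`. -/
def nullVec (x S₁ S₂ : Spacetime) : NullLabel → Spacetime
  | .L => Pi.single 0 1 + radial x
  | .Lbar => Pi.single 0 1 - radial x
  | .S₁ => S₁
  | .S₂ => S₂

/-- The inverse of the Euclidean metric of `ℝ⁴` in the null frame. -/
def euInv : NullLabel → NullLabel → ℝ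
  | .L, .L => 1 / 2
  | .Lbar, .Lbar => 1 / 2
  | .S₁, .S₁ => 1
  | .S₂, .S₂ => 1
  | _, _ => 0

/-- The family `𝒯 = {L, S₁, S₂}`. -/
def famT : Finset NullLabel := {.L, .S₁, .S₂}

/-- The family `𝒰 = {L̲, L, S₁, S₂}`. -/
def famU : Finset NullLabel := {.Lbar, .L, .S₁, .S₂}

/-- The family `ℒ = {L}`. -/
def famL : Finset NullLabel := {.L}

/-- `p(X, Y, ∂_α)` for a 3-tensor `p`. -/
def contract (p : Fin 4 → Fin 4 → Fin 4 → ℝ) (X Y : Spacetime) (α : Fin 4) : ℝ :=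
  ∑ μ, ∑ ν, p μ ν α * X μ * Y ν

/-- `|p|_{𝒱𝒲}` for a 3-tensor `p` (in the application `p = ∂k` with a 2-tensor `k`, so that the
families restrict the two indices of `k`, not the index of differentiation). -/
def frameNorm (x S₁ S₂ : Spacetime) (𝒱 𝒲 : Finset NullLabel)
    (p : Fin 4 → Fin 4 → Fin 4 → ℝ) : ℝ :=
  √(∑ V ∈ 𝒱, ∑ V' ∈ 𝒱, ∑ W ∈ 𝒲, ∑ W' ∈ 𝒲, ∑ α,
      euInv V V' * euInv W W' *
        contract p (nullVec x S₁ S₂ V) (nullVec x S₁ S₂ W) α *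
        contract p (nullVec x S₁ S₂ V') (nullVec x S₁ S₂ W') α)

/-! ### The metric `g = m + h` and the wave gauge -/

/-- The matrix `(g^{αβ})`, the inverse of `(m_{αβ} + h_{αβ})`. -/
def gInv (H : Matrix (Fin 4) (Fin 4) ℝ) : Matrix (Fin 4) (Fin 4) ℝ := (mink + H)⁻¹

/-- The components `g_{μν} = m_{μν} + h_{μν}` of the metric. -/
def metric (h : TwoTensorField) : TwoTensorField := fun μ ν x => mink μ ν + h μ ν x

/-- The Christoffel symbols `Γ^l_{αβ}` of `g = m + h`. -/
def christoffel (h : TwoTensorField) (x : Spacetime) (l α β : Fin 4) : ℝ :=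
  1 / 2 * ∑ μ, gInv (val₂ h x) l μ *
    (pd α (metric h μ β) x + pd β (metric h α μ) x - pd μ (metric h α β) x)

/-- The wave gauge on `U` with respect to the flat background metric: `g^{αβ} Γ^l_{αβ} = 0` (the
Christoffel symbols of the flat background vanish in Cartesian coordinates). -/
def WaveGauge (h : TwoTensorField) (U : Set Spacetime) : Prop :=
  ∀ x ∈ U, ∀ l, ∑ α, ∑ β, gInv (val₂ h x) α β * christoffel h x l α β = 0

/-! ### The source terms

In what follows `H` stands for the value of `h`, `p μ ν α` for `∂_α h_{μν}` and `a β α` for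
`∂_α A_β` at one point. -/

/-- The quadratic form `P(∂_μ h, ∂_ν h)`, indices raised with `γ`. -/
def formP (γ : Matrix (Fin 4) (Fin 4) ℝ) (p : Fin 4 → Fin 4 → Fin 4 → ℝ) (μ ν : Fin 4) : ℝ :=
  ∑ α, ∑ α', ∑ β, ∑ β', γ α α' * γ β β' *
    (1 / 4 * p β β' μ * p α α' ν - 1 / 2 * p α β ν * p α' β' μ)

/-- The quadratic form `Q_{μν}(∂h, ∂h)`, indices raised with `γ`. -/
def formQ (γ : Matrix (Fin 4) (Fin 4) ℝ) (p : Fin 4 → Fin 4 → Fin 4 → ℝ) (μ ν : Fin 4) : ℝ :=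
  ∑ α, ∑ α', ∑ β, ∑ β', γ α α' * γ β β' *
    (p β μ α * p β' ν α'
      - (p β μ α * p α' ν β' - p β μ β' * p α' ν α)
      + (p α' β' μ * p β ν α - p α' β' α * p β ν μ)
      + (p α' β' ν * p β μ α - p α' β' α * p β μ ν)
      + 1 / 2 * (p α α' β' * p β ν μ - p α α' μ * p β ν β')
      + 1 / 2 * (p α α' β' * p β μ ν - p α α' ν * p β μ β'))

/-- `G_{μν}(h)(∂h, ∂h)`: what is left of the quadratic terms of the Ricci tensor of `g` (indices
raised with `g`) after `P` and `Q` (indices raised with `m`) are split off. -/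
def formG (H : Matrix (Fin 4) (Fin 4) ℝ) (p : Fin 4 → Fin 4 → Fin 4 → ℝ) (μ ν : Fin 4) : ℝ :=
  (formP (gInv H) p μ ν + formQ (gInv H) p μ ν) - (formP mink p μ ν + formQ mink p μ ν)

/-- `h^{αβ} = m^{αα'} m^{ββ'} h_{α'β'}`. -/
def hUp (H : Matrix (Fin 4) (Fin 4) ℝ) : Matrix (Fin 4) (Fin 4) ℝ :=
  Matrix.of fun α β => ∑ α', ∑ β', mink α α' * mink β β' * H α' β'

/-- The second-order remainder `O^{αβ}(h²)` in `g^{αβ} = m^{αβ} - h^{αβ} + O^{αβ}(h²)`. -/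
def remInv (H : Matrix (Fin 4) (Fin 4) ℝ) (α β : Fin 4) : ℝ :=
  gInv H α β - (mink α β - hUp H α β)

/-- The second-order remainder `O^{αβγδ}(h²)` of `g^{αβ} g^{γδ}`. -/
def remInvInv (H : Matrix (Fin 4) (Fin 4) ℝ) (α β γ δ : Fin 4) : ℝ :=
  gInv H α β * gInv H γ δ -
    (-(mink α β * hUp H γ δ) - hUp H α β * mink γ δ + mink α β * mink γ δ)

/-- The second-order remainder `O^{αρβσ}_{μν}(h²)` of `g_{μν} g^{αρ} g^{βσ}`. -/
def remMetricInvInv (H : Matrix (Fin 4) (Fin 4) ℝ) (α ρ β σ μ ν : Fin 4) : ℝ :=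
  (mink μ ν + H μ ν) * gInv H α ρ * gInv H β σ -
    (mink α ρ * mink β σ * H μ ν + mink α ρ * mink β σ * mink μ ν
      - hUp H α ρ * mink β σ * mink μ ν - mink α ρ * hUp H β σ * mink μ ν)

/-- The electromagnetic field `∂_α A_β - ∂_β A_α`. -/
def faraday (a : Fin 4 → Fin 4 → ℝ) (α β : Fin 4) : ℝ := a β α - a α β

/-- The source term `F_{μν}` of the equations `g^{αβ} ∂_α ∂_β h_{μν} = F_{μν}`. -/
def sourceF (H : Matrix (Fin 4) (Fin 4) ℝ) (p : Fin 4 → Fin 4 → Fin 4 → ℝ)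
    (a : Fin 4 → Fin 4 → ℝ) (μ ν : Fin 4) : ℝ :=
  formP mink p μ ν + formQ mink p μ ν + formG H p μ ν
    + 2 * ∑ α, ∑ β, (hUp H α β - mink α β) * faraday a α μ * faraday a β ν
    - 2 * ∑ α, ∑ β, remInv H α β * faraday a α μ * faraday a β ν
    + 1 / 2 * ∑ α, ∑ ρ, ∑ β, ∑ σ,
        (mink α ρ * mink β σ * H μ ν + mink α ρ * mink β σ * mink μ ν
          - hUp H α ρ * mink β σ * mink μ ν - mink α ρ * hUp H β σ * mink μ ν
          + remMetricInvInv H α ρ β σ μ ν) * faraday a α β * faraday a ρ σ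

/-- The source term `J_β` of the equations `g^{αλ} ∂_λ ∂_α A_β = J_β`. -/
def sourceJ (H : Matrix (Fin 4) (Fin 4) ℝ) (p : Fin 4 → Fin 4 → Fin 4 → ℝ)
    (a : Fin 4 → Fin 4 → ℝ) (β : Fin 4) : ℝ :=
  ∑ α, ∑ θ, ∑ μ, ∑ l,
      (-(mink α θ * hUp H μ l) - hUp H α θ * mink μ l + mink α θ * mink μ l
        + remInvInv H α θ μ l) * p θ μ β * a α l
    + 1 / 2 * ∑ α, ∑ l, ∑ θ, ∑ μ,
      (-(mink α l * hUp H θ μ) - hUp H α l * mink θ μ + mink α l * mink θ μ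
        + remInvInv H α l θ μ) * (p μ β l + p μ l β - p l β μ) * faraday a α θ

/-- The expansion in `h` adds up to the full quadratic terms of the reduced Einstein equations. -/
theorem sourceF_eq (H : Matrix (Fin 4) (Fin 4) ℝ) (p : Fin 4 → Fin 4 → Fin 4 → ℝ)
    (a : Fin 4 → Fin 4 → ℝ) (μ ν : Fin 4) :
    sourceF H p a μ ν = formP (gInv H) p μ ν + formQ (gInv H) p μ ν
      - 2 * ∑ α, ∑ β, gInv H α β * faraday a α μ * faraday a β ν
      + 1 / 2 * ((mink μ ν + H μ ν) * ∑ α, ∑ ρ, ∑ β, ∑ σ,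
          gInv H α ρ * gInv H β σ * faraday a α β * faraday a ρ σ) := by
  have h1 : 2 * ∑ α, ∑ β, (hUp H α β - mink α β) * faraday a α μ * faraday a β ν
      - 2 * ∑ α, ∑ β, remInv H α β * faraday a α μ * faraday a β ν
      = - (2 * ∑ α, ∑ β, gInv H α β * faraday a α μ * faraday a β ν) := by
    rw [← mul_sub, ← Finset.sum_sub_distrib, ← mul_neg, ← Finset.sum_neg_distrib]
    congr 1
    refine Finset.sum_congr rfl fun α _ => ?_
    rw [← Finset.sum_sub_distrib, ← Finset.sum_neg_distrib]
    refine Finset.sum_congr rfl fun β _ => ?_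
    simp only [remInv]; ring
  simp only [sourceF, formG, Finset.mul_sum] at h1 ⊢
  have h2 : ∀ α ρ β σ : Fin 4,
      (mink α ρ * mink β σ * H μ ν + mink α ρ * mink β σ * mink μ ν
          - hUp H α ρ * mink β σ * mink μ ν - mink α ρ * hUp H β σ * mink μ ν
          + remMetricInvInv H α ρ β σ μ ν) * faraday a α β * faraday a ρ σ
      = (mink μ ν + H μ ν) * (gInv H α ρ * gInv H β σ * faraday a α β * faraday a ρ σ) := by
    intro α ρ β σ
    simp only [remMetricInvInv]; ring
  simp only [h2]
  linarith

/-- The same for the reduced Maxwell equations. -/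
theorem sourceJ_eq (H : Matrix (Fin 4) (Fin 4) ℝ) (p : Fin 4 → Fin 4 → Fin 4 → ℝ)
    (a : Fin 4 → Fin 4 → ℝ) (β : Fin 4) :
    sourceJ H p a β =
      ∑ α, ∑ θ, ∑ μ, ∑ l, gInv H α θ * gInv H μ l * p θ μ β * a α l
      + 1 / 2 * ∑ α, ∑ l, ∑ θ, ∑ μ, gInv H α l * gInv H θ μ *
          (p μ β l + p μ l β - p l β μ) * faraday a α θ := by
  simp [sourceJ, remInvInv]

/-- `F` as a 2-tensor field. -/
def fieldF (h : TwoTensorField) (A : OneFormField) : TwoTensorField :=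
  fun μ ν x => sourceF (val₂ h x) (grad₂ h x) (grad₁ A x) μ ν

/-- `J` as a field of 1-forms. -/
def fieldJ (h : TwoTensorField) (A : OneFormField) : OneFormField :=
  fun β x => sourceJ (val₂ h x) (grad₂ h x) (grad₁ A x) β

end EinsteinMaxwell

end

open EinsteinMaxwell

/-!
The estimate rests on three structures of the source terms, all of which survive the application
of the vector fields `Z`.

* Commuting `Z` with `∂_α` produces constant combinations of the `∂_β`. Hence `Z^I` of a form
  bilinear in two gradients is a combination of such forms in `∂ Z^J u`, `∂ Z^K v` with `|J| + |K|
  ≤ |I|`, from any set of forms that the commutators preserve (`isBigO_zPow_gradForm`). All forms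
  `N^{αβ} P(∂_α h, ∂_β h)` are such a set, and so are the null forms, because `∂_α Z^μ` generates
  a conformal Lorentz transformation (`commutator_mem_nullForms`). In a null form one gradient is
  tangential (`isBigO_gradForm_nullForms`); in `P`, two components have a tangential index or one
  of them is the `LL`-component (`isBigO_gradForm_coeffP`).

* The wave gauge controls the `LL`-component. Its linear part, contracted with `L`, expresses `∂_r
  h_{LL}` by tangential derivatives (`contract_LL_eq`), and it is covariant: up to combinations of
  its own components it commutes with `K ↦ Z K + c K`, where `c` is the infinitesimal rotation of
  the tensor indices that belongs to `Z` (`gaugeForm_lieDeriv`). Passing from `Z K + c K` to `Z K`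
  costs `(c K)_{LL} = 2 K(L, c L)` with one `Z` less, and `c L` is orthogonal to `L`, so it lies
  in the span of `L, S₁, S₂` (`IsSphereFrame.contract_rot`). This is why terms with one derivative
  less occur with `LT`-components, and general ones only with two less (`isBigO_contract_LL`).

* What remains has a factor `g⁻¹ - m⁻¹ = - m⁻¹ h g⁻¹`, or is quadratic in `∂A`. For these terms it
  is enough that `g⁻¹` and its derivatives are bounded (`isBigO_zPow_gInv`), which follows from
  `|h| ≤ C̃ < 1`, from the bounds on `Z^J h`, and from `Z g⁻¹ = - g⁻¹ (Z h) g⁻¹`.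

Constants that depend only on `k` and `C̃` are handled by considering families indexed by an
arbitrary type `Ω`, which in the end is the type of all admissible fields and points: `f =O[⊤] g`
says that `|f| ≤ C |g|` on all of `Ω`. Most lemmas have the form "if every term of the expansion
is `O(g)`, then so is the result", with arbitrary `g`, so that no sums over multi-indices have to
be carried along.
-/

noncomputable section

namespace EinsteinMaxwell

open Filter Topology Asymptotics

/-! ### Calculus of the vector fields -/

/-- The constant matrix `∂_α Z^μ` of first derivatives of the (affine) vector field `Z`. -/
def zLin (a : ZLabel) : Matrix (Fin 4) (Fin 4) ℝ :=
  Matrix.of fun α μ => zField a (Pi.single α 1) μ - zField a 0 μ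

theorem zField_eq (a : ZLabel) (x : Spacetime) : zField a x = x ᵥ* zLin a + zField a 0 := by
  funext μ
  rcases a with α | ⟨⟨i, j⟩, hij⟩ | u
  · simp [zField, zLin, Matrix.vecMul, dotProduct]
  · simp only [zField, zLin, mink]
    fin_cases i <;> fin_cases j <;> fin_cases μ <;>
      simp [Matrix.vecMul_eq_sum, Fin.sum_univ_four, Matrix.mulVec_diagonal] at hij ⊢
  · simp [zField, zLin, Matrix.vecMul, dotProduct, Pi.single_apply]

theorem hasFDerivAt_zField (a : ZLabel) (x : Spacetime) :
    HasFDerivAt (zField a) (LinearMap.toContinuousLinearMap (Matrix.vecMulLinear (zLin a))) x := by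
  have h : zField a = fun x => LinearMap.toContinuousLinearMap (Matrix.vecMulLinear (zLin a)) x
      + zField a 0 := by
    funext x
    rw [zField_eq]
    rfl
  rw [h]
  exact (ContinuousLinearMap.hasFDerivAt _).add_const _

theorem contDiff_zField (a : ZLabel) {n : WithTop ℕ∞} : ContDiff ℝ n (zField a) := by
  have h : zField a = fun x => LinearMap.toContinuousLinearMap (Matrix.vecMulLinear (zLin a)) x
      + zField a 0 := by
    funext x
    rw [zField_eq]
    rfl
  rw [h]
  exact (ContinuousLinearMap.contDiff _).add contDiff_const

theorem fderiv_apply_eq_sum (f : Spacetime → ℝ) (x v : Spacetime) :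
    fderiv ℝ f x v = ∑ μ, v μ * pd μ f x := by
  conv_lhs => rw [pi_eq_sum_univ' v]
  rw [map_sum]
  refine Finset.sum_congr rfl fun μ _ => ?_
  rw [map_smul, smul_eq_mul, pd]

section Regularity

variable {f g : Spacetime → ℝ} {x : Spacetime} {n : ℕ}

theorem contDiffAt_pd (hf : ContDiffAt ℝ (n + 1 : ℕ) f x) (α : Fin 4) :
    ContDiffAt ℝ n (pd α f) x :=
  ContDiffAt.clm_apply (hf.fderiv_right (by norm_cast)) contDiffAt_const

theorem contDiffAt_zApply (hf : ContDiffAt ℝ (n + 1 : ℕ) f x) (a : ZLabel) :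
    ContDiffAt ℝ n (zApply a f) x :=
  ContDiffAt.clm_apply (hf.fderiv_right (by norm_cast)) (contDiff_zField a).contDiffAt

theorem contDiffAt_zPow (I : MultiIndex) (hf : ContDiffAt ℝ (n + I.length : ℕ) f x) :
    ContDiffAt ℝ n (zPow I f) x := by
  induction I generalizing n with
  | nil => simpa [zPow] using hf
  | cons a I ih => exact contDiffAt_zApply (ih (by convert hf using 2; simp; ring)) a

theorem eventually_differentiableAt (hf : ContDiffAt ℝ (n + 1 : ℕ) f x) :
    ∀ᶠ y in 𝓝 x, DifferentiableAt ℝ f y := by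
  filter_upwards [hf.eventually (by simp)] with y hy
  exact hy.differentiableAt (by simp)

theorem zApply_congr (a : ZLabel) (h : f =ᶠ[𝓝 x] g) : zApply a f =ᶠ[𝓝 x] zApply a g := by
  filter_upwards [h.fderiv (𝕜 := ℝ)] with y hy
  simp only [zApply, hy]

theorem pd_congr (α : Fin 4) (h : f =ᶠ[𝓝 x] g) : pd α f =ᶠ[𝓝 x] pd α g := by
  filter_upwards [h.fderiv (𝕜 := ℝ)] with y hy
  simp only [pd, hy]

theorem zPow_congr (I : MultiIndex) (h : f =ᶠ[𝓝 x] g) : zPow I f =ᶠ[𝓝 x] zPow I g := by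
  induction I with
  | nil => exact h
  | cons a I ih => exact zApply_congr a ih

theorem zPow_append_singleton (I : MultiIndex) (a : ZLabel) (f : Spacetime → ℝ) :
    zPow (I ++ [a]) f = zPow I (zApply a f) := by
  simp [zPow]

theorem zApply_add (a : ZLabel) (hf : DifferentiableAt ℝ f x) (hg : DifferentiableAt ℝ g x) :
    zApply a (fun y => f y + g y) x = zApply a f x + zApply a g x := by
  simp only [zApply]
  rw [fderiv_fun_add hf hg]; rfl

theorem zApply_mul (a : ZLabel) (hf : DifferentiableAt ℝ f x) (hg : DifferentiableAt ℝ g x) :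
    zApply a (fun y => f y * g y) x = zApply a f x * g x + f x * zApply a g x := by
  simp only [zApply]
  rw [fderiv_fun_mul hf hg]; simp; ring

theorem zApply_const_mul (a : ZLabel) (c : ℝ) (f : Spacetime → ℝ) :
    zApply a (fun y => c * f y) = fun y => c * zApply a f y := by
  funext x
  have := congrFun (fderiv_const_smul_field (𝕜 := ℝ) (f := f) c) x
  simp only [zApply]
  change fderiv ℝ (c • f) x _ = _
  rw [this]; simp

theorem zApply_const (a : ZLabel) (c : ℝ) : zApply a (fun _ => c) = fun _ => 0 := by
  funext x
  simp [zApply]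

theorem pd_add (α : Fin 4) (hf : DifferentiableAt ℝ f x) (hg : DifferentiableAt ℝ g x) :
    pd α (fun y => f y + g y) x = pd α f x + pd α g x := by
  simp only [pd]
  rw [fderiv_fun_add hf hg]; rfl

theorem pd_const_mul (α : Fin 4) (c : ℝ) (f : Spacetime → ℝ) :
    pd α (fun y => c * f y) = fun y => c * pd α f y := by
  funext x
  have := congrFun (fderiv_const_smul_field (𝕜 := ℝ) (f := f) c) x
  simp only [pd]
  change fderiv ℝ (c • f) x _ = _
  rw [this]; simp

theorem pd_sum {ι : Type*} (s : Finset ι) (α : Fin 4) {F : ι → Spacetime → ℝ}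
    (hF : ∀ i ∈ s, DifferentiableAt ℝ (F i) x) :
    pd α (fun y => ∑ i ∈ s, F i y) x = ∑ i ∈ s, pd α (F i) x := by
  simp only [pd]
  rw [fderiv_fun_sum hF]; simp

theorem zApply_sum {ι : Type*} (s : Finset ι) (a : ZLabel) {F : ι → Spacetime → ℝ}
    (hF : ∀ i ∈ s, DifferentiableAt ℝ (F i) x) :
    zApply a (fun y => ∑ i ∈ s, F i y) x = ∑ i ∈ s, zApply a (F i) x := by
  simp only [zApply]
  rw [fderiv_fun_sum hF]; simp

/-- The commutator of a vector field with a coordinate derivative is a combination of coordinate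
derivatives with constant coefficients. -/
theorem pd_zApply (hf : ContDiffAt ℝ 2 f x) (a : ZLabel) (α : Fin 4) :
    pd α (zApply a f) x = zApply a (pd α f) x + ∑ μ, zLin a α μ * pd μ f x := by
  have hd : DifferentiableAt ℝ (fderiv ℝ f) x :=
    (hf.fderiv_right (m := 1) (by norm_num)).differentiableAt (by simp)
  have h1 := (hd.hasFDerivAt.clm_apply (hasFDerivAt_zField a x)).fderiv
  have h2 := (hd.hasFDerivAt.clm_apply
    (hasFDerivAt_const (Pi.single α 1 : Spacetime) x)).fderiv
  have hsymm : IsSymmSndFDerivAt ℝ f x :=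
    hf.isSymmSndFDerivAt (by simp)
  have e1 : pd α (zApply a f) x = _ := congrArg (fun T => T (Pi.single α 1)) h1
  have e2 : zApply a (pd α f) x = _ := congrArg (fun T => T (zField a x)) h2
  rw [e1, e2]
  simp only [_root_.add_apply, ContinuousLinearMap.comp_apply,
    ContinuousLinearMap.flip_apply, _root_.zero_apply, map_zero, zero_add]
  rw [hsymm.eq, fderiv_apply_eq_sum, add_comm]
  simp

theorem zPow_add (I : MultiIndex) (hf : ContDiffAt ℝ I.length f x)
    (hg : ContDiffAt ℝ I.length g x) :
    zPow I (fun y => f y + g y) x = zPow I f x + zPow I g x := by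
  induction I using List.reverseRecOn generalizing f g with
  | nil => rfl
  | append_singleton I a ih =>
    simp only [List.length_append, List.length_singleton] at hf hg
    simp only [zPow_append_singleton]
    rw [← ih (contDiffAt_zApply hf a) (contDiffAt_zApply hg a)]
    refine (zPow_congr I ?_).self_of_nhds
    filter_upwards [eventually_differentiableAt hf, eventually_differentiableAt hg] with y h1 h2
    exact zApply_add a h1 h2

theorem zPow_const_mul (I : MultiIndex) (c : ℝ) (f : Spacetime → ℝ) :
    zPow I (fun y => c * f y) = fun y => c * zPow I f y := by
  induction I with
  | nil => rfl
  | cons a I ih =>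
    change zApply a (zPow I _) = fun y => c * zApply a (zPow I f) y
    rw [ih, zApply_const_mul]

theorem zPow_zero (I : MultiIndex) : zPow I (fun _ => (0 : ℝ)) = fun _ => 0 := by
  simpa using zPow_const_mul I 0 (fun _ => 0)

theorem zPow_const_isConst (I : MultiIndex) (c : ℝ) :
    ∃ d : ℝ, zPow I (fun _ => c) = fun _ => d := by
  induction I with
  | nil => exact ⟨c, rfl⟩
  | cons a I ih =>
    obtain ⟨d, hd⟩ := ih
    refine ⟨0, ?_⟩
    change zApply a (zPow I _) = _
    rw [hd, zApply_const]

theorem zPow_sum {ι : Type*} (s : Finset ι) (I : MultiIndex) {F : ι → Spacetime → ℝ}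
    (hF : ∀ i ∈ s, ContDiffAt ℝ I.length (F i) x) :
    zPow I (fun y => ∑ i ∈ s, F i y) x = ∑ i ∈ s, zPow I (F i) x := by
  classical
  induction s using Finset.induction_on with
  | empty => simp [zPow_zero]
  | insert i s hi ih =>
    simp only [Finset.sum_insert hi]
    rw [zPow_add I (hF i (by simp)) (ContDiffAt.sum fun j hj => hF j (by simp [hj])),
      ih fun j hj => hF j (by simp [hj])]

end Regularity

/-- The conformal weight of a vector field of the family: `∂_α Z_β + ∂_β Z_α = 2 s m_{αβ}`. It is
one for the scaling field, and zero for the others, which are Killing. -/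
def zWeight : ZLabel → ℝ
  | .inr (.inr _) => 1
  | _ => 0

/-- The trace-free part of `∂_α Z^μ`, an element of the Lie algebra of the Lorentz group. -/
def zRot (a : ZLabel) : Matrix (Fin 4) (Fin 4) ℝ := zLin a - zWeight a • 1

theorem zRot_skew (a : ZLabel) : zRot a * mink + (zRot a * mink)ᵀ = 0 := by
  ext μ ν
  rcases a with α | ⟨⟨i, j⟩, hij⟩ | u
  · simp [zRot, zWeight, zLin, zField, mink]
  · simp only [zRot, zWeight, zField, zLin, mink]
    fin_cases i <;> fin_cases j <;> fin_cases μ <;> fin_cases ν <;>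
      simp [Matrix.mulVec_diagonal] at hij ⊢
  · have : zRot (.inr (.inr u)) = 0 := by
      ext α β
      simp [zRot, zWeight, zLin, zField, Matrix.one_apply, Pi.single_apply, eq_comm]
    simp [this]

/-! ### Bounds for families of functions -/

section Families

variable {Ω : Type*} {x : Ω → Spacetime} {g : Ω → ℝ}

/-- The Leibniz rule: `Z^I (f₁ f₂)` is bounded if all products `Z^J f₁ Z^K f₂` are. -/
theorem isBigO_zPow_mul (I : MultiIndex) {f₁ f₂ : Ω → Spacetime → ℝ}
    (h₁ : ∀ ω, ContDiffAt ℝ I.length (f₁ ω) (x ω)) (h₂ : ∀ ω, ContDiffAt ℝ I.length (f₂ ω) (x ω))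
    (H : ∀ J K : MultiIndex, J.length + K.length ≤ I.length →
      (fun ω => zPow J (f₁ ω) (x ω) * zPow K (f₂ ω) (x ω)) =O[⊤] g) :
    (fun ω => zPow I (fun y => f₁ ω y * f₂ ω y) (x ω)) =O[⊤] g := by
  induction I using List.reverseRecOn generalizing f₁ f₂ with
  | nil => exact H [] [] (by simp)
  | append_singleton I a ih =>
    simp only [List.length_append, List.length_singleton] at h₁ h₂ H
    have key : ∀ ω, zPow (I ++ [a]) (fun y => f₁ ω y * f₂ ω y) (x ω) =
        zPow I (fun y => zApply a (f₁ ω) y * f₂ ω y) (x ω)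
          + zPow I (fun y => f₁ ω y * zApply a (f₂ ω) y) (x ω) := by
      intro ω
      have r₁ := contDiffAt_zApply (h₁ ω) a
      have r₂ := contDiffAt_zApply (h₂ ω) a
      rw [zPow_append_singleton, ← zPow_add I (r₁.mul ((h₂ ω).of_le (by norm_cast; lia)))
        (((h₁ ω).of_le (by norm_cast; lia)).mul r₂)]
      refine (zPow_congr I ?_).self_of_nhds
      filter_upwards [eventually_differentiableAt (h₁ ω), eventually_differentiableAt (h₂ ω)]
        with y e₁ e₂
      exact zApply_mul a e₁ e₂
    simp only [key]
    refine (ih (fun ω => contDiffAt_zApply (h₁ ω) a)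
      (fun ω => (h₂ ω).of_le (by norm_cast; lia)) fun J K hJK => ?_).add
      (ih (fun ω => (h₁ ω).of_le (by norm_cast; lia))
        (fun ω => contDiffAt_zApply (h₂ ω) a) fun J K hJK => ?_)
    · simpa only [zPow_append_singleton] using
        H (J ++ [a]) K (by simp only [List.length_append, List.length_singleton]; lia)
    · simpa only [zPow_append_singleton] using
        H J (K ++ [a]) (by simp only [List.length_append, List.length_singleton]; lia)

theorem isBigO_zPow_sum {ι : Type*} (s : Finset ι) (I : MultiIndex)
    {F : ι → Ω → Spacetime → ℝ} (hF : ∀ i ∈ s, ∀ ω, ContDiffAt ℝ I.length (F i ω) (x ω))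
    (H : ∀ i ∈ s, (fun ω => zPow I (F i ω) (x ω)) =O[⊤] g) :
    (fun ω => zPow I (fun y => ∑ i ∈ s, F i ω y) (x ω)) =O[⊤] g := by
  have key : ∀ ω, zPow I (fun y => ∑ i ∈ s, F i ω y) (x ω) = ∑ i ∈ s, zPow I (F i ω) (x ω) :=
    fun ω => zPow_sum s I fun i hi => hF i hi ω
  simp only [key]
  exact IsBigO.fun_sum H

theorem isBigO_zPow_add (I : MultiIndex) {f₁ f₂ : Ω → Spacetime → ℝ}
    (h₁ : ∀ ω, ContDiffAt ℝ I.length (f₁ ω) (x ω)) (h₂ : ∀ ω, ContDiffAt ℝ I.length (f₂ ω) (x ω))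
    (H₁ : (fun ω => zPow I (f₁ ω) (x ω)) =O[⊤] g)
    (H₂ : (fun ω => zPow I (f₂ ω) (x ω)) =O[⊤] g) :
    (fun ω => zPow I (fun y => f₁ ω y + f₂ ω y) (x ω)) =O[⊤] g := by
  simp only [fun ω => zPow_add I (h₁ ω) (h₂ ω)]
  exact H₁.add H₂

theorem isBigO_zPow_const_mul (I : MultiIndex) (c : ℝ) {f : Ω → Spacetime → ℝ}
    (H : (fun ω => zPow I (f ω) (x ω)) =O[⊤] g) :
    (fun ω => zPow I (fun y => c * f ω y) (x ω)) =O[⊤] g := by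
  simp only [zPow_const_mul]
  exact H.const_mul_left c

/-- Up to derivatives of lower order, `Z^I` can be moved past a coordinate derivative. -/
theorem isBigO_zPow_pd (I : MultiIndex) (α : Fin 4) {u : Ω → Spacetime → ℝ}
    (hu : ∀ ω, ContDiffAt ℝ (I.length + 1 : ℕ) (u ω) (x ω))
    (H : ∀ J : MultiIndex, J.length ≤ I.length → ∀ β,
      (fun ω => pd β (zPow J (u ω)) (x ω)) =O[⊤] g) :
    (fun ω => zPow I (pd α (u ω)) (x ω)) =O[⊤] g := by
  induction I using List.reverseRecOn generalizing u α with
  | nil => exact H [] (by simp) α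
  | append_singleton I a ih =>
    simp only [List.length_append, List.length_singleton] at hu H
    have key : ∀ ω, zPow (I ++ [a]) (pd α (u ω)) (x ω) = zPow I (pd α (zApply a (u ω))) (x ω)
        + ∑ μ, -zLin a α μ * zPow I (pd μ (u ω)) (x ω) := by
      intro ω
      have r : ∀ μ, ContDiffAt ℝ I.length (pd μ (u ω)) (x ω) :=
        fun μ => contDiffAt_pd ((hu ω).of_le (by norm_cast; lia)) μ
      have e : ∀ μ, -zLin a α μ * zPow I (pd μ (u ω)) (x ω)
          = zPow I (fun y => -zLin a α μ * pd μ (u ω) y) (x ω) := by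
        intro μ; rw [zPow_const_mul]
      simp only [e]
      rw [zPow_append_singleton, ← zPow_sum _ _ fun μ _ => contDiffAt_const.mul (r μ), ← zPow_add I
        (contDiffAt_pd (contDiffAt_zApply (hu ω) a) α)
        (ContDiffAt.sum fun μ _ => contDiffAt_const.mul (r μ))]
      refine (zPow_congr I ?_).self_of_nhds
      filter_upwards [(hu ω).eventually (by simp)] with y hy
      rw [pd_zApply (hy.of_le (by norm_cast; lia)) a α, add_assoc, ← Finset.sum_add_distrib]
      simp
    simp only [key]
    refine (ih α (fun ω => contDiffAt_zApply (hu ω) a) fun J hJ β => ?_).add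
      (IsBigO.fun_sum fun μ _ => IsBigO.const_mul_left (ih μ
        (fun ω => (hu ω).of_le (by norm_cast; lia)) fun J hJ β => H J (by lia) β) _)
    simpa only [zPow_append_singleton] using
      H (J ++ [a]) (by simp only [List.length_append, List.length_singleton]; lia) β

/-- The value of the bilinear form `b ⊗ N` on two tuples of covectors. -/
def gradForm {ι κ : Type*} [Fintype ι] [Fintype κ] (b : ι → κ → ℝ) (N : Matrix (Fin 4) (Fin 4) ℝ)
    (ξ : ι → Fin 4 → ℝ) (η : κ → Fin 4 → ℝ) : ℝ :=
  ∑ i, ∑ j, b i j * (ξ i ⬝ᵥ N *ᵥ η j)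

theorem zApply_dotProduct_mulVec (a : ZLabel) (N : Matrix (Fin 4) (Fin 4) ℝ) {u v : Spacetime → ℝ}
    {y : Spacetime} (hu : ContDiffAt ℝ 2 u y) (hv : ContDiffAt ℝ 2 v y) :
    zApply a (fun z => (fun α => pd α u z) ⬝ᵥ N *ᵥ fun β => pd β v z) y =
      (fun α => pd α (zApply a u) y) ⬝ᵥ N *ᵥ (fun β => pd β v y)
      + (fun α => pd α u y) ⬝ᵥ N *ᵥ (fun β => pd β (zApply a v) y)
      - (fun α => pd α u y) ⬝ᵥ ((zLin a)ᵀ * N + N * zLin a) *ᵥ (fun β => pd β v y) := by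
  have du : ∀ α, DifferentiableAt ℝ (pd α u) y :=
    fun α => (contDiffAt_pd (n := 1) hu α).differentiableAt (by simp)
  have dv : ∀ α, DifferentiableAt ℝ (pd α v) y :=
    fun α => (contDiffAt_pd (n := 1) hv α).differentiableAt (by simp)
  have e1 : zApply a (fun z => (fun α => pd α u z) ⬝ᵥ N *ᵥ fun β => pd β v z) y =
      (fun α => zApply a (pd α u) y) ⬝ᵥ N *ᵥ (fun β => pd β v y)
      + (fun α => pd α u y) ⬝ᵥ N *ᵥ (fun β => zApply a (pd β v) y) := by
    simp only [dotProduct, Matrix.mulVec]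
    rw [zApply_sum _ _ fun α _ => by fun_prop, ← Finset.sum_add_distrib]
    refine Finset.sum_congr rfl fun α _ => ?_
    rw [zApply_mul a (du α) (by fun_prop), zApply_sum _ _ fun α _ => by fun_prop]
    congr 2
    refine Finset.sum_congr rfl fun β _ => ?_
    rw [zApply_const_mul]
  have e2 : ∀ w : Spacetime → ℝ, ContDiffAt ℝ 2 w y → (fun α => zApply a (pd α w) y) =
      (fun α => pd α (zApply a w) y) - zLin a *ᵥ fun α => pd α w y := by
    intro w hw
    funext α
    simp only [Pi.sub_apply, pd_zApply hw a α, Matrix.mulVec, dotProduct]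
    ring
  rw [e1, e2 u hu, e2 v hv, sub_dotProduct, Matrix.mulVec_sub, dotProduct_sub, Matrix.add_mulVec,
    dotProduct_add, ← Matrix.mulVec_mulVec, ← Matrix.mulVec_mulVec, Matrix.dotProduct_mulVec _ (zLin a)ᵀ,
    Matrix.vecMul_transpose]
  ring

/-- Let `S` be a set of bilinear forms in two gradients that is invariant under the commutators of
the vector fields with the coordinate derivatives. If for all splittings of the derivatives `Z^I`
over the two factors all forms in `S` are bounded by `g`, then so are the derivatives `Z^I` of
these forms. -/
theorem isBigO_zPow_gradForm {ι κ : Type*} [Fintype ι] [Fintype κ] (b : ι → κ → ℝ)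
    {S : Set (Matrix (Fin 4) (Fin 4) ℝ)} (hS : ∀ N ∈ S, ∀ a, (zLin a)ᵀ * N + N * zLin a ∈ S)
    (I : MultiIndex) {u : Ω → ι → Spacetime → ℝ} {v : Ω → κ → Spacetime → ℝ}
    (hu : ∀ ω i, ContDiffAt ℝ (I.length + 1 : ℕ) (u ω i) (x ω))
    (hv : ∀ ω j, ContDiffAt ℝ (I.length + 1 : ℕ) (v ω j) (x ω))
    (H : ∀ J K : MultiIndex, J.length + K.length ≤ I.length → ∀ N ∈ S,
      (fun ω => gradForm b N (fun i α => pd α (zPow J (u ω i)) (x ω))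
        (fun j α => pd α (zPow K (v ω j)) (x ω))) =O[⊤] g)
    (N : Matrix (Fin 4) (Fin 4) ℝ) (hN : N ∈ S) :
    (fun ω => zPow I (fun y => gradForm b N (fun i α => pd α (u ω i) y)
      (fun j α => pd α (v ω j) y)) (x ω)) =O[⊤] g := by
  induction I using List.reverseRecOn generalizing u v N with
  | nil => exact H [] [] (by simp) N hN
  | append_singleton I a ih =>
    simp only [List.length_append, List.length_singleton] at hu hv H
    have reg : ∀ (N' : Matrix (Fin 4) (Fin 4) ℝ) ω (u' : ι → Spacetime → ℝ)
        (v' : κ → Spacetime → ℝ), (∀ i, ContDiffAt ℝ (I.length + 1 : ℕ) (u' i) (x ω)) →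
        (∀ j, ContDiffAt ℝ (I.length + 1 : ℕ) (v' j) (x ω)) →
        ContDiffAt ℝ I.length (fun y => gradForm b N' (fun i α => pd α (u' i) y)
          (fun j α => pd α (v' j) y)) (x ω) := by
      intro N' ω u' v' hu' hv'
      simp only [gradForm, dotProduct, Matrix.mulVec]
      exact ContDiffAt.sum fun i _ => ContDiffAt.sum fun j _ => contDiffAt_const.mul <|
        ContDiffAt.sum fun α _ => (contDiffAt_pd (hu' i) α).mul <|
        ContDiffAt.sum fun β _ => contDiffAt_const.mul (contDiffAt_pd (hv' j) β)
    have lu : ∀ ω i, ContDiffAt ℝ (I.length + 1 : ℕ) (u ω i) (x ω) :=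
      fun ω i => (hu ω i).of_le (by norm_cast; lia)
    have lv : ∀ ω i, ContDiffAt ℝ (I.length + 1 : ℕ) (v ω i) (x ω) :=
      fun ω i => (hv ω i).of_le (by norm_cast; lia)
    have key : ∀ ω, zPow (I ++ [a]) (fun y => gradForm b N (fun i α => pd α (u ω i) y)
          (fun j α => pd α (v ω j) y)) (x ω) =
        zPow I (fun y => gradForm b N (fun i α => pd α (zApply a (u ω i)) y)
            (fun j α => pd α (v ω j) y)) (x ω)
          + zPow I (fun y => gradForm b N (fun i α => pd α (u ω i) y)
            (fun j α => pd α (zApply a (v ω j)) y)) (x ω)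
          + -1 * zPow I (fun y => gradForm b ((zLin a)ᵀ * N + N * zLin a)
            (fun i α => pd α (u ω i) y) (fun j α => pd α (v ω j) y)) (x ω) := by
      intro ω
      have r₁ := reg N ω _ _ (fun i => contDiffAt_zApply (hu ω i) a) (lv ω)
      have r₂ := reg N ω _ _ (lu ω) (fun i => contDiffAt_zApply (hv ω i) a)
      have r₃ := reg ((zLin a)ᵀ * N + N * zLin a) ω _ _ (lu ω) (lv ω)
      rw [zPow_append_singleton, ← congrFun (zPow_const_mul I (-1) _) (x ω), ← zPow_add I r₁ r₂,
        ← zPow_add I (r₁.add r₂) (contDiffAt_const.mul r₃)]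
      refine (zPow_congr I ?_).self_of_nhds
      filter_upwards [eventually_all.2 fun i => (hu ω i).eventually (by simp),
        eventually_all.2 fun i => (hv ω i).eventually (by simp)] with y hy hz
      have hy' : ∀ i, ContDiffAt ℝ 2 (u ω i) y := fun i => (hy i).of_le (by norm_cast; lia)
      have hz' : ∀ i, ContDiffAt ℝ 2 (v ω i) y := fun i => (hz i).of_le (by norm_cast; lia)
      have d : ∀ i j, DifferentiableAt ℝ
          (fun z => (fun α => pd α (u ω i) z) ⬝ᵥ N *ᵥ fun β => pd β (v ω j) z) y := by
        intro i j
        have du : ∀ α, DifferentiableAt ℝ (pd α (u ω i)) y :=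
          fun α => (contDiffAt_pd (n := 1) (hy' i) α).differentiableAt (by simp)
        have dv : ∀ α, DifferentiableAt ℝ (pd α (v ω j)) y :=
          fun α => (contDiffAt_pd (n := 1) (hz' j) α).differentiableAt (by simp)
        simp only [dotProduct, Matrix.mulVec]
        fun_prop
      simp only [gradForm, Finset.mul_sum, ← Finset.sum_add_distrib]
      rw [zApply_sum _ _ fun i _ => by fun_prop]
      refine Finset.sum_congr rfl fun i _ => ?_
      rw [zApply_sum _ _ fun i _ => by fun_prop]
      refine Finset.sum_congr rfl fun j _ => ?_
      rw [zApply_const_mul]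
      simp only [zApply_dotProduct_mulVec a N (hy' i) (hz' j)]
      ring
    simp only [key]
    refine ((ih (fun ω i => contDiffAt_zApply (hu ω i) a) lv (fun J K hJK M hM => ?_) N hN).add
      (ih lu (fun ω i => contDiffAt_zApply (hv ω i) a) (fun J K hJK M hM => ?_) N hN)).add
      (IsBigO.const_mul_left (ih lu lv (fun J K hJK M hM => H J K (by lia) M hM) _ (hS N hN a)) _)
    · simpa only [zPow_append_singleton] using
        H (J ++ [a]) K (by simp only [List.length_append, List.length_singleton]; lia) M hM
    · simpa only [zPow_append_singleton] using
        H J (K ++ [a]) (by simp only [List.length_append, List.length_singleton]; lia) M hM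

/-- The null forms: bilinear forms in two covectors whose symmetric part is a multiple of the
Minkowski metric. They are the ones that vanish on pairs of equal null covectors. -/
def nullForms : Set (Matrix (Fin 4) (Fin 4) ℝ) := {N | ∃ s : ℝ, N + Nᵀ = s • mink}

theorem commutator_mem_nullForms {N : Matrix (Fin 4) (Fin 4) ℝ} (hN : N ∈ nullForms) (a : ZLabel) :
    (zLin a)ᵀ * N + N * zLin a ∈ nullForms := by
  obtain ⟨s, hs⟩ := hN
  have hm : mink * mink = 1 := mink_mul_mink
  have ht : minkᵀ = mink := by simp [mink]
  -- `zRot a * mink` skew gives `mink * zRot a` skew by conjugation with `mink`.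
  have h1 : (zRot a)ᵀ * mink + mink * zRot a = 0 := by
    have h := zRot_skew a
    rw [Matrix.transpose_mul, ht] at h
    have h2 : mink * (zRot a * mink + mink * (zRot a)ᵀ) * mink = 0 := by rw [h]; simp
    rw [mul_add, add_mul, mul_assoc, mul_assoc, hm, ← mul_assoc mink mink, hm] at h2
    simpa [add_comm] using h2
  have h3 : (zLin a)ᵀ * mink + mink * zLin a = (2 * zWeight a) • mink := by
    have e : zLin a = zRot a + zWeight a • 1 := by simp [zRot]
    rw [e, Matrix.transpose_add, add_mul, mul_add, Matrix.transpose_smul, Matrix.transpose_one]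
    calc _ = ((zRot a)ᵀ * mink + mink * zRot a) + (2 * zWeight a) • mink := by
          simp [two_mul, add_smul]; abel
      _ = _ := by rw [h1, zero_add]
  refine ⟨s * (2 * zWeight a), ?_⟩
  calc _ = (zLin a)ᵀ * (N + Nᵀ) + (N + Nᵀ) * zLin a := by
        simp [mul_add, add_mul, Matrix.transpose_mul]; abel
    _ = _ := by
        rw [hs, mul_smul, ← h3]; simp

end Families

/-! ### The inverse metric -/

theorem abs_le_norm₂ (p : Fin 4 → Fin 4 → ℝ) (α β : Fin 4) : |p α β| ≤ norm₂ p := by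
  rw [norm₂, ← Real.sqrt_sq_eq_abs]
  refine Real.sqrt_le_sqrt ?_
  exact (Finset.single_le_sum (f := fun β => p α β ^ 2) (fun _ _ => sq_nonneg _)
    (Finset.mem_univ β)).trans (Finset.single_le_sum (f := fun α => ∑ β, p α β ^ 2)
    (fun _ _ => Finset.sum_nonneg fun _ _ => sq_nonneg _) (Finset.mem_univ α))

theorem abs_le_norm₃ (p : Fin 4 → Fin 4 → Fin 4 → ℝ) (α β γ : Fin 4) :
    |p α β γ| ≤ norm₃ p := by
  rw [norm₃, ← Real.sqrt_sq_eq_abs]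
  refine Real.sqrt_le_sqrt ?_
  exact (Finset.single_le_sum (f := fun γ => p α β γ ^ 2) (fun _ _ => sq_nonneg _)
    (Finset.mem_univ γ)).trans <| (Finset.single_le_sum (f := fun β => ∑ γ, p α β γ ^ 2)
    (fun _ _ => Finset.sum_nonneg fun _ _ => sq_nonneg _) (Finset.mem_univ β)).trans <|
    Finset.single_le_sum (f := fun α => ∑ β, ∑ γ, p α β γ ^ 2)
    (fun _ _ => Finset.sum_nonneg fun _ _ => Finset.sum_nonneg fun _ _ => sq_nonneg _)
    (Finset.mem_univ α)

section Frobenius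

open scoped Matrix.Norms.Frobenius

theorem norm₂_eq_norm (H : Matrix (Fin 4) (Fin 4) ℝ) : norm₂ H = ‖H‖ := by
  rw [Matrix.frobenius_norm_def, ← Real.sqrt_eq_rpow]
  simp [norm₂]

theorem norm_mink_mul (H : Matrix (Fin 4) (Fin 4) ℝ) : ‖mink * H‖ = ‖H‖ := by
  rw [← norm₂_eq_norm, ← norm₂_eq_norm]
  unfold norm₂
  congr 1
  refine Finset.sum_congr rfl fun α _ => Finset.sum_congr rfl fun β _ => ?_
  rw [mink, Matrix.diagonal_mul]
  fin_cases α <;> simp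

theorem isUnit_det_mink_add {H : Matrix (Fin 4) (Fin 4) ℝ} (hH : norm₂ H < 1) :
    IsUnit (mink + H).det := by
  rw [← Matrix.isUnit_iff_isUnit_det]
  have e : mink + H = mink * (1 - -(mink * H)) := by
    rw [sub_neg_eq_add, mul_add, ← mul_assoc, mink_mul_mink]; simp
  rw [e]
  refine IsUnit.mul ⟨⟨mink, mink, mink_mul_mink, mink_mul_mink⟩, rfl⟩
    (isUnit_one_sub_of_norm_lt_one ?_)
  rw [norm_neg, norm_mink_mul, ← norm₂_eq_norm]
  exact hH

theorem gInv_mul {H : Matrix (Fin 4) (Fin 4) ℝ} (hH : IsUnit (mink + H).det) :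
    gInv H * (mink + H) = 1 := Matrix.nonsing_inv_mul _ hH

theorem mul_gInv {H : Matrix (Fin 4) (Fin 4) ℝ} (hH : IsUnit (mink + H).det) :
    (mink + H) * gInv H = 1 := Matrix.mul_nonsing_inv _ hH

/-- The resolvent identity for the inverse metric. -/
theorem gInv_eq {H : Matrix (Fin 4) (Fin 4) ℝ} (hH : IsUnit (mink + H).det) :
    gInv H = mink - mink * H * gInv H := by
  have h := congrArg (fun X => mink * X) (mul_gInv hH)
  simp only [add_mul, mul_add, mul_one, ← mul_assoc, mink_mul_mink, one_mul] at h
  exact eq_sub_of_add_eq h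

theorem abs_gInv_le {H : Matrix (Fin 4) (Fin 4) ℝ} {c : ℝ} (hH : norm₂ H ≤ c) (hc : c < 1)
    (α β : Fin 4) : |gInv H α β| ≤ ‖mink‖ / (1 - c) := by
  have hu := isUnit_det_mink_add (hH.trans_lt hc)
  refine (abs_le_norm₂ (gInv H) α β).trans ?_
  rw [norm₂_eq_norm, le_div_iff₀ (by linarith)]
  rw [norm₂_eq_norm] at hH
  have h1 : ‖gInv H‖ ≤ ‖mink‖ + ‖H‖ * ‖gInv H‖ := by
    conv_lhs => rw [gInv_eq hu, mul_assoc]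
    refine (norm_sub_le _ _).trans ?_
    rw [norm_mink_mul]
    exact add_le_add le_rfl (norm_mul_le _ _)
  nlinarith [norm_nonneg (gInv H)]

end Frobenius

section Regularity

variable {h : TwoTensorField} {x : Spacetime} {n : ℕ}

theorem contDiffAt_det {M : Spacetime → Matrix (Fin 4) (Fin 4) ℝ}
    (hM : ∀ α β, ContDiffAt ℝ n (fun y => M y α β) x) : ContDiffAt ℝ n (fun y => (M y).det) x := by
  simp only [Matrix.det_apply]
  refine ContDiffAt.sum fun σ _ => ContDiffAt.const_smul _ ?_
  exact contDiffAt_prod fun i _ => hM _ _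

theorem contDiffAt_gInv (hh : ∀ μ ν, ContDiffAt ℝ n (h μ ν) x)
    (hu : IsUnit (mink + val₂ h x).det) (α β : Fin 4) :
    ContDiffAt ℝ n (fun y => gInv (val₂ h y) α β) x := by
  have hM : ∀ α β, ContDiffAt ℝ n (fun y => (mink + val₂ h y) α β) x :=
    fun α β => contDiffAt_const.add (hh α β)
  have e : (fun y => gInv (val₂ h y) α β) =
      fun y => ((mink + val₂ h y).det)⁻¹ * (mink + val₂ h y).adjugate α β := by
    funext y
    rw [gInv, Matrix.inv_def, Matrix.smul_apply, smul_eq_mul, Ring.inverse_eq_inv']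
  rw [e]
  refine ((contDiffAt_det hM).inv hu.ne_zero).mul ?_
  simp only [Matrix.adjugate_apply]
  refine contDiffAt_det fun i j => ?_
  simp only [Matrix.updateRow_apply]
  split_ifs
  · exact contDiffAt_const
  · exact hM i j

theorem eventually_isUnit_det (hh : ∀ μ ν, ContDiffAt ℝ n (h μ ν) x)
    (hu : IsUnit (mink + val₂ h x).det) : ∀ᶠ y in 𝓝 x, IsUnit (mink + val₂ h y).det := by
  have hM : ∀ α β, ContDiffAt ℝ n (fun y => (mink + val₂ h y) α β) x :=
    fun α β => contDiffAt_const.add (hh α β)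
  filter_upwards [(contDiffAt_det hM).continuousAt.eventually_ne hu.ne_zero] with y hy
  exact isUnit_iff_ne_zero.2 hy

/-- `Z g⁻¹ = - g⁻¹ (Z h) g⁻¹`. -/
theorem zApply_gInv (hh : ∀ μ ν, ContDiffAt ℝ (n + 1 : ℕ) (h μ ν) x)
    (hu : IsUnit (mink + val₂ h x).det) (a : ZLabel) (α β : Fin 4) :
    zApply a (fun y => gInv (val₂ h y) α β) x =
      ∑ μ, ∑ ν, -1 * (gInv (val₂ h x) α μ * (zApply a (h μ ν) x * gInv (val₂ h x) ν β)) := by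
  have dh : ∀ μ ν, DifferentiableAt ℝ (h μ ν) x := fun μ ν => (hh μ ν).differentiableAt (by simp)
  have dg : ∀ μ ν, DifferentiableAt ℝ (fun y => gInv (val₂ h y) μ ν) x :=
    fun μ ν => (contDiffAt_gInv hh hu μ ν).differentiableAt (by simp)
  set Zh : Matrix (Fin 4) (Fin 4) ℝ := Matrix.of fun μ ν => zApply a (h μ ν) x with hZh
  set Zg : Matrix (Fin 4) (Fin 4) ℝ :=
    Matrix.of fun μ ν => zApply a (fun y => gInv (val₂ h y) μ ν) x with hZg
  have h1 : Zg * (mink + val₂ h x) + gInv (val₂ h x) * Zh = 0 := by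
    ext μ ν
    have e1 : (fun y => ∑ l, gInv (val₂ h y) μ l * (mink l ν + h l ν y)) =ᶠ[𝓝 x]
        fun _ => (1 : Matrix (Fin 4) (Fin 4) ℝ) μ ν := by
      filter_upwards [eventually_isUnit_det hh hu] with y hy
      rw [← gInv_mul hy, Matrix.mul_apply]
      rfl
    have e2 := (zApply_congr a e1).self_of_nhds
    rw [zApply_const, zApply_sum _ _ fun l _ => by fun_prop] at e2
    rw [Matrix.add_apply, Matrix.mul_apply, Matrix.mul_apply, ← Finset.sum_add_distrib,
      Matrix.zero_apply]
    refine Eq.trans (Finset.sum_congr rfl fun l _ => ?_) e2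
    rw [zApply_mul a (dg μ l) (by fun_prop),
      zApply_add a (by fun_prop) (dh l ν), zApply_const]
    simp [hZg, hZh, val₂]
  have h2 : Zg = -(gInv (val₂ h x) * (Zh * gInv (val₂ h x))) := by
    have e := congrArg (fun X => X * gInv (val₂ h x)) h1
    simp only [add_mul, mul_assoc, mul_gInv hu, mul_one, zero_mul] at e
    exact eq_neg_of_add_eq_zero_left e
  have h3 := congrFun (congrFun h2 α) β
  simp only [hZg, Matrix.of_apply] at h3
  rw [h3, Matrix.neg_apply, Matrix.mul_apply, ← Finset.sum_neg_distrib]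
  refine Finset.sum_congr rfl fun μ _ => ?_
  rw [Matrix.mul_apply, Finset.mul_sum, ← Finset.sum_neg_distrib]
  refine Finset.sum_congr rfl fun ν _ => ?_
  simp [hZh]

end Regularity

section Families

variable {Ω : Type*} {x : Ω → Spacetime} {h : Ω → TwoTensorField} {n : ℕ}

theorem isBigO_one_mul {f₁ f₂ : Ω → ℝ} (h₁ : f₁ =O[⊤] fun _ => (1 : ℝ))
    (h₂ : f₂ =O[⊤] fun _ => (1 : ℝ)) : (fun ω => f₁ ω * f₂ ω) =O[⊤] fun _ => (1 : ℝ) := by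
  simpa using h₁.mul h₂

/-- The derivatives of the inverse metric are bounded if those of `h` are, by induction from
`Z g⁻¹ = - g⁻¹ (Z h) g⁻¹`. -/
theorem isBigO_zPow_gInv (hh : ∀ ω μ ν, ContDiffAt ℝ n (h ω μ ν) (x ω))
    (hu : ∀ ω, IsUnit (mink + val₂ (h ω) (x ω)).det)
    (h0 : ∀ α β, (fun ω => gInv (val₂ (h ω) (x ω)) α β) =O[⊤] fun _ => (1 : ℝ))
    (hb : ∀ J : MultiIndex, J.length ≤ n → ∀ μ ν,
      (fun ω => zPow J (h ω μ ν) (x ω)) =O[⊤] fun _ => (1 : ℝ))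
    (J : MultiIndex) (hJ : J.length ≤ n) (α β : Fin 4) :
    (fun ω => zPow J (fun y => gInv (val₂ (h ω) y) α β) (x ω)) =O[⊤] fun _ => (1 : ℝ) := by
  induction hm : J.length using Nat.strong_induction_on generalizing J α β with
  | _ m ih =>
    rcases List.eq_nil_or_concat J with rfl | ⟨J, a, rfl⟩
    · exact h0 α β
    simp only [List.concat_eq_append, List.length_append, List.length_singleton] at hJ hm ⊢
    have rh : ∀ ω μ ν, ContDiffAt ℝ (J.length + 1 : ℕ) (h ω μ ν) (x ω) :=
      fun ω μ ν => (hh ω μ ν).of_le (by exact_mod_cast hJ)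
    have rz : ∀ ω μ ν, ContDiffAt ℝ J.length (zApply a (h ω μ ν)) (x ω) :=
      fun ω μ ν => contDiffAt_zApply (rh ω μ ν) a
    have rg : ∀ ω μ ν, ContDiffAt ℝ J.length (fun y => gInv (val₂ (h ω) y) μ ν) (x ω) :=
      fun ω μ ν => contDiffAt_gInv (fun μ ν => (rh ω μ ν).of_le (by norm_cast; lia)) (hu ω) μ ν
    have key : ∀ ω, zPow (J ++ [a]) (fun y => gInv (val₂ (h ω) y) α β) (x ω) =
        zPow J (fun y => ∑ μ, ∑ ν, -1 * (gInv (val₂ (h ω) y) α μ *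
          (zApply a (h ω μ ν) y * gInv (val₂ (h ω) y) ν β))) (x ω) := by
      intro ω
      rw [zPow_append_singleton]
      refine (zPow_congr J ?_).self_of_nhds
      filter_upwards [eventually_isUnit_det (hh ω) (hu ω), eventually_all.2 fun μ =>
        eventually_all.2 fun ν => (rh ω μ ν).eventually (by simp)] with y hy hy'
      exact zApply_gInv hy' hy a α β
    simp only [key]
    have hg : ∀ K : MultiIndex, K.length ≤ J.length → ∀ α β,
        (fun ω => zPow K (fun y => gInv (val₂ (h ω) y) α β) (x ω)) =O[⊤] fun _ => (1 : ℝ) :=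
      fun K hK α β => ih K.length (by lia) K (by lia) α β rfl
    refine isBigO_zPow_sum _ _ (fun μ _ ω => ContDiffAt.sum fun ν _ => contDiffAt_const.mul
      ((rg ω _ _).mul ((rz ω _ _).mul (rg ω _ _)))) fun μ _ => ?_
    refine isBigO_zPow_sum _ _ (fun ν _ ω => contDiffAt_const.mul
      ((rg ω _ _).mul ((rz ω _ _).mul (rg ω _ _)))) fun ν _ => ?_
    refine isBigO_zPow_const_mul _ _ (isBigO_zPow_mul _ (fun ω => rg ω _ _)
      (fun ω => (rz ω _ _).mul (rg ω _ _)) fun K L hKL => ?_)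
    refine isBigO_one_mul (hg K (by lia) _ _) (isBigO_zPow_mul _
      (fun ω => (rz ω _ _).of_le (by norm_cast; lia))
      (fun ω => (rg ω _ _).of_le (by norm_cast; lia)) fun L₁ L₂ hL => ?_)
    refine isBigO_one_mul ?_ (hg L₂ (by lia) _ _)
    simpa only [zPow_append_singleton] using
      hb (L₁ ++ [a]) (by simp only [List.length_append, List.length_singleton]; lia) μ ν

/-- The derivatives of `g⁻¹ - m⁻¹ = - m⁻¹ h g⁻¹` are bounded by those of `h`. -/
theorem isBigO_zPow_gInv_sub_mink {g : Ω → ℝ} (J : MultiIndex)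
    (hh : ∀ ω μ ν, ContDiffAt ℝ J.length (h ω μ ν) (x ω))
    (hu : ∀ ω, IsUnit (mink + val₂ (h ω) (x ω)).det)
    (hg : ∀ K : MultiIndex, K.length ≤ J.length → ∀ α β,
      (fun ω => zPow K (fun y => gInv (val₂ (h ω) y) α β) (x ω)) =O[⊤] fun _ => (1 : ℝ))
    (H : ∀ K : MultiIndex, K.length ≤ J.length → ∀ μ ν,
      (fun ω => zPow K (h ω μ ν) (x ω)) =O[⊤] g) (α β : Fin 4) :
    (fun ω => zPow J (fun y => gInv (val₂ (h ω) y) α β - mink α β) (x ω)) =O[⊤] g := by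
  have rg : ∀ ω μ ν, ContDiffAt ℝ J.length (fun y => gInv (val₂ (h ω) y) μ ν) (x ω) :=
    fun ω μ ν => contDiffAt_gInv (hh ω) (hu ω) μ ν
  have key : ∀ ω, zPow J (fun y => gInv (val₂ (h ω) y) α β - mink α β) (x ω) =
      zPow J (fun y => ∑ μ, ∑ ν, -mink α μ * (h ω μ ν y * gInv (val₂ (h ω) y) ν β)) (x ω) := by
    intro ω
    refine (zPow_congr J ?_).self_of_nhds
    filter_upwards [eventually_isUnit_det (hh ω) (hu ω)] with y hy
    have e := congrFun (congrFun (gInv_eq hy) α) β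
    rw [Matrix.sub_apply, mul_assoc, Matrix.mul_apply] at e
    rw [e, sub_sub_cancel_left, ← Finset.sum_neg_distrib]
    refine Finset.sum_congr rfl fun μ _ => ?_
    rw [Matrix.mul_apply, Finset.mul_sum, ← Finset.sum_neg_distrib]
    refine Finset.sum_congr rfl fun ν _ => ?_
    simp [val₂]
  simp only [key]
  refine isBigO_zPow_sum _ _ (fun μ _ ω => ContDiffAt.sum fun ν _ => contDiffAt_const.mul
    ((hh ω _ _).mul (rg ω _ _))) fun μ _ => ?_
  refine isBigO_zPow_sum _ _ (fun ν _ ω => contDiffAt_const.mul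
    ((hh ω _ _).mul (rg ω _ _))) fun ν _ => ?_
  refine isBigO_zPow_const_mul _ _ (isBigO_zPow_mul _ (fun ω => hh ω _ _)
    (fun ω => rg ω _ _) fun K L hKL => ?_)
  simpa using (H K (by lia) μ ν).mul (hg L (by lia) ν β)

end Families

/-! ### Algebra of the null frame -/

instance : Fintype NullLabel := ⟨famU, fun V => by cases V <;> simp [famU]⟩

theorem sum_nullLabel {M : Type*} [AddCommMonoid M] (f : NullLabel → M) :
    ∑ V, f V = f .Lbar + (f .L + (f .S₁ + f .S₂)) := by
  have : (Finset.univ : Finset NullLabel) = {.Lbar, .L, .S₁, .S₂} := rfl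
  rw [this]
  simp

/-- The inverse of the Minkowski metric in the null frame. -/
def nullInv : NullLabel → NullLabel → ℝ
  | .L, .Lbar => -(1 / 2)
  | .Lbar, .L => -(1 / 2)
  | .S₁, .S₁ => 1
  | .S₂, .S₂ => 1
  | _, _ => 0

section Frame

variable {x S₁ S₂ : Spacetime}

theorem radial_sq_sum (hr : rad x ≠ 0) :
    radial x 1 ^ 2 + radial x 2 ^ 2 + radial x 3 ^ 2 = 1 := by
  have h : rad x ^ 2 = x 1 ^ 2 + x 2 ^ 2 + x 3 ^ 2 := Real.sq_sqrt (by positivity)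
  simp only [radial, Fin.isValue, one_ne_zero, if_false, Fin.reduceEq]
  field_simp
  rw [h]

theorem radial_zero : radial x 0 = 0 := by simp [radial]

theorem abs_radial_le (hr : rad x ≠ 0) (α : Fin 4) : |radial x α| ≤ 1 := by
  have h := radial_sq_sum hr
  rw [← sq_le_one_iff_abs_le_one]
  fin_cases α
  · simp [radial_zero]
  all_goals simp only [Fin.mk_one, Fin.reduceFinMk]; nlinarith [sq_nonneg (radial x 1),
    sq_nonneg (radial x 2), sq_nonneg (radial x 3)]

theorem dq_zero : dq x 0 = -1 := by simp [dq]

theorem dq_eq_radial {α : Fin 4} (hα : α ≠ 0) : dq x α = radial x α := by simp [dq, radial, hα]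

theorem abs_dq_le (hr : rad x ≠ 0) (α : Fin 4) : |dq x α| ≤ 1 := by
  by_cases hα : α = 0
  · simp [hα, dq_zero]
  · rw [dq_eq_radial hα]; exact abs_radial_le hr α

/-- The frame `∂_t, ∂_r, S₁, S₂` is complete: a matrix with orthonormal rows also has orthonormal
columns. -/
theorem IsSphereFrame.complete (hS : IsSphereFrame x S₁ S₂) (hr : rad x ≠ 0) (α β : Fin 4) :
    (1 : Matrix (Fin 4) (Fin 4) ℝ) α β = (Pi.single 0 1 : Spacetime) α * (Pi.single 0 1 : Spacetime) β
      + radial x α * radial x β + S₁ α * S₁ β + S₂ α * S₂ β := by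
  set O : Matrix (Fin 4) (Fin 4) ℝ := Matrix.of ![Pi.single 0 1, radial x, S₁, S₂] with hO
  have h := radial_sq_sum hr
  have h₁ := hS.radial₁
  have h₂ := hS.radial₂
  have u₁ := hS.unit₁
  have u₂ := hS.unit₂
  have o := hS.orth
  simp only [dotProduct, Fin.sum_univ_four, radial_zero, hS.time₁, hS.time₂] at h₁ h₂ u₁ u₂ o
  have h1 : O * Oᵀ = 1 := by
    ext i j
    rw [Matrix.mul_apply]
    fin_cases i <;> fin_cases j <;>
      simp [hO, Fin.sum_univ_four, radial_zero, hS.time₁, hS.time₂] <;> linarith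
  have h2 : Oᵀ * O = 1 := mul_eq_one_comm.1 h1
  rw [← h2, Matrix.mul_apply, Fin.sum_univ_four]
  simp [hO]

theorem IsSphereFrame.mink_eq (hS : IsSphereFrame x S₁ S₂) (hr : rad x ≠ 0) (α β : Fin 4) :
    mink α β = ∑ V, ∑ W, nullInv V W * nullVec x S₁ S₂ V α * nullVec x S₁ S₂ W β := by
  have h := hS.complete hr α β
  have e : mink α β = (1 : Matrix (Fin 4) (Fin 4) ℝ) α β
      - 2 * ((Pi.single 0 1 : Spacetime) α * (Pi.single 0 1 : Spacetime) β) := by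
    fin_cases α <;> fin_cases β <;> (simp [mink]; try norm_num)
  rw [e, h]
  simp only [sum_nullLabel, nullInv, nullVec, Pi.add_apply, Pi.sub_apply]
  ring

theorem IsSphereFrame.abs_le (hS : IsSphereFrame x S₁ S₂) (α : Fin 4) :
    |S₁ α| ≤ 1 ∧ |S₂ α| ≤ 1 := by
  constructor
  · rw [← sq_le_one_iff_abs_le_one, ← hS.unit₁, dotProduct, sq]
    exact Finset.single_le_sum (f := fun α => S₁ α * S₁ α) (fun _ _ => mul_self_nonneg _)
      (Finset.mem_univ α)
  · rw [← sq_le_one_iff_abs_le_one, ← hS.unit₂, dotProduct, sq]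
    exact Finset.single_le_sum (f := fun α => S₂ α * S₂ α) (fun _ _ => mul_self_nonneg _)
      (Finset.mem_univ α)

theorem IsSphereFrame.abs_nullVec_le (hS : IsSphereFrame x S₁ S₂) (hr : rad x ≠ 0)
    (V : NullLabel) (α : Fin 4) : |nullVec x S₁ S₂ V α| ≤ 2 := by
  have h1 : |(Pi.single 0 1 : Spacetime) α| ≤ 1 := by fin_cases α <;> simp
  have h2 := abs_radial_le hr α
  have h3 := hS.abs_le α
  cases V
  · exact (abs_add_le _ _).trans (by linarith)
  · exact (abs_sub _ _).trans (by linarith)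
  · exact h3.1.trans (by norm_num)
  · exact h3.2.trans (by norm_num)

theorem sum_euInv_mul (𝒱 : Finset NullLabel) {V : NullLabel} (hV : V ∈ 𝒱) (f : NullLabel → ℝ) :
    ∑ V' ∈ 𝒱, euInv V V' * f V' = euInv V V * f V := by
  refine Finset.sum_eq_single_of_mem V hV fun V' _ hne => ?_
  have : euInv V V' = 0 := by cases V <;> cases V' <;> first | rfl | exact absurd rfl hne
  rw [this, zero_mul]

theorem half_le_euInv (V : NullLabel) : 1 / 2 ≤ euInv V V := by
  cases V <;> norm_num [euInv]

/-- As the frame is orthogonal for the Euclidean metric, its norms are weighted sums of squares. -/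
theorem frameNorm_eq (𝒱 𝒲 : Finset NullLabel) (p : Fin 4 → Fin 4 → Fin 4 → ℝ) :
    frameNorm x S₁ S₂ 𝒱 𝒲 p = √(∑ V ∈ 𝒱, ∑ W ∈ 𝒲, ∑ α, euInv V V * (euInv W W *
      contract p (nullVec x S₁ S₂ V) (nullVec x S₁ S₂ W) α ^ 2)) := by
  rw [frameNorm]
  congr 1
  refine Finset.sum_congr rfl fun V hV => ?_
  have e : ∀ V' ∈ 𝒱, (∑ W ∈ 𝒲, ∑ W' ∈ 𝒲, ∑ α, euInv V V' * euInv W W' *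
        contract p (nullVec x S₁ S₂ V) (nullVec x S₁ S₂ W) α *
        contract p (nullVec x S₁ S₂ V') (nullVec x S₁ S₂ W') α) =
      euInv V V' * ∑ W ∈ 𝒲, euInv W W * ∑ α,
        contract p (nullVec x S₁ S₂ V) (nullVec x S₁ S₂ W) α *
        contract p (nullVec x S₁ S₂ V') (nullVec x S₁ S₂ W) α := by
    intro V' _
    rw [Finset.mul_sum]
    refine Finset.sum_congr rfl fun W hW => ?_
    rw [← sum_euInv_mul 𝒲 hW (fun W' => ∑ α,
      contract p (nullVec x S₁ S₂ V) (nullVec x S₁ S₂ W) α *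
        contract p (nullVec x S₁ S₂ V') (nullVec x S₁ S₂ W') α), Finset.mul_sum]
    refine Finset.sum_congr rfl fun W' _ => ?_
    rw [Finset.mul_sum, Finset.mul_sum]
    exact Finset.sum_congr rfl fun α _ => by ring
  rw [Finset.sum_congr rfl e, sum_euInv_mul 𝒱 hV (fun V' => ∑ W ∈ 𝒲, euInv W W * ∑ α,
        contract p (nullVec x S₁ S₂ V) (nullVec x S₁ S₂ W) α *
        contract p (nullVec x S₁ S₂ V') (nullVec x S₁ S₂ W) α), Finset.mul_sum]
  refine Finset.sum_congr rfl fun W _ => ?_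
  rw [Finset.mul_sum, Finset.mul_sum]
  exact Finset.sum_congr rfl fun α _ => by ring

theorem abs_contract_le_frameNorm {𝒱 𝒲 : Finset NullLabel} {V W : NullLabel} (hV : V ∈ 𝒱)
    (hW : W ∈ 𝒲) (p : Fin 4 → Fin 4 → Fin 4 → ℝ) (α : Fin 4) :
    |contract p (nullVec x S₁ S₂ V) (nullVec x S₁ S₂ W) α| ≤ 2 * frameNorm x S₁ S₂ 𝒱 𝒲 p := by
  have pos : ∀ V W α, 0 ≤ euInv V V * (euInv W W *
      contract p (nullVec x S₁ S₂ V) (nullVec x S₁ S₂ W) α ^ 2) := fun V W α =>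
    mul_nonneg (by linarith [half_le_euInv V]) (mul_nonneg (by linarith [half_le_euInv W])
      (sq_nonneg _))
  have h1 : euInv V V * (euInv W W * contract p (nullVec x S₁ S₂ V) (nullVec x S₁ S₂ W) α ^ 2) ≤
      ∑ V ∈ 𝒱, ∑ W ∈ 𝒲, ∑ α, euInv V V * (euInv W W *
        contract p (nullVec x S₁ S₂ V) (nullVec x S₁ S₂ W) α ^ 2) :=
    (Finset.single_le_sum (f := fun α => euInv V V * (euInv W W *
        contract p (nullVec x S₁ S₂ V) (nullVec x S₁ S₂ W) α ^ 2)) (fun α _ => pos V W α)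
      (Finset.mem_univ α)).trans <|
    (Finset.single_le_sum (f := fun W => ∑ α, euInv V V * (euInv W W *
        contract p (nullVec x S₁ S₂ V) (nullVec x S₁ S₂ W) α ^ 2))
      (fun W _ => Finset.sum_nonneg fun α _ => pos V W α) hW).trans <|
    Finset.single_le_sum (f := fun V => ∑ W ∈ 𝒲, ∑ α, euInv V V * (euInv W W *
        contract p (nullVec x S₁ S₂ V) (nullVec x S₁ S₂ W) α ^ 2))
      (fun V _ => Finset.sum_nonneg fun W _ => Finset.sum_nonneg fun α _ => pos V W α) hV
  have h2 : (1 / 2) * ((1 / 2) * contract p (nullVec x S₁ S₂ V) (nullVec x S₁ S₂ W) α ^ 2) ≤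
      euInv V V * (euInv W W * contract p (nullVec x S₁ S₂ V) (nullVec x S₁ S₂ W) α ^ 2) := by
    gcongr
    · linarith [half_le_euInv V]
    · exact half_le_euInv V
    · exact half_le_euInv W
  have h3 := Real.sqrt_le_sqrt (h2.trans h1)
  rw [← frameNorm_eq] at h3
  have e : (1 / 2 : ℝ) * ((1 / 2) * contract p (nullVec x S₁ S₂ V) (nullVec x S₁ S₂ W) α ^ 2) =
      (1 / 2 * contract p (nullVec x S₁ S₂ V) (nullVec x S₁ S₂ W) α) ^ 2 := by ring
  rw [e, Real.sqrt_sq_eq_abs, abs_mul, abs_of_pos (by norm_num : (0 : ℝ) < 1 / 2)] at h3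
  linarith

theorem frameNorm_nonneg (𝒱 𝒲 : Finset NullLabel) (p : Fin 4 → Fin 4 → Fin 4 → ℝ) :
    0 ≤ frameNorm x S₁ S₂ 𝒱 𝒲 p := Real.sqrt_nonneg _

theorem norm₃_nonneg (p : Fin 4 → Fin 4 → Fin 4 → ℝ) : 0 ≤ norm₃ p := Real.sqrt_nonneg _

theorem contract_comm {p : Fin 4 → Fin 4 → Fin 4 → ℝ} (hp : ∀ μ ν α, p μ ν α = p ν μ α)
    (X Y : Spacetime) (α : Fin 4) : contract p X Y α = contract p Y X α := by
  rw [contract, contract, Finset.sum_comm]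
  exact Finset.sum_congr rfl fun μ _ => Finset.sum_congr rfl fun ν _ => by rw [hp]; ring

/-- The contraction of a tensor with an infinitesimal rotation, applied to `L` twice, only involves
the components along `L` and a vector tangent to the outgoing cone, as a skew form vanishes on
`(L, L)`. -/
theorem IsSphereFrame.contract_rot (hS : IsSphereFrame x S₁ S₂) (hr : rad x ≠ 0)
    {c : Matrix (Fin 4) (Fin 4) ℝ} (hc : c * mink + (c * mink)ᵀ = 0)
    {p : Fin 4 → Fin 4 → Fin 4 → ℝ} (hp : ∀ μ ν α, p μ ν α = p ν μ α) (α : Fin 4) :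
    contract (fun μ ν α => ∑ l, (c μ l * p l ν α + c ν l * p μ l α))
        (nullVec x S₁ S₂ .L) (nullVec x S₁ S₂ .L) α =
      2 * ((nullVec x S₁ S₂ .L ᵥ* c) 0 *
          contract p (nullVec x S₁ S₂ .L) (nullVec x S₁ S₂ .L) α
        + ((nullVec x S₁ S₂ .L ᵥ* c) ⬝ᵥ S₁) *
          contract p (nullVec x S₁ S₂ .L) (nullVec x S₁ S₂ .S₁) α
        + ((nullVec x S₁ S₂ .L ᵥ* c) ⬝ᵥ S₂) *
          contract p (nullVec x S₁ S₂ .L) (nullVec x S₁ S₂ .S₂) α) := by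
  set L := nullVec x S₁ S₂ .L with hL
  set X := L ᵥ* c with hX
  have h0 : X 0 = X ⬝ᵥ radial x := by
    have e : X ⬝ᵥ (mink *ᵥ L) = 0 := by
      have e1 : L ⬝ᵥ (c * mink + (c * mink)ᵀ) *ᵥ L = 0 := by rw [hc]; simp
      rw [Matrix.add_mulVec, dotProduct_add, Matrix.mulVec_transpose, dotProduct_comm L (L ᵥ* _),
        ← Matrix.dotProduct_mulVec, ← Matrix.mulVec_mulVec, Matrix.dotProduct_mulVec L c] at e1
      linarith
    have e2 : mink *ᵥ L = radial x - Pi.single 0 1 := by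
      funext β
      rw [mink, Matrix.mulVec_diagonal, hL]
      fin_cases β <;> simp [nullVec, radial_zero]
    rw [e2, dotProduct_sub] at e
    simp at e
    linarith
  have hXeq : ∀ l, X l = X 0 * L l + (X ⬝ᵥ S₁) * S₁ l + (X ⬝ᵥ S₂) * S₂ l := by
    intro l
    have e1 : X l = ∑ m, X m * (1 : Matrix (Fin 4) (Fin 4) ℝ) m l := by
      simp [Matrix.one_apply]
    simp only [hS.complete hr, mul_add, Finset.sum_add_distrib, ← mul_assoc, ← Finset.sum_mul] at e1
    rw [e1]
    change X ⬝ᵥ (Pi.single 0 1) * _ + (X ⬝ᵥ radial x) * _ + (X ⬝ᵥ S₁) * _ + (X ⬝ᵥ S₂) * _ = _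
    rw [← h0, hL]
    simp [nullVec]
    ring
  have e1 : contract (fun μ ν α => ∑ l, (c μ l * p l ν α + c ν l * p μ l α)) L L α =
      contract p X L α + contract p L X α := by
    simp only [contract, hX, Matrix.vecMul, dotProduct, Fin.sum_univ_four]
    ring
  have e2 : contract p L X α = X 0 * contract p L L α + (X ⬝ᵥ S₁) * contract p L S₁ α
      + (X ⬝ᵥ S₂) * contract p L S₂ α := by
    simp only [contract, Finset.mul_sum, ← Finset.sum_add_distrib]
    refine Finset.sum_congr rfl fun μ _ => Finset.sum_congr rfl fun ν _ => ?_
    rw [hXeq ν]; ring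
  rw [e1, contract_comm hp X L, e2]
  change _ = 2 * (X 0 * contract p L L α + (X ⬝ᵥ S₁) * contract p L S₁ α
      + (X ⬝ᵥ S₂) * contract p L S₂ α)
  ring

/-- The linear part of the wave gauge condition, `m^{αβ} (∂_α h_{βμ} - ½ ∂_μ h_{αβ})`. -/
def gaugeForm (p : Fin 4 → Fin 4 → Fin 4 → ℝ) (μ : Fin 4) : ℝ :=
  ∑ α, ∑ β, mink α β * (p β μ α - 1 / 2 * p α β μ)

/-- The `LL`-component of a gradient is determined by its tangential part and by the linear part of
the wave gauge condition. -/
theorem contract_LL_eq (hr : rad x ≠ 0) {p pbar : Fin 4 → Fin 4 → Fin 4 → ℝ}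
    {ρ : Fin 4 → Fin 4 → ℝ} (hp : ∀ μ ν α, p μ ν α = pbar μ ν α + ρ μ ν * dq x α) (α : Fin 4) :
    contract p (nullVec x S₁ S₂ .L) (nullVec x S₁ S₂ .L) α =
      contract pbar (nullVec x S₁ S₂ .L) (nullVec x S₁ S₂ .L) α
      + dq x α * ∑ μ, nullVec x S₁ S₂ .L μ * (gaugeForm p μ - gaugeForm pbar μ) := by
  have h := radial_sq_sum hr
  have e1 : ∀ μ, gaugeForm p μ - gaugeForm pbar μ =
      -ρ 0 μ * dq x 0 + ρ 1 μ * dq x 1 + ρ 2 μ * dq x 2 + ρ 3 μ * dq x 3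
        - 1 / 2 * (-ρ 0 0 + ρ 1 1 + ρ 2 2 + ρ 3 3) * dq x μ := by
    intro μ
    simp only [gaugeForm, mink, Fin.sum_univ_four, hp]
    simp
    ring
  have e2 : contract p (nullVec x S₁ S₂ .L) (nullVec x S₁ S₂ .L) α =
      contract pbar (nullVec x S₁ S₂ .L) (nullVec x S₁ S₂ .L) α + dq x α *
        ∑ μ, ∑ ν, ρ μ ν * nullVec x S₁ S₂ .L μ * nullVec x S₁ S₂ .L ν := by
    simp only [contract, Finset.mul_sum, ← Finset.sum_add_distrib, hp]
    exact Finset.sum_congr rfl fun μ _ => Finset.sum_congr rfl fun ν _ => by ring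
  rw [e2]
  congr 2
  simp only [e1, Fin.sum_univ_four, dq_zero, dq_eq_radial (show (1 : Fin 4) ≠ 0 by decide),
    dq_eq_radial (show (2 : Fin 4) ≠ 0 by decide), dq_eq_radial (show (3 : Fin 4) ≠ 0 by decide)]
  simp only [nullVec, Pi.add_apply, radial_zero]
  simp
  linear_combination (1 / 2) * (-ρ 0 0 + ρ 1 1 + ρ 2 2 + ρ 3 3) * h

/-- A null form sees only the tangential part of at least one of its two arguments. -/
theorem dotProduct_nullForm {N : Matrix (Fin 4) (Fin 4) ℝ} (hN : N ∈ nullForms) (hr : rad x ≠ 0)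
    (ξ η : Fin 4 → ℝ) (a b : ℝ) :
    (ξ + a • dq x) ⬝ᵥ N *ᵥ (η + b • dq x) =
      ξ ⬝ᵥ N *ᵥ (η + b • dq x) + a * (dq x ⬝ᵥ N *ᵥ η) := by
  obtain ⟨s, hs⟩ := hN
  have h := radial_sq_sum hr
  have e1 : dq x ⬝ᵥ mink *ᵥ dq x = 0 := by
    simp only [dotProduct, mink, Matrix.mulVec_diagonal, Fin.sum_univ_four, dq_zero,
      dq_eq_radial (show (1 : Fin 4) ≠ 0 by decide),
      dq_eq_radial (show (2 : Fin 4) ≠ 0 by decide), dq_eq_radial (show (3 : Fin 4) ≠ 0 by decide)]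
    simp
    linear_combination h
  have e2 : dq x ⬝ᵥ N *ᵥ dq x = 0 := by
    have e3 : dq x ⬝ᵥ (N + Nᵀ) *ᵥ dq x = 0 := by
      rw [hs, Matrix.smul_mulVec, dotProduct_smul, e1, smul_zero]
    rw [Matrix.add_mulVec, dotProduct_add, Matrix.mulVec_transpose,
      dotProduct_comm _ (dq x ᵥ* N), ← Matrix.dotProduct_mulVec] at e3
    linarith
  simp only [add_dotProduct, Matrix.mulVec_add, dotProduct_add, Matrix.mulVec_smul,
    smul_dotProduct, dotProduct_smul, smul_eq_mul, e2]
  ring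

end Frame

/-- The coefficients of the bilinear form `¼ tr π tr θ - ½ ⟨π, θ⟩` in two symmetric tensors. -/
def coeffP (i j : Fin 4 × Fin 4) : ℝ :=
  1 / 4 * mink i.1 i.2 * mink j.1 j.2 - 1 / 2 * mink i.1 j.1 * mink i.2 j.2

section Frame

variable {x S₁ S₂ : Spacetime}

theorem IsSphereFrame.sum_mink_mul (hS : IsSphereFrame x S₁ S₂) (hr : rad x ≠ 0)
    (p : Fin 4 → Fin 4 → Fin 4 → ℝ) (α : Fin 4) :
    ∑ μ, ∑ ν, mink μ ν * p μ ν α =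
      ∑ V, ∑ W, nullInv V W * contract p (nullVec x S₁ S₂ V) (nullVec x S₁ S₂ W) α := by
  simp only [hS.mink_eq hr, contract, Finset.sum_mul, Finset.mul_sum]
  rw [Finset.sum_congr rfl fun μ _ => Finset.sum_comm, Finset.sum_comm]
  refine Finset.sum_congr rfl fun V _ => ?_
  rw [Finset.sum_congr rfl fun μ _ => Finset.sum_comm, Finset.sum_comm]
  exact Finset.sum_congr rfl fun W _ => Finset.sum_congr rfl fun μ _ =>
    Finset.sum_congr rfl fun ν _ => by ring

theorem IsSphereFrame.sum_mink_mul_mink (hS : IsSphereFrame x S₁ S₂) (hr : rad x ≠ 0)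
    (p q : Fin 4 → Fin 4 → Fin 4 → ℝ) (α β : Fin 4) :
    ∑ i : Fin 4 × Fin 4, ∑ j : Fin 4 × Fin 4,
        mink i.1 j.1 * mink i.2 j.2 * (p i.1 i.2 α * q j.1 j.2 β) =
      ∑ V : NullLabel × NullLabel, ∑ W : NullLabel × NullLabel,
        nullInv V.1 W.1 * nullInv V.2 W.2 *
        (contract p (nullVec x S₁ S₂ V.1) (nullVec x S₁ S₂ V.2) α
          * contract q (nullVec x S₁ S₂ W.1) (nullVec x S₁ S₂ W.2) β) := by
  have e1 : ∀ i j : Fin 4 × Fin 4, mink i.1 j.1 * mink i.2 j.2 =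
      ∑ V : NullLabel × NullLabel, ∑ W : NullLabel × NullLabel, nullInv V.1 W.1 * nullInv V.2 W.2 *
        (nullVec x S₁ S₂ V.1 i.1 * nullVec x S₁ S₂ V.2 i.2 *
          (nullVec x S₁ S₂ W.1 j.1 * nullVec x S₁ S₂ W.2 j.2)) := by
    intro i j
    rw [hS.mink_eq hr i.1, hS.mink_eq hr i.2, Fintype.sum_mul_sum, Fintype.sum_prod_type]
    refine Finset.sum_congr rfl fun V _ => Finset.sum_congr rfl fun V' _ => ?_
    rw [Fintype.sum_mul_sum, Fintype.sum_prod_type]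
    exact Finset.sum_congr rfl fun W _ => Finset.sum_congr rfl fun W' _ => by ring
  have e2 : ∀ (r : Fin 4 → Fin 4 → Fin 4 → ℝ) (V : NullLabel × NullLabel) (α : Fin 4),
      contract r (nullVec x S₁ S₂ V.1) (nullVec x S₁ S₂ V.2) α =
      ∑ i : Fin 4 × Fin 4, r i.1 i.2 α *
        (nullVec x S₁ S₂ V.1 i.1 * nullVec x S₁ S₂ V.2 i.2) := by
    intro r V α
    rw [Fintype.sum_prod_type, contract]
    exact Finset.sum_congr rfl fun μ _ => Finset.sum_congr rfl fun ν _ => by ring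
  simp only [e1, e2, Finset.sum_mul, Finset.mul_sum]
  rw [Finset.sum_congr rfl fun i _ => Finset.sum_comm, Finset.sum_comm]
  refine Finset.sum_congr rfl fun V _ => ?_
  rw [Finset.sum_congr rfl fun i _ => Finset.sum_comm, Finset.sum_comm]
  refine Finset.sum_congr rfl fun W _ => ?_
  rw [Finset.sum_comm]
  exact Finset.sum_congr rfl fun i _ => Finset.sum_congr rfl fun j _ => by ring

theorem IsSphereFrame.abs_contract_le (hS : IsSphereFrame x S₁ S₂) (hr : rad x ≠ 0)
    (p : Fin 4 → Fin 4 → Fin 4 → ℝ) (V W : NullLabel) (α : Fin 4) :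
    |contract p (nullVec x S₁ S₂ V) (nullVec x S₁ S₂ W) α| ≤ 64 * norm₃ p := by
  have h : ∀ μ ν, |p μ ν α * nullVec x S₁ S₂ V μ * nullVec x S₁ S₂ W ν| ≤ 4 * norm₃ p := by
    intro μ ν
    rw [abs_mul, abs_mul]
    have h1 := abs_le_norm₃ p μ ν α
    have h2 := hS.abs_nullVec_le hr V μ
    have h3 := hS.abs_nullVec_le hr W ν
    calc _ ≤ norm₃ p * 2 * 2 := by
          gcongr
          exact mul_nonneg (Real.sqrt_nonneg _) (by norm_num)
          exact Real.sqrt_nonneg _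
      _ = _ := by ring
  refine (Finset.abs_sum_le_sum_abs _ _).trans ?_
  calc _ ≤ ∑ μ : Fin 4, ∑ ν : Fin 4, 4 * norm₃ p := Finset.sum_le_sum fun μ _ =>
        (Finset.abs_sum_le_sum_abs _ _).trans (Finset.sum_le_sum fun ν _ => h μ ν)
    _ = _ := by simp; ring

end Frame

section Families

variable {Ω : Type*} {x S₁ S₂ : Ω → Spacetime} {g : Ω → ℝ}

theorem isBigO_mul_of_abs_le {f₁ f₂ F₁ F₂ : Ω → ℝ} {c₁ c₂ : ℝ} (h₁ : ∀ ω, |f₁ ω| ≤ c₁ * F₁ ω)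
    (h₂ : ∀ ω, |f₂ ω| ≤ c₂ * F₂ ω) (H : (fun ω => F₁ ω * F₂ ω) =O[⊤] g) :
    (fun ω => f₁ ω * f₂ ω) =O[⊤] g := by
  have hO : ∀ {f F : Ω → ℝ} {c : ℝ}, (∀ ω, |f ω| ≤ c * F ω) → f =O[⊤] F := by
    intro f F c h
    refine IsBigO.of_bound |c| (Eventually.of_forall fun ω => ?_)
    rw [Real.norm_eq_abs, Real.norm_eq_abs, ← abs_mul]
    exact (h ω).trans (le_abs_self _)
  exact ((hO h₁).mul (hO h₂)).trans H

/-- The weak null structure of `P`: each product has a factor of type `LL`, or two factors with a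
tangential index. -/
theorem isBigO_gradForm_coeffP (hS : ∀ ω, IsSphereFrame (x ω) (S₁ ω) (S₂ ω))
    (hr : ∀ ω, rad (x ω) ≠ 0) {p q : Ω → Fin 4 → Fin 4 → Fin 4 → ℝ}
    (hp : ∀ ω μ ν α, p ω μ ν α = p ω ν μ α) (hq : ∀ ω μ ν α, q ω μ ν α = q ω ν μ α)
    (hTU : (fun ω => frameNorm (x ω) (S₁ ω) (S₂ ω) famT famU (p ω) *
      frameNorm (x ω) (S₁ ω) (S₂ ω) famT famU (q ω)) =O[⊤] g)
    (hpL : ∀ α, (fun ω => contract (p ω) (nullVec (x ω) (S₁ ω) (S₂ ω) .L)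
      (nullVec (x ω) (S₁ ω) (S₂ ω) .L) α * norm₃ (q ω)) =O[⊤] g)
    (hqL : ∀ α, (fun ω => contract (q ω) (nullVec (x ω) (S₁ ω) (S₂ ω) .L)
      (nullVec (x ω) (S₁ ω) (S₂ ω) .L) α * norm₃ (p ω)) =O[⊤] g)
    (N : Matrix (Fin 4) (Fin 4) ℝ) :
    (fun ω => gradForm coeffP N (fun i α => p ω i.1 i.2 α) (fun j α => q ω j.1 j.2 α)) =O[⊤] g := by
  set e : Ω → NullLabel → Spacetime := fun ω => nullVec (x ω) (S₁ ω) (S₂ ω)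
  have expand : ∀ ω, gradForm coeffP N (fun i α => p ω i.1 i.2 α) (fun j α => q ω j.1 j.2 α) =
      ∑ α, ∑ β, N α β * (1 / 4 * ((∑ V, ∑ W, nullInv V W * contract (p ω) (e ω V) (e ω W) α) *
          ∑ V, ∑ W, nullInv V W * contract (q ω) (e ω V) (e ω W) β)
        - 1 / 2 * ∑ V : NullLabel × NullLabel, ∑ W : NullLabel × NullLabel,
          nullInv V.1 W.1 * nullInv V.2 W.2 *
            (contract (p ω) (e ω V.1) (e ω V.2) α * contract (q ω) (e ω W.1) (e ω W.2) β)) := by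
    intro ω
    simp only [e, ← (hS ω).sum_mink_mul (hr ω), ← (hS ω).sum_mink_mul_mink (hr ω)]
    simp only [← Fintype.sum_prod_type' fun μ ν => mink μ ν * p ω μ ν _,
      ← Fintype.sum_prod_type' fun μ ν => mink μ ν * q ω μ ν _, Finset.sum_mul_sum]
    simp only [gradForm, dotProduct, Matrix.mulVec, coeffP, Finset.mul_sum, ← Finset.sum_sub_distrib]
    rw [Finset.sum_congr rfl fun i _ => Finset.sum_comm, Finset.sum_comm]
    refine Finset.sum_congr rfl fun α _ => ?_
    rw [Finset.sum_congr rfl fun i _ => Finset.sum_comm, Finset.sum_comm]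
    exact Finset.sum_congr rfl fun β _ => Finset.sum_congr rfl fun i _ =>
      Finset.sum_congr rfl fun j _ => by ring
  simp only [expand]
  -- A pair of components is tangential if both have an index in `famT`.
  have tang : ∀ (V₁ V₂ W₁ W₂ : NullLabel) (α β : Fin 4), (V₁ ∈ famT ∨ V₂ ∈ famT) →
      (W₁ ∈ famT ∨ W₂ ∈ famT) → (fun ω => contract (p ω) (e ω V₁) (e ω V₂) α *
        contract (q ω) (e ω W₁) (e ω W₂) β) =O[⊤] g := by
    have memU : ∀ V, V ∈ famU := fun V => by cases V <;> simp [famU]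
    have one : ∀ {r : Ω → Fin 4 → Fin 4 → Fin 4 → ℝ}, (∀ ω μ ν α, r ω μ ν α = r ω ν μ α) →
        ∀ (V₁ V₂ : NullLabel) (α : Fin 4), (V₁ ∈ famT ∨ V₂ ∈ famT) →
        ∀ ω, |contract (r ω) (e ω V₁) (e ω V₂) α| ≤
          2 * frameNorm (x ω) (S₁ ω) (S₂ ω) famT famU (r ω) := by
      intro r hsym V₁ V₂ α h ω
      rcases h with h | h
      · exact abs_contract_le_frameNorm h (memU _) _ _
      · rw [contract_comm (hsym ω)]
        exact abs_contract_le_frameNorm h (memU _) _ _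
    intro V₁ V₂ W₁ W₂ α β hV hW
    exact isBigO_mul_of_abs_le (one hp V₁ V₂ α hV) (one hq W₁ W₂ β hW) hTU
  refine IsBigO.fun_sum fun α _ => IsBigO.fun_sum fun β _ => IsBigO.const_mul_left ?_ _
  refine IsBigO.sub (IsBigO.const_mul_left ?_ _) (IsBigO.const_mul_left ?_ _)
  · simp only [Finset.sum_mul_sum]
    refine IsBigO.fun_sum fun V₁ _ => IsBigO.fun_sum fun W₁ _ => IsBigO.fun_sum fun V₂ _ =>
      IsBigO.fun_sum fun W₂ _ => ?_
    have e1 : ∀ ω, nullInv V₁ V₂ * contract (p ω) (e ω V₁) (e ω V₂) α *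
        (nullInv W₁ W₂ * contract (q ω) (e ω W₁) (e ω W₂) β) = nullInv V₁ V₂ * nullInv W₁ W₂ *
        (contract (p ω) (e ω V₁) (e ω V₂) α * contract (q ω) (e ω W₁) (e ω W₂) β) :=
      fun ω => by ring
    simp only [e1]
    by_cases h0 : nullInv V₁ V₂ = 0
    · simpa only [h0, zero_mul, mul_zero] using isBigO_zero (E' := ℝ) g ⊤
    by_cases h1 : nullInv W₁ W₂ = 0
    · simpa only [h1, zero_mul, mul_zero] using isBigO_zero (E' := ℝ) g ⊤
    refine IsBigO.const_mul_left (tang _ _ _ _ _ _ ?_ ?_) _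
    · cases V₁ <;> cases V₂ <;> simp [nullInv, famT] at h0 ⊢
    · cases W₁ <;> cases W₂ <;> simp [nullInv, famT] at h1 ⊢
  · refine IsBigO.fun_sum fun V _ => IsBigO.fun_sum fun W _ => ?_
    obtain ⟨V₁, V₂⟩ := V
    obtain ⟨W₁, W₂⟩ := W
    simp only
    by_cases h0 : nullInv V₁ W₁ = 0
    · simpa only [h0, zero_mul, mul_zero] using isBigO_zero (E' := ℝ) g ⊤
    by_cases h1 : nullInv V₂ W₂ = 0
    · simpa only [h1, zero_mul, mul_zero] using isBigO_zero (E' := ℝ) g ⊤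
    refine IsBigO.const_mul_left ?_ _
    by_cases hV : V₁ ∈ famT ∨ V₂ ∈ famT
    · by_cases hW : W₁ ∈ famT ∨ W₂ ∈ famT
      · exact tang _ _ _ _ _ _ hV hW
      · have hL : V₁ = .L ∧ V₂ = .L := by
          cases V₁ <;> cases V₂ <;> cases W₁ <;> cases W₂ <;> simp [nullInv, famT] at h0 h1 hW ⊢
        rw [hL.1, hL.2]
        exact isBigO_mul_of_abs_le (c₁ := 1) (F₁ := fun ω => |contract (p ω) (e ω .L) (e ω .L) α|)
          (fun ω => by simp) (fun ω => (hS ω).abs_contract_le (hr ω) (q ω) W₁ W₂ β)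
          (((hpL α).norm_left).congr_left fun ω => by
            rw [Real.norm_eq_abs, abs_mul, abs_of_nonneg (norm₃_nonneg (q ω))])
    · have hL : W₁ = .L ∧ W₂ = .L := by
        cases V₁ <;> cases V₂ <;> cases W₁ <;> cases W₂ <;> simp [nullInv, famT] at h0 h1 hV ⊢
      rw [hL.1, hL.2]
      simp only [mul_comm (contract (p _) _ _ _)]
      exact isBigO_mul_of_abs_le (c₁ := 1) (F₁ := fun ω => |contract (q ω) (e ω .L) (e ω .L) β|)
        (fun ω => by simp) (fun ω => (hS ω).abs_contract_le (hr ω) (p ω) V₁ V₂ α)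
        (((hqL β).norm_left).congr_left fun ω => by
          rw [Real.norm_eq_abs, abs_mul, abs_of_nonneg (norm₃_nonneg (p ω))])

theorem grad₂_eq_goodGrad₂ (h : TwoTensorField) (y : Spacetime) (μ ν α : Fin 4) :
    grad₂ h y μ ν α = goodGrad₂ h y μ ν α + fderiv ℝ (h μ ν) y (radial y) * dq y α := by
  simp [grad₂, goodGrad₂]

theorem abs_fderiv_radial_le {y : Spacetime} (hr : rad y ≠ 0) (h : TwoTensorField) (μ ν : Fin 4) :
    |fderiv ℝ (h μ ν) y (radial y)| ≤ 4 * norm₃ (grad₂ h y) := by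
  rw [fderiv_apply_eq_sum]
  refine (Finset.abs_sum_le_sum_abs _ _).trans ?_
  calc _ ≤ ∑ α : Fin 4, norm₃ (grad₂ h y) := by
        refine Finset.sum_le_sum fun α _ => ?_
        rw [abs_mul]
        have h1 := abs_radial_le hr α
        have h2 : |pd α (h μ ν) y| ≤ _ := abs_le_norm₃ (grad₂ h y) μ ν α
        nlinarith [abs_nonneg (pd α (h μ ν) y)]
    _ = _ := by simp

/-- In a null form one of the two gradients is tangential. -/
theorem isBigO_gradForm_nullForms (hr : ∀ ω, rad (x ω) ≠ 0) (b : Fin 4 × Fin 4 → Fin 4 × Fin 4 → ℝ)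
    {N : Matrix (Fin 4) (Fin 4) ℝ} (hN : N ∈ nullForms) {h k : Ω → TwoTensorField}
    (H₁ : (fun ω => norm₃ (goodGrad₂ (h ω) (x ω)) * norm₃ (grad₂ (k ω) (x ω))) =O[⊤] g)
    (H₂ : (fun ω => norm₃ (goodGrad₂ (k ω) (x ω)) * norm₃ (grad₂ (h ω) (x ω))) =O[⊤] g) :
    (fun ω => gradForm b N (fun i α => grad₂ (h ω) (x ω) i.1 i.2 α)
      (fun j α => grad₂ (k ω) (x ω) j.1 j.2 α)) =O[⊤] g := by
  refine IsBigO.fun_sum fun i _ => IsBigO.fun_sum fun j _ => IsBigO.const_mul_left ?_ _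
  have e : ∀ ω, (fun α => grad₂ (h ω) (x ω) i.1 i.2 α) ⬝ᵥ N *ᵥ
        (fun α => grad₂ (k ω) (x ω) j.1 j.2 α) =
      goodGrad₂ (h ω) (x ω) i.1 i.2 ⬝ᵥ N *ᵥ grad₂ (k ω) (x ω) j.1 j.2
      + fderiv ℝ (h ω i.1 i.2) (x ω) (radial (x ω)) *
        (dq (x ω) ⬝ᵥ N *ᵥ goodGrad₂ (k ω) (x ω) j.1 j.2) := by
    intro ω
    have e1 : ∀ (f : TwoTensorField) (i : Fin 4 × Fin 4), grad₂ f (x ω) i.1 i.2 =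
        goodGrad₂ f (x ω) i.1 i.2 + fderiv ℝ (f i.1 i.2) (x ω) (radial (x ω)) • dq (x ω) := by
      intro f i; funext α
      rw [grad₂_eq_goodGrad₂]; rfl
    have e2 := dotProduct_nullForm hN (hr ω) (goodGrad₂ (h ω) (x ω) i.1 i.2)
      (goodGrad₂ (k ω) (x ω) j.1 j.2) (fderiv ℝ (h ω i.1 i.2) (x ω) (radial (x ω)))
      (fderiv ℝ (k ω j.1 j.2) (x ω) (radial (x ω)))
    rw [← e1, ← e1] at e2
    exact e2
  simp only [e]
  refine IsBigO.add ?_ ?_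
  · simp only [dotProduct, Matrix.mulVec, Finset.mul_sum]
    refine IsBigO.fun_sum fun α _ => IsBigO.fun_sum fun β _ => ?_
    simp only [mul_left_comm _ (N α β)]
    exact IsBigO.const_mul_left (isBigO_mul_of_abs_le (c₁ := 1) (c₂ := 1)
      (fun ω => by rw [one_mul]; exact abs_le_norm₃ _ _ _ _)
      (fun ω => by rw [one_mul]; exact abs_le_norm₃ _ _ _ _) H₁) _
  · simp only [dotProduct, Matrix.mulVec, Finset.mul_sum]
    refine IsBigO.fun_sum fun α _ => IsBigO.fun_sum fun β _ => ?_
    simp only [mul_left_comm _ (N α β)]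
    refine IsBigO.const_mul_left ?_ _
    simp only [← mul_assoc]
    simp only [mul_comm _ (goodGrad₂ _ _ _ _ _)]
    refine isBigO_mul_of_abs_le (c₁ := 1) (c₂ := 4)
      (fun ω => by rw [one_mul]; exact abs_le_norm₃ _ _ _ _) (fun ω => ?_) H₂
    rw [abs_mul]
    have h1 := abs_fderiv_radial_le (hr ω) (h ω) i.1 i.2
    have h2 := abs_dq_le (hr ω) α
    nlinarith [abs_nonneg (fderiv ℝ (h ω i.1 i.2) (x ω) (radial (x ω)))]

end Families

/-! ### The wave gauge condition -/

/-- The action of an infinitesimal linear transformation on the two indices of a tensor. -/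
def rotAct (c : Matrix (Fin 4) (Fin 4) ℝ) (p : Fin 4 → Fin 4 → Fin 4 → ℝ) :
    Fin 4 → Fin 4 → Fin 4 → ℝ :=
  fun μ ν α => ∑ l, (c μ l * p l ν α + c ν l * p μ l α)

/-- The Lie derivative of a 2-tensor field along a vector field of the family, without the multiple
of the field that arises for the scaling field. -/
def lieDeriv (a : ZLabel) (k : TwoTensorField) : TwoTensorField :=
  fun μ ν y => zApply a (k μ ν) y + ∑ l, (zRot a μ l * k l ν y + zRot a ν l * k μ l y)

/-- The algebraic identity behind the covariance of the gauge condition: `w` stands for `Z ∂k`, and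
the two sums for the commutator of `Z` with `∂` and for the action of `Z` on the tensor indices. -/
theorem gaugeForm_rotAct {c : Matrix (Fin 4) (Fin 4) ℝ} (hc : c * mink + (c * mink)ᵀ = 0) (s : ℝ)
    (w p : Fin 4 → Fin 4 → Fin 4 → ℝ) (μ : Fin 4) :
    gaugeForm (fun μ ν α => w μ ν α + ∑ l, (c + s • 1) α l * p μ ν l + rotAct c p μ ν α) μ =
      gaugeForm w μ + ∑ l, (c + s • 1) μ l * gaugeForm p l := by
  have e : ∀ α β, c α β * mink β β + c β α * mink α α = 0 := by
    intro α β
    have h := congrFun (congrFun hc α) β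
    simp [mink, Matrix.mul_diagonal] at h ⊢
    linarith
  have e00 : c 0 0 = 0 := by have := e 0 0; simp [mink] at this; linarith
  have e11 : c 1 1 = 0 := by have := e 1 1; simp [mink] at this; linarith
  have e22 : c 2 2 = 0 := by have := e 2 2; simp [mink] at this; linarith
  have e33 : c 3 3 = 0 := by have := e 3 3; simp [mink] at this; linarith
  have e10 : c 1 0 = c 0 1 := by have := e 0 1; simp [mink] at this; linarith
  have e20 : c 2 0 = c 0 2 := by have := e 0 2; simp [mink] at this; linarith
  have e30 : c 3 0 = c 0 3 := by have := e 0 3; simp [mink] at this; linarith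
  have e21 : c 2 1 = -c 1 2 := by have := e 1 2; simp [mink] at this; linarith
  have e31 : c 3 1 = -c 1 3 := by have := e 1 3; simp [mink] at this; linarith
  have e32 : c 3 2 = -c 2 3 := by have := e 2 3; simp [mink] at this; linarith
  fin_cases μ <;>
  · simp [gaugeForm, rotAct, mink, Fin.sum_univ_four, Matrix.one_apply, e00, e11, e22, e33, e10,
      e20, e30, e21, e31, e32]
    ring

section Regularity

variable {k : TwoTensorField} {y : Spacetime} {n : ℕ}

theorem contDiffAt_lieDeriv (hk : ∀ μ ν, ContDiffAt ℝ (n + 1 : ℕ) (k μ ν) y) (a : ZLabel)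
    (μ ν : Fin 4) : ContDiffAt ℝ n (lieDeriv a k μ ν) y := by
  have hk' : ∀ μ ν, ContDiffAt ℝ n (k μ ν) y := fun μ ν => (hk μ ν).of_le (by norm_cast; lia)
  exact (contDiffAt_zApply (hk μ ν) a).add (ContDiffAt.sum fun l _ =>
    (contDiffAt_const.mul (hk' l ν)).add (contDiffAt_const.mul (hk' μ l)))

theorem contDiffAt_gaugeForm (hk : ∀ μ ν, ContDiffAt ℝ (n + 1 : ℕ) (k μ ν) y) (μ : Fin 4) :
    ContDiffAt ℝ n (fun z => gaugeForm (grad₂ k z) μ) y :=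
  ContDiffAt.sum fun _ _ => ContDiffAt.sum fun _ _ => contDiffAt_const.mul
    ((contDiffAt_pd (hk _ _) _).sub (contDiffAt_const.mul (contDiffAt_pd (hk _ _) _)))

theorem pd_sum_rot (hk : ∀ μ ν, DifferentiableAt ℝ (k μ ν) y) (c : Matrix (Fin 4) (Fin 4) ℝ)
    (μ ν α : Fin 4) :
    pd α (fun z => ∑ l, (c μ l * k l ν z + c ν l * k μ l z)) y = rotAct c (grad₂ k y) μ ν α := by
  rw [pd_sum _ _ fun l _ => by fun_prop]
  refine Finset.sum_congr rfl fun l _ => ?_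
  rw [pd_add _ (by fun_prop) (by fun_prop), pd_const_mul, pd_const_mul]
  rfl

/-- The linear part of the wave gauge condition is Lorentz covariant. -/
theorem gaugeForm_lieDeriv (hk : ∀ μ ν, ContDiffAt ℝ 2 (k μ ν) y) (a : ZLabel) (μ : Fin 4) :
    gaugeForm (grad₂ (lieDeriv a k) y) μ = zApply a (fun z => gaugeForm (grad₂ k z) μ) y
      + ∑ l, zLin a μ l * gaugeForm (grad₂ k y) l := by
  have dk : ∀ μ ν, DifferentiableAt ℝ (k μ ν) y := fun μ ν => (hk μ ν).differentiableAt (by simp)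
  have dz : ∀ μ ν, DifferentiableAt ℝ (zApply a (k μ ν)) y :=
    fun μ ν => (contDiffAt_zApply (n := 1) (hk μ ν) a).differentiableAt (by simp)
  have dp : ∀ μ ν α, DifferentiableAt ℝ (pd α (k μ ν)) y :=
    fun μ ν α => (contDiffAt_pd (n := 1) (hk μ ν) α).differentiableAt (by simp)
  have eM : zLin a = zRot a + zWeight a • 1 := by simp [zRot]
  have e1 : grad₂ (lieDeriv a k) y = fun μ ν α => zApply a (pd α (k μ ν)) y
      + ∑ l, (zRot a + zWeight a • 1) α l * grad₂ k y μ ν l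
      + rotAct (zRot a) (grad₂ k y) μ ν α := by
    funext μ ν α
    change pd α (fun z => zApply a (k μ ν) z + _) y = _
    rw [pd_add _ (dz μ ν) (by fun_prop), pd_sum_rot dk, pd_zApply (hk μ ν), ← eM]
    rfl
  rw [e1, gaugeForm_rotAct (zRot_skew a), ← eM]
  congr 1
  simp only [gaugeForm, grad₂]
  rw [zApply_sum _ _ fun α _ => by fun_prop]
  refine Finset.sum_congr rfl fun α _ => ?_
  rw [zApply_sum _ _ fun α _ => by fun_prop]
  refine Finset.sum_congr rfl fun β _ => ?_
  simp only [sub_eq_add_neg, ← neg_mul]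
  rw [zApply_const_mul]
  beta_reduce
  rw [zApply_add _ (dp _ _ _) (by fun_prop), zApply_const_mul]

theorem grad₂_zPow₂_lieDeriv (J : MultiIndex)
    (hk : ∀ μ ν, ContDiffAt ℝ (J.length + 1 + 1 : ℕ) (k μ ν) y) (a : ZLabel) :
    grad₂ (zPow₂ J (lieDeriv a k)) y =
      grad₂ (zPow₂ (J ++ [a]) k) y + rotAct (zRot a) (grad₂ (zPow₂ J k) y) := by
  funext μ ν α
  have dk : ∀ μ ν, DifferentiableAt ℝ (zPow₂ J k μ ν) y := fun μ ν =>
    (contDiffAt_zPow (n := 1) J ((hk μ ν).of_le (by norm_cast; lia))).differentiableAt (by simp)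
  have dz : DifferentiableAt ℝ (zPow J (zApply a (k μ ν))) y := by
    rw [← zPow_append_singleton]
    exact (contDiffAt_zPow (n := 1) _ ((hk μ ν).of_le (by
      simp only [List.length_append, List.length_singleton]
      norm_cast; lia))).differentiableAt (by simp)
  have e : zPow J (lieDeriv a k μ ν) =ᶠ[𝓝 y] fun z => zPow J (zApply a (k μ ν)) z
      + ∑ l, (zRot a μ l * zPow₂ J k l ν z + zRot a ν l * zPow₂ J k μ l z) := by
    filter_upwards [eventually_all.2 fun μ => eventually_all.2 fun ν =>
      (hk μ ν).eventually (by simp)] with z hz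
    have hz0 : ∀ μ ν, ContDiffAt ℝ J.length (k μ ν) z :=
      fun μ ν => (hz μ ν).of_le (by norm_cast; lia)
    have hz1 : ContDiffAt ℝ J.length (zApply a (k μ ν)) z :=
      contDiffAt_zApply ((hz μ ν).of_le (by norm_cast; lia)) a
    rw [show lieDeriv a k μ ν = fun z => zApply a (k μ ν) z +
      ∑ l, (zRot a μ l * k l ν z + zRot a ν l * k μ l z) from rfl]
    rw [zPow_add J hz1 (ContDiffAt.sum fun l _ =>
      (contDiffAt_const.mul (hz0 l ν)).add (contDiffAt_const.mul (hz0 μ l))),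
      zPow_sum _ J fun l _ =>
        (contDiffAt_const.mul (hz0 l ν)).add (contDiffAt_const.mul (hz0 μ l))]
    congr 1
    refine Finset.sum_congr rfl fun l _ => ?_
    rw [zPow_add J (contDiffAt_const.mul (hz0 l ν)) (contDiffAt_const.mul (hz0 μ l)),
      zPow_const_mul, zPow_const_mul]
    rfl
  change pd α (zPow J (lieDeriv a k μ ν)) y = pd α (zPow (J ++ [a]) (k μ ν)) y + _
  rw [(pd_congr α e).self_of_nhds, pd_add _ dz (by fun_prop), pd_sum_rot dk, zPow_append_singleton]

theorem grad₂_zPow₂_symm (J : MultiIndex) (hs : ∀ μ ν, k μ ν =ᶠ[𝓝 y] k ν μ) (μ ν α : Fin 4) :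
    grad₂ (zPow₂ J k) y μ ν α = grad₂ (zPow₂ J k) y ν μ α :=
  (pd_congr α (zPow_congr J (hs μ ν))).self_of_nhds

/-- In the wave gauge its linear part is quadratic in `(g⁻¹ - m⁻¹, ∂h)`. -/
theorem gaugeForm_eq_of_waveGauge {U : Set Spacetime} {h : TwoTensorField} (hU : IsOpen U)
    (hs : ∀ μ ν, ∀ x ∈ U, h μ ν x = h ν μ x) (hg : WaveGauge h U) (hy : y ∈ U)
    (hd : ∀ μ ν, DifferentiableAt ℝ (h μ ν) y) (hu : IsUnit (mink + val₂ h y).det) (μ : Fin 4) :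
    gaugeForm (grad₂ h y) μ = ∑ α, ∑ β, ((gInv (val₂ h y) α β - mink α β) * (-1 * pd α (h β μ) y)
      + (gInv (val₂ h y) α β - mink α β) * (1 / 2 * pd μ (h α β) y)) := by
  set γ := gInv (val₂ h y) with hγ
  have sp : ∀ μ ν α, pd α (h μ ν) y = pd α (h ν μ) y := fun μ ν α =>
    (pd_congr α (Filter.eventuallyEq_of_mem (hU.mem_nhds hy) (hs μ ν))).self_of_nhds
  have pm : ∀ μ ν α, pd α (metric h μ ν) y = pd α (h μ ν) y := by
    intro μ ν α
    change pd α (fun z => mink μ ν + h μ ν z) y = _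
    rw [pd_add _ (by fun_prop) (hd μ ν)]
    simp [pd]
  have hsymm : (mink + val₂ h y)ᵀ = mink + val₂ h y := by
    ext i j
    simp only [Matrix.transpose_apply, Matrix.add_apply, val₂, Matrix.of_apply, hs i j y hy]
    congr 1
    simp only [mink, Matrix.diagonal_apply]
    split_ifs with h1 h2 h2 <;> simp_all
  have γs : ∀ α β, γ α β = γ β α := by
    intro α β
    have : γᵀ = γ := by rw [hγ, gInv, Matrix.transpose_nonsing_inv, hsymm]
    rw [← Matrix.transpose_apply γ β α, this]
  -- the gauge condition with the free index lowered
  set V : Fin 4 → ℝ := fun m => ∑ α, ∑ β, γ α β * (pd α (h m β) y + pd β (h α m) y - pd m (h α β) y)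
    with hV
  have h1 : γ *ᵥ V = 0 := by
    funext l
    have e := hg y hy l
    simp only [christoffel, pm, Finset.mul_sum] at e
    simp only [Matrix.mulVec, dotProduct, hV, Finset.mul_sum, Pi.zero_apply]
    rw [Finset.sum_congr rfl fun α _ => Finset.sum_comm, Finset.sum_comm] at e
    have e' : (1 / 2 : ℝ) * ∑ m, ∑ α, ∑ β, γ l m * (γ α β * (pd α (h m β) y + pd β (h α m) y
        - pd m (h α β) y)) = 0 := by
      rw [← e]
      simp only [Finset.mul_sum]
      exact Finset.sum_congr rfl fun m _ => Finset.sum_congr rfl fun α _ =>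
        Finset.sum_congr rfl fun β _ => by ring
    linarith
  have h2 : V = 0 := by
    have e := congrArg (fun w => (mink + val₂ h y) *ᵥ w) h1
    simpa only [Matrix.mulVec_mulVec, hγ, mul_gInv hu, Matrix.one_mulVec, Matrix.mulVec_zero] using e
  have h3 : ∑ α, ∑ β, γ α β * (pd α (h β μ) y - 1 / 2 * pd μ (h α β) y) = 0 := by
    have e := congrFun h2 μ
    simp only [hV, Pi.zero_apply] at e
    have e1 : ∑ α, ∑ β, γ α β * pd β (h α μ) y = ∑ α, ∑ β, γ α β * pd α (h β μ) y := by
      rw [Finset.sum_comm]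
      exact Finset.sum_congr rfl fun α _ => Finset.sum_congr rfl fun β _ => by rw [γs]
    simp only [mul_sub, mul_add, Finset.sum_sub_distrib, Finset.sum_add_distrib, e1, sp μ _ _] at e
    simp only [mul_sub, Finset.sum_sub_distrib]
    have e2 : ∑ α, ∑ β, γ α β * (1 / 2 * pd μ (h α β) y) =
        1 / 2 * ∑ α, ∑ β, γ α β * pd μ (h α β) y := by
      simp only [Finset.mul_sum]
      exact Finset.sum_congr rfl fun α _ => Finset.sum_congr rfl fun β _ => by ring
    rw [e2]
    linarith
  rw [← sub_zero (gaugeForm _ _), ← h3]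
  simp only [gaugeForm, grad₂, ← Finset.sum_sub_distrib]
  exact Finset.sum_congr rfl fun α _ => Finset.sum_congr rfl fun β _ => by ring

end Regularity

section Families

variable {Ω : Type*} {x S₁ S₂ : Ω → Spacetime} {g : Ω → ℝ}

theorem isBigO_mul_of_one {f₁ f₂ : Ω → ℝ} (h₁ : f₁ =O[⊤] fun _ => (1 : ℝ)) (h₂ : f₂ =O[⊤] g) :
    (fun ω => f₁ ω * f₂ ω) =O[⊤] g := by
  simpa using h₁.mul h₂

theorem isBigO_one_of_abs_le {f : Ω → ℝ} {c : ℝ} (h : ∀ ω, |f ω| ≤ c) :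
    f =O[⊤] fun _ => (1 : ℝ) :=
  IsBigO.of_bound c (Eventually.of_forall fun ω => by simpa using h ω)

theorem isBigO_nullVec (hS : ∀ ω, IsSphereFrame (x ω) (S₁ ω) (S₂ ω)) (hr : ∀ ω, rad (x ω) ≠ 0)
    (V : NullLabel) (α : Fin 4) :
    (fun ω => nullVec (x ω) (S₁ ω) (S₂ ω) V α) =O[⊤] fun _ => (1 : ℝ) :=
  isBigO_one_of_abs_le fun ω => (hS ω).abs_nullVec_le (hr ω) V α

theorem isBigO_contract (hS : ∀ ω, IsSphereFrame (x ω) (S₁ ω) (S₂ ω)) (hr : ∀ ω, rad (x ω) ≠ 0)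
    {p : Ω → Fin 4 → Fin 4 → Fin 4 → ℝ} (hp : ∀ μ ν α, (fun ω => p ω μ ν α) =O[⊤] g)
    (V W : NullLabel) (α : Fin 4) :
    (fun ω => contract (p ω) (nullVec (x ω) (S₁ ω) (S₂ ω) V)
      (nullVec (x ω) (S₁ ω) (S₂ ω) W) α) =O[⊤] g := by
  refine IsBigO.fun_sum fun μ _ => IsBigO.fun_sum fun ν _ => ?_
  simpa using ((hp μ ν α).mul (isBigO_nullVec hS hr V μ)).mul (isBigO_nullVec hS hr W ν)

theorem isBigO_rotAct (c : Matrix (Fin 4) (Fin 4) ℝ)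
    {p : Ω → Fin 4 → Fin 4 → Fin 4 → ℝ} (hp : ∀ μ ν α, (fun ω => p ω μ ν α) =O[⊤] g)
    (μ ν α : Fin 4) : (fun ω => rotAct c (p ω) μ ν α) =O[⊤] g :=
  IsBigO.fun_sum fun _ _ => ((hp _ _ _).const_mul_left _).add ((hp _ _ _).const_mul_left _)

theorem goodGrad₂_eq (h : TwoTensorField) (y : Spacetime) (μ ν α : Fin 4) :
    goodGrad₂ h y μ ν α =
      grad₂ h y μ ν α - (∑ β, radial y β * grad₂ h y μ ν β) * dq y α := by
  rw [goodGrad₂, fderiv_apply_eq_sum]; rfl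

/-- The improved bound for the `LL`-components of `∂ Z^I k` from the linear part of the wave gauge
condition. The terms of one order less have a tangential index, since the commutators of the
`Z`-fields with the gauge condition are infinitesimal rotations of the tensor indices. -/
theorem isBigO_contract_LL (hS : ∀ ω, IsSphereFrame (x ω) (S₁ ω) (S₂ ω))
    (hr : ∀ ω, rad (x ω) ≠ 0) (I : MultiIndex) {k : Ω → TwoTensorField}
    (hk : ∀ ω μ ν, ContDiffAt ℝ (I.length + 1 : ℕ) (k ω μ ν) (x ω))
    (hs : ∀ ω μ ν, k ω μ ν =ᶠ[𝓝 (x ω)] k ω ν μ)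
    (H₁ : ∀ J : MultiIndex, J.length ≤ I.length → ∀ μ ν α,
      (fun ω => goodGrad₂ (zPow₂ J (k ω)) (x ω) μ ν α) =O[⊤] g)
    (H₂ : ∀ J : MultiIndex, J.length + 1 ≤ I.length → ∀ V ∈ famT, ∀ α,
      (fun ω => contract (grad₂ (zPow₂ J (k ω)) (x ω)) (nullVec (x ω) (S₁ ω) (S₂ ω) .L)
        (nullVec (x ω) (S₁ ω) (S₂ ω) V) α) =O[⊤] g)
    (H₃ : ∀ J : MultiIndex, J.length + 2 ≤ I.length → ∀ μ ν α,
      (fun ω => grad₂ (zPow₂ J (k ω)) (x ω) μ ν α) =O[⊤] g)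
    (H₄ : ∀ J : MultiIndex, J.length ≤ I.length → ∀ μ,
      (fun ω => zPow J (fun y => gaugeForm (grad₂ (k ω) y) μ) (x ω)) =O[⊤] g) (α : Fin 4) :
    (fun ω => contract (grad₂ (zPow₂ I (k ω)) (x ω)) (nullVec (x ω) (S₁ ω) (S₂ ω) .L)
        (nullVec (x ω) (S₁ ω) (S₂ ω) .L) α) =O[⊤] g := by
  induction I using List.reverseRecOn generalizing k α with
  | nil =>
    have h1 : ∀ μ ν α, (fun ω => goodGrad₂ (k ω) (x ω) μ ν α) =O[⊤] g := H₁ [] le_rfl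
    have h4 : ∀ μ, (fun ω => gaugeForm (grad₂ (k ω) (x ω)) μ) =O[⊤] g := H₄ [] le_rfl
    have key := fun ω => contract_LL_eq (S₁ := S₁ ω) (S₂ := S₂ ω) (hr ω)
      (grad₂_eq_goodGrad₂ (k ω) (x ω)) α
    refine IsBigO.congr_left ?_ fun ω => (key ω).symm
    refine (isBigO_contract hS hr h1 _ _ _).add (isBigO_mul_of_one
      (isBigO_one_of_abs_le fun ω => abs_dq_le (hr ω) α) (IsBigO.fun_sum fun μ _ =>
        isBigO_mul_of_one (isBigO_nullVec hS hr _ _) ((h4 μ).sub ?_)))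
    exact IsBigO.fun_sum fun α _ => IsBigO.fun_sum fun β _ => IsBigO.const_mul_left
      ((h1 _ _ _).sub ((h1 _ _ _).const_mul_left _)) _
  | append_singleton I a ih =>
    simp only [List.length_append, List.length_singleton] at hk H₁ H₂ H₃ H₄
    have lenS : ∀ J : MultiIndex, (J ++ [a]).length = J.length + 1 := by simp
    have eg : ∀ J : MultiIndex, J.length ≤ I.length → ∀ ω,
        grad₂ (zPow₂ J (lieDeriv a (k ω))) (x ω) = grad₂ (zPow₂ (J ++ [a]) (k ω)) (x ω)
          + rotAct (zRot a) (grad₂ (zPow₂ J (k ω)) (x ω)) := fun J hJ ω =>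
      grad₂_zPow₂_lieDeriv J (fun μ ν => (hk ω μ ν).of_le (by norm_cast; lia)) a
    have main := ih (k := fun ω => lieDeriv a (k ω))
      (fun ω μ ν => contDiffAt_lieDeriv (hk ω) a μ ν) ?_ ?_ ?_ ?_ ?_ α
    · have e : ∀ ω, contract (grad₂ (zPow₂ (I ++ [a]) (k ω)) (x ω))
          (nullVec (x ω) (S₁ ω) (S₂ ω) .L) (nullVec (x ω) (S₁ ω) (S₂ ω) .L) α =
          contract (grad₂ (zPow₂ I (lieDeriv a (k ω))) (x ω))
            (nullVec (x ω) (S₁ ω) (S₂ ω) .L) (nullVec (x ω) (S₁ ω) (S₂ ω) .L) α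
          - contract (rotAct (zRot a) (grad₂ (zPow₂ I (k ω)) (x ω)))
            (nullVec (x ω) (S₁ ω) (S₂ ω) .L) (nullVec (x ω) (S₁ ω) (S₂ ω) .L) α := by
        intro ω
        rw [eg I le_rfl ω]
        simp only [contract, ← Finset.sum_sub_distrib, Pi.add_apply]
        exact Finset.sum_congr rfl fun μ _ => Finset.sum_congr rfl fun ν _ => by ring
      simp only [e]
      refine main.sub ?_
      refine IsBigO.congr_left ?_ fun ω => ((hS ω).contract_rot (hr ω) (zRot_skew a)
        (grad₂_zPow₂_symm I (hs ω)) α).symm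
      have bX : ∀ l, (fun ω => (nullVec (x ω) (S₁ ω) (S₂ ω) .L ᵥ* zRot a) l) =O[⊤]
          fun _ => (1 : ℝ) := fun l => by
        simp only [Matrix.vecMul, dotProduct, mul_comm _ (zRot a _ l)]
        exact IsBigO.fun_sum fun m _ => (isBigO_nullVec hS hr .L m).const_mul_left (zRot a m l)
      have b₁ := fun l => isBigO_nullVec hS hr .S₁ l
      have b₂ := fun l => isBigO_nullVec hS hr .S₂ l
      refine IsBigO.const_mul_left (((isBigO_mul_of_one (bX 0) ?_).add
        (isBigO_mul_of_one (IsBigO.fun_sum fun l _ => isBigO_mul_of_one (bX l) (b₁ l)) ?_)).add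
        (isBigO_mul_of_one (IsBigO.fun_sum fun l _ => isBigO_mul_of_one (bX l) (b₂ l)) ?_)) _
      · exact H₂ I le_rfl .L (by simp [famT]) α
      · exact H₂ I le_rfl .S₁ (by simp [famT]) α
      · exact H₂ I le_rfl .S₂ (by simp [famT]) α
    · intro ω μ ν
      filter_upwards [zApply_congr a (hs ω μ ν), eventually_all.2 fun μ => eventually_all.2 fun ν =>
        hs ω μ ν] with y h1 h2
      simp only [lieDeriv, h1]
      congr 1
      refine Finset.sum_congr rfl fun l _ => ?_
      rw [h2 l ν, h2 μ l, add_comm]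
    · intro J hJ μ ν α
      have e : ∀ ω, goodGrad₂ (zPow₂ J (lieDeriv a (k ω))) (x ω) μ ν α =
          goodGrad₂ (zPow₂ (J ++ [a]) (k ω)) (x ω) μ ν α
            + rotAct (zRot a) (goodGrad₂ (zPow₂ J (k ω)) (x ω)) μ ν α := by
        intro ω
        rw [goodGrad₂_eq, goodGrad₂_eq, eg J hJ ω]
        simp only [Pi.add_apply, rotAct, goodGrad₂_eq, Fin.sum_univ_four]
        ring
      simp only [e]
      exact (H₁ (J ++ [a]) (by rw [lenS]; lia) μ ν α).add
        (isBigO_rotAct _ (H₁ J (by lia)) μ ν α)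
    · intro J hJ V hV α
      have e : ∀ ω, contract (grad₂ (zPow₂ J (lieDeriv a (k ω))) (x ω))
          (nullVec (x ω) (S₁ ω) (S₂ ω) .L) (nullVec (x ω) (S₁ ω) (S₂ ω) V) α =
          contract (grad₂ (zPow₂ (J ++ [a]) (k ω)) (x ω))
            (nullVec (x ω) (S₁ ω) (S₂ ω) .L) (nullVec (x ω) (S₁ ω) (S₂ ω) V) α
          + contract (rotAct (zRot a) (grad₂ (zPow₂ J (k ω)) (x ω)))
            (nullVec (x ω) (S₁ ω) (S₂ ω) .L) (nullVec (x ω) (S₁ ω) (S₂ ω) V) α := by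
        intro ω
        rw [eg J (by lia) ω]
        simp only [contract, ← Finset.sum_add_distrib, Pi.add_apply]
        exact Finset.sum_congr rfl fun μ _ => Finset.sum_congr rfl fun ν _ => by ring
      simp only [e]
      exact (H₂ (J ++ [a]) (by rw [lenS]; lia) V hV α).add
        (isBigO_contract hS hr (isBigO_rotAct _ (H₃ J (by lia))) _ _ _)
    · intro J hJ μ ν α
      simp only [eg J (by lia), Pi.add_apply]
      exact (H₃ (J ++ [a]) (by rw [lenS]; lia) μ ν α).add
        (isBigO_rotAct _ (H₃ J (by lia)) μ ν α)
    · intro J hJ μ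
      have r1 : ∀ ω μ, ContDiffAt ℝ (J.length + 1 : ℕ)
          (fun y => gaugeForm (grad₂ (k ω) y) μ) (x ω) := fun ω μ =>
        contDiffAt_gaugeForm (fun μ ν => (hk ω μ ν).of_le (by norm_cast; lia)) μ
      have r0 : ∀ ω μ, ContDiffAt ℝ J.length
          (fun y => gaugeForm (grad₂ (k ω) y) μ) (x ω) := fun ω μ =>
        (r1 ω μ).of_le (by norm_cast; lia)
      have e : ∀ ω, zPow J (fun y => gaugeForm (grad₂ (lieDeriv a (k ω)) y) μ) (x ω) =
          zPow J (fun y => zApply a (fun z => gaugeForm (grad₂ (k ω) z) μ) y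
            + ∑ l, zLin a μ l * gaugeForm (grad₂ (k ω) y) l) (x ω) := by
        intro ω
        refine (zPow_congr J ?_).self_of_nhds
        filter_upwards [eventually_all.2 fun μ => eventually_all.2 fun ν =>
          (hk ω μ ν).eventually (by simp)] with y hy
        exact gaugeForm_lieDeriv (fun μ ν => (hy μ ν).of_le (by norm_cast; lia)) a μ
      simp only [e]
      refine isBigO_zPow_add J (fun ω => contDiffAt_zApply (r1 ω μ) a)
        (fun ω => ContDiffAt.sum fun l _ => contDiffAt_const.mul (r0 ω l)) ?_
        (isBigO_zPow_sum _ J (fun l _ ω => contDiffAt_const.mul (r0 ω l)) fun l _ =>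
          isBigO_zPow_const_mul J _ (H₄ J (by lia) l))
      simpa only [zPow_append_singleton] using H₄ (J ++ [a]) (by rw [lenS]; lia) μ

end Families

/-! ### Weighted bounds -/

section Families

variable {Ω : Type*} {x S₁ S₂ : Ω → Spacetime} {g : Ω → ℝ}

/-- A weight can be moved to the right side of a bound, as nothing has to be shown where it
vanishes. -/
theorem isBigO_mul_of_restrict {f w : Ω → ℝ}
    (H : (fun ω : {ω // w ω ≠ 0} => f ω) =O[⊤] fun ω => g ω / w ω) :
    (fun ω => f ω * w ω) =O[⊤] g := by
  obtain ⟨C, hC0, hC⟩ := H.exists_nonneg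
  replace hC := isBigOWith_top.1 hC
  refine IsBigO.of_bound C (Eventually.of_forall fun ω => ?_)
  by_cases hw : w ω = 0
  · rw [hw, mul_zero, norm_zero]
    positivity
  · have h := hC ⟨ω, hw⟩
    rw [norm_div] at h
    rw [norm_mul]
    have hw' : 0 < ‖w ω‖ := norm_pos_iff.2 hw
    calc _ ≤ C * (‖g ω‖ / ‖w ω‖) * ‖w ω‖ := by gcongr
      _ = _ := by field_simp

theorem isBigO_restrict_div {f w : Ω → ℝ} (H : (fun ω => f ω * w ω) =O[⊤] g) :
    (fun ω : {ω // w ω ≠ 0} => f ω) =O[⊤] fun ω => g ω / w ω := by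
  obtain ⟨C, hC⟩ := isBigO_top.1 H
  refine IsBigO.of_bound C (Eventually.of_forall fun ω => ?_)
  have hw' : 0 < ‖w ω‖ := norm_pos_iff.2 ω.2
  rw [norm_div, ← mul_div_assoc, le_div_iff₀ hw', ← norm_mul]
  exact hC ω

theorem isBigO_zPow_pd_mul (I : MultiIndex) (α : Fin 4) {u : Ω → Spacetime → ℝ} {w : Ω → ℝ}
    (hu : ∀ ω, ContDiffAt ℝ (I.length + 1 : ℕ) (u ω) (x ω))
    (H : ∀ J : MultiIndex, J.length ≤ I.length → ∀ β,
      (fun ω => pd β (zPow J (u ω)) (x ω) * w ω) =O[⊤] g) :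
    (fun ω => zPow I (pd α (u ω)) (x ω) * w ω) =O[⊤] g :=
  isBigO_mul_of_restrict (isBigO_zPow_pd (Ω := {ω // w ω ≠ 0}) (x := fun ω => x ω)
    (u := fun ω => u ω) I α (fun ω => hu ω) fun J hJ β => by
      have h := isBigO_restrict_div (H J hJ β)
      exact h)

theorem isBigO_zPow_mul_mul (I : MultiIndex) {f₁ f₂ : Ω → Spacetime → ℝ} {w : Ω → ℝ}
    (h₁ : ∀ ω, ContDiffAt ℝ I.length (f₁ ω) (x ω)) (h₂ : ∀ ω, ContDiffAt ℝ I.length (f₂ ω) (x ω))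
    (H : ∀ J K : MultiIndex, J.length + K.length ≤ I.length →
      (fun ω => zPow J (f₁ ω) (x ω) * zPow K (f₂ ω) (x ω) * w ω) =O[⊤] g) :
    (fun ω => zPow I (fun y => f₁ ω y * f₂ ω y) (x ω) * w ω) =O[⊤] g :=
  isBigO_mul_of_restrict (isBigO_zPow_mul (Ω := {ω // w ω ≠ 0}) (x := fun ω => x ω)
    (f₁ := fun ω => f₁ ω) (f₂ := fun ω => f₂ ω) I (fun ω => h₁ ω) (fun ω => h₂ ω)
    fun J K hJK => by
      have h := isBigO_restrict_div (H J K hJK)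
      exact h)

theorem isBigO_zPow_mul_pd_mul_pd (I : MultiIndex) {w u v : Ω → Spacetime → ℝ}
    (hw : ∀ ω, ContDiffAt ℝ I.length (w ω) (x ω))
    (hu : ∀ ω, ContDiffAt ℝ (I.length + 1 : ℕ) (u ω) (x ω))
    (hv : ∀ ω, ContDiffAt ℝ (I.length + 1 : ℕ) (v ω) (x ω))
    (H : ∀ J K L : MultiIndex, J.length + K.length + L.length ≤ I.length → ∀ α β,
      (fun ω => zPow J (w ω) (x ω) * (pd α (zPow K (u ω)) (x ω) * pd β (zPow L (v ω)) (x ω)))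
        =O[⊤] g) (μ ν : Fin 4) :
    (fun ω => zPow I (fun y => w ω y * (pd μ (u ω) y * pd ν (v ω) y)) (x ω)) =O[⊤] g := by
  refine isBigO_zPow_mul I hw
    (fun ω => (contDiffAt_pd (hu ω) μ).mul (contDiffAt_pd (hv ω) ν)) fun J M hJM => ?_
  simp only [mul_comm (zPow J _ _)]
  refine isBigO_zPow_mul_mul M
    (fun ω => contDiffAt_pd ((hu ω).of_le (by norm_cast; lia)) μ)
    (fun ω => contDiffAt_pd ((hv ω).of_le (by norm_cast; lia)) ν) fun K L hKL => ?_
  simp only [mul_assoc]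
  refine isBigO_zPow_pd_mul K μ
    (fun ω => (hu ω).of_le (by norm_cast; lia)) fun K' hK' α => ?_
  simp only [mul_left_comm (pd α _ _)]
  refine isBigO_zPow_pd_mul L ν (fun ω => (hv ω).of_le (by norm_cast; lia)) fun L' hL' β => ?_
  refine (H J K' L' (by lia) α β).congr_left fun ω => ?_
  ring

/-- A family of functions is regular enough for `Z^I` to be applied at `x`, with result bounded by
a multiple of `g`. -/
def DerivBigO (x : Ω → Spacetime) (I : MultiIndex) (g : Ω → ℝ) (f : Ω → Spacetime → ℝ) : Prop :=
  (∀ ω, ContDiffAt ℝ I.length (f ω) (x ω)) ∧ (fun ω => zPow I (f ω) (x ω)) =O[⊤] g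

namespace DerivBigO

variable {I : MultiIndex} {f f₁ f₂ : Ω → Spacetime → ℝ}

theorem add (h₁ : DerivBigO x I g f₁) (h₂ : DerivBigO x I g f₂) :
    DerivBigO x I g fun ω y => f₁ ω y + f₂ ω y :=
  ⟨fun ω => (h₁.1 ω).add (h₂.1 ω), isBigO_zPow_add I h₁.1 h₂.1 h₁.2 h₂.2⟩

theorem const_mul (h : DerivBigO x I g f) (c : ℝ) : DerivBigO x I g fun ω y => c * f ω y :=
  ⟨fun ω => contDiffAt_const.mul (h.1 ω), isBigO_zPow_const_mul I c h.2⟩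

theorem sub (h₁ : DerivBigO x I g f₁) (h₂ : DerivBigO x I g f₂) :
    DerivBigO x I g fun ω y => f₁ ω y - f₂ ω y := by
  simpa [sub_eq_add_neg] using h₁.add (h₂.const_mul (-1))

theorem sum {ι : Type*} {s : Finset ι} {F : ι → Ω → Spacetime → ℝ}
    (h : ∀ i ∈ s, DerivBigO x I g (F i)) : DerivBigO x I g fun ω y => ∑ i ∈ s, F i ω y :=
  ⟨fun ω => ContDiffAt.sum fun i hi => (h i hi).1 ω,
    isBigO_zPow_sum s I (fun i hi => (h i hi).1) fun i hi => (h i hi).2⟩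

end DerivBigO

section Metric

variable {h : Ω → TwoTensorField} {n : ℕ}

theorem isBigO_zPow_gInv_sub_mink_mul {w : Ω → ℝ} (J : MultiIndex)
    (hh : ∀ ω μ ν, ContDiffAt ℝ J.length (h ω μ ν) (x ω))
    (hu : ∀ ω, IsUnit (mink + val₂ (h ω) (x ω)).det)
    (hγ : ∀ K : MultiIndex, K.length ≤ J.length → ∀ α β,
      (fun ω => zPow K (fun y => gInv (val₂ (h ω) y) α β) (x ω)) =O[⊤] fun _ => (1 : ℝ))
    (H : ∀ K : MultiIndex, K.length ≤ J.length → ∀ μ ν,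
      (fun ω => zPow K (h ω μ ν) (x ω) * w ω) =O[⊤] g) (α β : Fin 4) :
    (fun ω => zPow J (fun y => gInv (val₂ (h ω) y) α β - mink α β) (x ω) * w ω) =O[⊤] g :=
  isBigO_mul_of_restrict (isBigO_zPow_gInv_sub_mink (Ω := {ω // w ω ≠ 0}) (x := fun ω => x ω)
    (h := fun ω => h ω) J (fun ω => hh ω) (fun ω => hu ω)
    (fun K hK α β => (hγ K hK α β).comp_tendsto (k := Subtype.val) tendsto_top)
    (fun K hK μ ν => by
      have h := isBigO_restrict_div (H K hK μ ν)
      exact h) α β)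

/-- The derivatives of `g^{αα'} g^{ββ'} - m^{αα'} m^{ββ'}` are bounded by those of `h`. -/
theorem isBigO_zPow_gInv_mul_sub_mink_mul {w : Ω → ℝ} (J : MultiIndex)
    (hh : ∀ ω μ ν, ContDiffAt ℝ J.length (h ω μ ν) (x ω))
    (hu : ∀ ω, IsUnit (mink + val₂ (h ω) (x ω)).det)
    (hγ : ∀ K : MultiIndex, K.length ≤ J.length → ∀ α β,
      (fun ω => zPow K (fun y => gInv (val₂ (h ω) y) α β) (x ω)) =O[⊤] fun _ => (1 : ℝ))
    (H : ∀ K : MultiIndex, K.length ≤ J.length → ∀ μ ν,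
      (fun ω => zPow K (h ω μ ν) (x ω) * w ω) =O[⊤] g) (α α' β β' : Fin 4) :
    (fun ω => zPow J (fun y => gInv (val₂ (h ω) y) α α' * gInv (val₂ (h ω) y) β β'
      - mink α α' * mink β β') (x ω) * w ω) =O[⊤] g := by
  have rg : ∀ ω α β, ContDiffAt ℝ J.length (fun y => gInv (val₂ (h ω) y) α β) (x ω) :=
    fun ω => contDiffAt_gInv (hh ω) (hu ω)
  have e : ∀ ω, (fun y => gInv (val₂ (h ω) y) α α' * gInv (val₂ (h ω) y) β β'
      - mink α α' * mink β β') = fun y =>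
        (gInv (val₂ (h ω) y) α α' - mink α α') * gInv (val₂ (h ω) y) β β'
        + mink α α' * (gInv (val₂ (h ω) y) β β' - mink β β') := fun ω => by funext y; ring
  simp only [e]
  have main : (fun ω => zPow J (fun y => (gInv (val₂ (h ω) y) α α' - mink α α')
      * gInv (val₂ (h ω) y) β β') (x ω) * w ω) =O[⊤] g := by
    refine isBigO_zPow_mul_mul J (fun ω => (rg ω α α').sub contDiffAt_const) (fun ω => rg ω β β')
      fun K L hKL => ?_
    simp only [mul_right_comm]
    simp only [mul_comm _ (zPow L _ _)]
    exact isBigO_mul_of_one (hγ L (by lia) β β') (isBigO_zPow_gInv_sub_mink_mul K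
        (fun ω μ ν => (hh ω μ ν).of_le (by norm_cast; lia)) hu (fun K' hK' => hγ K' (by lia))
        (fun K' hK' => H K' (by lia)) α α')
  refine (main.add ((isBigO_zPow_gInv_sub_mink_mul J hh hu hγ H β β').const_mul_left
    (mink α α'))).congr_left fun ω => ?_
  rw [zPow_add J (((rg ω α α').sub contDiffAt_const).mul (rg ω β β'))
    (contDiffAt_const.mul ((rg ω β β').sub contDiffAt_const)), zPow_const_mul]
  ring

theorem isBigO_zPow_gInv_mul_gInv (J : MultiIndex)
    (hh : ∀ ω μ ν, ContDiffAt ℝ J.length (h ω μ ν) (x ω))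
    (hu : ∀ ω, IsUnit (mink + val₂ (h ω) (x ω)).det)
    (hγ : ∀ K : MultiIndex, K.length ≤ J.length → ∀ α β,
      (fun ω => zPow K (fun y => gInv (val₂ (h ω) y) α β) (x ω)) =O[⊤] fun _ => (1 : ℝ))
    (α α' β β' : Fin 4) :
    (fun ω => zPow J (fun y => gInv (val₂ (h ω) y) α α' * gInv (val₂ (h ω) y) β β') (x ω))
      =O[⊤] fun _ => (1 : ℝ) :=
  isBigO_zPow_mul J (fun ω => contDiffAt_gInv (hh ω) (hu ω) α α')
    (fun ω => contDiffAt_gInv (hh ω) (hu ω) β β') fun K L hKL =>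
    isBigO_one_mul (hγ K (by lia) _ _) (hγ L (by lia) _ _)

theorem isBigO_zPow_gaugeForm {U : Ω → Set Spacetime} (hU : ∀ ω, IsOpen (U ω))
    (hx : ∀ ω, x ω ∈ U ω) (hs : ∀ ω μ ν, ∀ y ∈ U ω, h ω μ ν y = h ω ν μ y)
    (hg : ∀ ω, WaveGauge (h ω) (U ω)) (J : MultiIndex)
    (hh : ∀ ω μ ν, ContDiffAt ℝ (J.length + 1 : ℕ) (h ω μ ν) (x ω))
    (hu : ∀ ω, IsUnit (mink + val₂ (h ω) (x ω)).det)
    (hγ : ∀ K : MultiIndex, K.length ≤ J.length → ∀ α β,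
      (fun ω => zPow K (fun y => gInv (val₂ (h ω) y) α β) (x ω)) =O[⊤] fun _ => (1 : ℝ))
    (H : ∀ K L : MultiIndex, K.length + L.length ≤ J.length → ∀ μ ν α β l,
      (fun ω => zPow K (h ω μ ν) (x ω) * pd l (zPow L (h ω α β)) (x ω)) =O[⊤] g) (μ : Fin 4) :
    (fun ω => zPow J (fun y => gaugeForm (grad₂ (h ω) y) μ) (x ω)) =O[⊤] g := by
  have hh' : ∀ ω μ ν, ContDiffAt ℝ J.length (h ω μ ν) (x ω) :=
    fun ω μ ν => (hh ω μ ν).of_le (by norm_cast; lia)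
  have e : ∀ ω, zPow J (fun y => gaugeForm (grad₂ (h ω) y) μ) (x ω) =
      zPow J (fun y => ∑ α, ∑ β,
        ((gInv (val₂ (h ω) y) α β - mink α β) * (-1 * pd α (h ω β μ) y)
        + (gInv (val₂ (h ω) y) α β - mink α β) * (1 / 2 * pd μ (h ω α β) y))) (x ω) := by
    intro ω
    refine (zPow_congr J ?_).self_of_nhds
    filter_upwards [(hU ω).mem_nhds (hx ω), eventually_isUnit_det (hh' ω) (hu ω),
      eventually_all.2 fun μ => eventually_all.2 fun ν =>
        eventually_differentiableAt (hh ω μ ν)] with y h1 h2 h3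
    exact gaugeForm_eq_of_waveGauge (hU ω) (hs ω) (hg ω) h1 h3 h2 μ
  simp only [e]
  have main : ∀ (c : ℝ) (α β l μ ν : Fin 4), DerivBigO x J g fun ω y =>
      (gInv (val₂ (h ω) y) α β - mink α β) * (c * pd l (h ω μ ν) y) := by
    intro c α β l μ ν
    have r₁ : ∀ ω, ContDiffAt ℝ J.length (fun y => gInv (val₂ (h ω) y) α β - mink α β) (x ω) :=
      fun ω => (contDiffAt_gInv (hh' ω) (hu ω) α β).sub contDiffAt_const
    have r₂ : ∀ ω, ContDiffAt ℝ J.length (fun y => c * pd l (h ω μ ν) y) (x ω) :=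
      fun ω => contDiffAt_const.mul (contDiffAt_pd (hh ω μ ν) l)
    refine ⟨fun ω => (r₁ ω).mul (r₂ ω), isBigO_zPow_mul J r₁ r₂ fun K L hKL => ?_⟩
    refine isBigO_zPow_gInv_sub_mink_mul K (fun ω μ ν => (hh' ω μ ν).of_le (by norm_cast; lia)) hu
      (fun K' hK' => hγ K' (by lia)) (fun K' hK' μ' ν' => ?_) α β
    simp only [zPow_const_mul, mul_left_comm _ c]
    simp only [mul_comm (zPow K' _ _)]
    refine IsBigO.const_mul_left (isBigO_zPow_pd_mul L l
      (fun ω => (hh ω μ ν).of_le (by norm_cast; lia)) fun L' hL' β' => ?_) c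
    simpa only [mul_comm] using H K' L' (by lia) μ' ν' μ ν β'
  exact (DerivBigO.sum fun α _ => DerivBigO.sum fun β _ => (main _ _ _ _ _ _).add
    (main _ _ _ _ _ _)).2

end Metric

end Families

/-! ### The structure of the source terms -/

section Algebra

variable {ι : Type*}

theorem dotProduct_single_mulVec (a b : Fin 4) (ξ η : Fin 4 → ℝ) :
    ξ ⬝ᵥ Matrix.single a b 1 *ᵥ η = ξ a * η b := by
  simp [dotProduct, Matrix.mulVec, Matrix.single_apply, ite_and]

theorem single_sub_single_mem_nullForms (a b : Fin 4) :
    Matrix.single a b 1 - Matrix.single b a 1 ∈ nullForms :=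
  ⟨0, by simp⟩

theorem mink_mem_nullForms : mink ∈ nullForms := ⟨2, by simp [mink, two_smul]⟩

theorem dotProduct_single_sub_single_mulVec (a b : Fin 4) (ξ η : Fin 4 → ℝ) :
    ξ ⬝ᵥ (Matrix.single a b 1 - Matrix.single b a 1) *ᵥ η = ξ a * η b - ξ b * η a := by
  rw [Matrix.sub_mulVec, dotProduct_sub, dotProduct_single_mulVec, dotProduct_single_mulVec]

theorem mink_comm (α β : Fin 4) : mink α β = mink β α := by
  have : minkᵀ = mink := by simp [mink]
  rw [← Matrix.transpose_apply mink, this]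

theorem formP_mink (p : Fin 4 → Fin 4 → Fin 4 → ℝ) (μ ν : Fin 4) :
    formP mink p μ ν = gradForm coeffP (Matrix.single μ ν 1) (fun i α => p i.1 i.2 α)
      (fun j α => p j.1 j.2 α) := by
  have e1 : formP mink p μ ν =
      (∑ α, ∑ α', ∑ β, ∑ β', mink α α' * mink β β' * (1 / 4 * p β β' μ * p α α' ν))
      - ∑ α, ∑ α', ∑ β, ∑ β', mink α α' * mink β β' * (1 / 2 * p α β ν * p α' β' μ) := by
    simp only [formP, mul_sub, Finset.sum_sub_distrib]
  have e2 : gradForm coeffP (Matrix.single μ ν 1) (fun i α => p i.1 i.2 α)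
      (fun j α => p j.1 j.2 α) =
      (∑ a, ∑ b, ∑ c, ∑ d, mink c d * mink a b * (1 / 4 * p a b μ * p c d ν))
      - ∑ a, ∑ b, ∑ c, ∑ d, mink c a * mink d b * (1 / 2 * p c d ν * p a b μ) := by
    simp only [gradForm, coeffP, dotProduct_single_mulVec, Fintype.sum_prod_type,
      ← Finset.sum_sub_distrib]
    refine Finset.sum_congr rfl fun a _ => Finset.sum_congr rfl fun b _ =>
      Finset.sum_congr rfl fun c _ => Finset.sum_congr rfl fun d _ => ?_
    rw [mink_comm c a, mink_comm d b]
    ring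
  rw [e1, e2]
  congr 1
  · rw [Finset.sum_congr rfl fun α _ => Finset.sum_comm, Finset.sum_comm]
    refine Finset.sum_congr rfl fun a _ => ?_
    rw [Finset.sum_congr rfl fun α _ => Finset.sum_comm, Finset.sum_comm]
  · rw [Finset.sum_comm]
    refine Finset.sum_congr rfl fun a _ => ?_
    rw [Finset.sum_congr rfl fun α _ => Finset.sum_comm, Finset.sum_comm]

theorem formQ_mink (p : Fin 4 → Fin 4 → Fin 4 → ℝ) (μ ν : Fin 4) :
    formQ mink p μ ν = (∑ β, ∑ β', mink β β' * (p β μ ⬝ᵥ mink *ᵥ p β' ν)) +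
      ∑ α, ∑ α', ∑ β, ∑ β', mink α α' * mink β β' *
        (-1 * (p β μ ⬝ᵥ (Matrix.single α β' 1 - Matrix.single β' α 1) *ᵥ p α' ν)
        + p α' β' ⬝ᵥ (Matrix.single μ α 1 - Matrix.single α μ 1) *ᵥ p β ν
        + p α' β' ⬝ᵥ (Matrix.single ν α 1 - Matrix.single α ν 1) *ᵥ p β μ
        + 1 / 2 * (p α α' ⬝ᵥ (Matrix.single β' μ 1 - Matrix.single μ β' 1) *ᵥ p β ν)
        + 1 / 2 * (p α α' ⬝ᵥ (Matrix.single β' ν 1 - Matrix.single ν β' 1) *ᵥ p β μ)) := by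
  have e1 : ∑ β, ∑ β', mink β β' * (p β μ ⬝ᵥ mink *ᵥ p β' ν) =
      ∑ α, ∑ α', ∑ β, ∑ β', mink α α' * mink β β' * (p β μ α * p β' ν α') := by
    simp only [dotProduct, Matrix.mulVec, Finset.mul_sum]
    rw [Finset.sum_congr rfl fun β _ => Finset.sum_comm, Finset.sum_comm]
    refine Finset.sum_congr rfl fun α _ => ?_
    rw [Finset.sum_congr rfl fun β _ => Finset.sum_comm, Finset.sum_comm]
    exact Finset.sum_congr rfl fun α' _ => Finset.sum_congr rfl fun β _ =>
      Finset.sum_congr rfl fun β' _ => by ring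
  rw [e1]
  simp only [formQ, dotProduct_single_sub_single_mulVec, ← Finset.sum_add_distrib]
  exact Finset.sum_congr rfl fun α _ => Finset.sum_congr rfl fun α' _ =>
    Finset.sum_congr rfl fun β _ => Finset.sum_congr rfl fun β' _ => by ring

end Algebra

theorem DerivBigO.mul_pd_mul_pd {Ω : Type*} {x : Ω → Spacetime} {g : Ω → ℝ} {I : MultiIndex}
    {w u v : Ω → Spacetime → ℝ}
    (hw : ∀ ω, ContDiffAt ℝ I.length (w ω) (x ω))
    (hw' : ∀ J : MultiIndex, J.length ≤ I.length →
      (fun ω => zPow J (w ω) (x ω)) =O[⊤] fun _ => (1 : ℝ))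
    (hu : ∀ ω, ContDiffAt ℝ (I.length + 1 : ℕ) (u ω) (x ω))
    (hv : ∀ ω, ContDiffAt ℝ (I.length + 1 : ℕ) (v ω) (x ω))
    (hO : ∀ K L : MultiIndex, K.length + L.length ≤ I.length → ∀ α β,
      (fun ω => pd α (zPow K (u ω)) (x ω) * pd β (zPow L (v ω)) (x ω)) =O[⊤] g) (μ ν : Fin 4) :
    DerivBigO x I g fun ω y => w ω y * (pd μ (u ω) y * pd ν (v ω) y) :=
  ⟨fun ω => (hw ω).mul ((contDiffAt_pd (hu ω) μ).mul (contDiffAt_pd (hv ω) ν)),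
    isBigO_zPow_mul_pd_mul_pd I hw hu hv (fun J K L hJKL α β =>
      isBigO_mul_of_one (hw' J (by lia)) (hO K L (by lia) α β)) μ ν⟩

/-- The hypotheses on a family of solutions, in the form in which they are used: near the
points `x` the fields solve the gauge condition, and at these points `n` derivatives of `h` and of
the inverse metric are bounded. -/
structure IsSolutionFamily {Ω : Type*} (x : Ω → Spacetime) (U : Ω → Set Spacetime)
    (h : Ω → TwoTensorField) (A : Ω → OneFormField) (n : ℕ) : Prop where
  isOpen : ∀ ω, IsOpen (U ω)
  mem : ∀ ω, x ω ∈ U ω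
  symm : ∀ ω μ ν, ∀ y ∈ U ω, h ω μ ν y = h ω ν μ y
  gauge : ∀ ω, WaveGauge (h ω) (U ω)
  contDiff_h : ∀ ω μ ν, ContDiffAt ℝ (n + 1 : ℕ) (h ω μ ν) (x ω)
  contDiff_A : ∀ ω β, ContDiffAt ℝ (n + 1 : ℕ) (A ω β) (x ω)
  isUnit : ∀ ω, IsUnit (mink + val₂ (h ω) (x ω)).det
  bound_h : ∀ K : MultiIndex, K.length ≤ n → ∀ μ ν,
    (fun ω => zPow K (h ω μ ν) (x ω)) =O[⊤] fun _ => (1 : ℝ)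
  bound_gInv : ∀ K : MultiIndex, K.length ≤ n → ∀ α β,
    (fun ω => zPow K (fun y => gInv (val₂ (h ω) y) α β) (x ω)) =O[⊤] fun _ => (1 : ℝ)

namespace IsSolutionFamily

variable {Ω : Type*} {x S₁ S₂ : Ω → Spacetime} {U : Ω → Set Spacetime}
  {h : Ω → TwoTensorField} {A : Ω → OneFormField} {g : Ω → ℝ} {I : MultiIndex}

theorem contDiff_gInv (H : IsSolutionFamily x U h A I.length) (ω : Ω) (α β : Fin 4) :
    ContDiffAt ℝ I.length (fun y => gInv (val₂ (h ω) y) α β) (x ω) :=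
  contDiffAt_gInv (fun μ ν => (H.contDiff_h ω μ ν).of_le (by norm_cast; lia)) (H.isUnit ω) α β

theorem contDiff_gInv_mul (H : IsSolutionFamily x U h A I.length) (ω : Ω) (α α' β β' : Fin 4) :
    ContDiffAt ℝ I.length (fun y => gInv (val₂ (h ω) y) α α' * gInv (val₂ (h ω) y) β β') (x ω) :=
  (H.contDiff_gInv ω _ _).mul (H.contDiff_gInv ω _ _)

theorem contDiff_h' (H : IsSolutionFamily x U h A I.length) (ω : Ω) (μ ν : Fin 4) :
    ContDiffAt ℝ I.length (h ω μ ν) (x ω) :=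
  (H.contDiff_h ω μ ν).of_le (by norm_cast; lia)

/-- The `LL`-components of `∂ Z^J h` in the wave gauge, multiplied by `∂ Z^K h`. -/
theorem isBigO_contract_LL_mul (H : IsSolutionFamily x U h A I.length)
    (hS : ∀ ω, IsSphereFrame (x ω) (S₁ ω) (S₂ ω)) (hr : ∀ ω, rad (x ω) ≠ 0)
    (hgood : ∀ J K : MultiIndex, J.length + K.length ≤ I.length →
      (fun ω => norm₃ (goodGrad₂ (zPow₂ J (h ω)) (x ω)) * norm₃ (grad₂ (zPow₂ K (h ω)) (x ω)))
        =O[⊤] g)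
    (hLT : ∀ J K : MultiIndex, J.length + K.length + 1 ≤ I.length →
      (fun ω => frameNorm (x ω) (S₁ ω) (S₂ ω) famL famT (grad₂ (zPow₂ J (h ω)) (x ω)) *
        norm₃ (grad₂ (zPow₂ K (h ω)) (x ω))) =O[⊤] g)
    (hlow : ∀ J K : MultiIndex, J.length + K.length + 2 ≤ I.length →
      (fun ω => norm₃ (grad₂ (zPow₂ J (h ω)) (x ω)) *
        norm₃ (grad₂ (zPow₂ K (h ω)) (x ω))) =O[⊤] g)
    (hcub : ∀ J K L : MultiIndex, J.length + K.length + L.length ≤ I.length →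
      (fun ω => norm₂ (val₂ (zPow₂ J (h ω)) (x ω)) * norm₃ (grad₂ (zPow₂ K (h ω)) (x ω)) *
        norm₃ (grad₂ (zPow₂ L (h ω)) (x ω))) =O[⊤] g)
    (J K : MultiIndex) (hJK : J.length + K.length ≤ I.length) (α : Fin 4) :
    (fun ω => contract (grad₂ (zPow₂ J (h ω)) (x ω)) (nullVec (x ω) (S₁ ω) (S₂ ω) .L)
      (nullVec (x ω) (S₁ ω) (S₂ ω) .L) α * norm₃ (grad₂ (zPow₂ K (h ω)) (x ω))) =O[⊤] g := by
  set w : Ω → ℝ := fun ω => norm₃ (grad₂ (zPow₂ K (h ω)) (x ω)) with hw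
  have w0 : ∀ ω, |w ω| ≤ 1 * w ω := fun ω => by
    rw [one_mul, abs_of_nonneg (norm₃_nonneg _)]
  refine isBigO_mul_of_restrict (isBigO_contract_LL (Ω := {ω // w ω ≠ 0}) (x := fun ω => x ω)
    (S₁ := fun ω => S₁ ω) (S₂ := fun ω => S₂ ω) (fun ω => hS ω) (fun ω => hr ω) J
    (k := fun ω => h ω) (fun ω μ ν => (H.contDiff_h ω μ ν).of_le (by norm_cast; lia))
    (fun ω μ ν => Filter.eventuallyEq_of_mem ((H.isOpen ω).mem_nhds (H.mem ω)) (H.symm ω μ ν))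
    ?_ ?_ ?_ ?_ α)
  · intro J' hJ' μ ν β
    have h1 : (fun ω => goodGrad₂ (zPow₂ J' (h ω)) (x ω) μ ν β * w ω) =O[⊤] g :=
      isBigO_mul_of_abs_le (c₁ := 1) (fun ω => by rw [one_mul]; exact abs_le_norm₃ _ μ ν β) w0
        (hgood J' K (by lia))
    have h2 := isBigO_restrict_div h1
    exact h2
  · intro J' hJ' V hV β
    have h1 : (fun ω => contract (grad₂ (zPow₂ J' (h ω)) (x ω)) (nullVec (x ω) (S₁ ω) (S₂ ω) .L)
        (nullVec (x ω) (S₁ ω) (S₂ ω) V) β * w ω) =O[⊤] g :=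
      isBigO_mul_of_abs_le (fun ω => abs_contract_le_frameNorm (𝒱 := famL) (by simp [famL]) hV _ β)
        w0 (hLT J' K (by lia))
    have h2 := isBigO_restrict_div h1
    exact h2
  · intro J' hJ' μ ν β
    have h1 : (fun ω => grad₂ (zPow₂ J' (h ω)) (x ω) μ ν β * w ω) =O[⊤] g :=
      isBigO_mul_of_abs_le (c₁ := 1) (fun ω => by rw [one_mul]; exact abs_le_norm₃ _ μ ν β) w0
        (hlow J' K (by lia))
    have h2 := isBigO_restrict_div h1
    exact h2
  · intro J' hJ' μ
    refine isBigO_zPow_gaugeForm (Ω := {ω // w ω ≠ 0}) (x := fun ω => x ω) (h := fun ω => h ω)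
      (U := fun ω => U ω) (fun ω => H.isOpen ω) (fun ω => H.mem ω) (fun ω => H.symm ω)
      (fun ω => H.gauge ω) J' (fun ω μ ν => (H.contDiff_h ω μ ν).of_le (by norm_cast; lia))
      (fun ω => H.isUnit ω) (fun K' hK' α β =>
        (H.bound_gInv K' (by lia) α β).comp_tendsto (k := Subtype.val) tendsto_top) ?_ μ
    intro K' L' hKL μ ν α β l
    have h1 : (fun ω => zPow K' (h ω μ ν) (x ω) * pd l (zPow L' (h ω α β)) (x ω) * w ω) =O[⊤] g := by
      refine isBigO_mul_of_abs_le (c₁ := 1) (fun ω => ?_) w0 (hcub K' L' K (by lia))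
      rw [abs_mul, one_mul]
      exact mul_le_mul (abs_le_norm₂ (val₂ (zPow₂ K' (h ω)) (x ω)) μ ν)
        (abs_le_norm₃ (grad₂ (zPow₂ L' (h ω)) (x ω)) α β l) (abs_nonneg _) (Real.sqrt_nonneg _)
    have h2 := isBigO_restrict_div h1
    exact h2

/-- The quadratic terms with indices raised by the Minkowski metric: `P` has the weak null
structure, and `Q` consists of null forms. -/
theorem derivBigO_formP_add_formQ (H : IsSolutionFamily x U h A I.length)
    (hS : ∀ ω, IsSphereFrame (x ω) (S₁ ω) (S₂ ω)) (hr : ∀ ω, rad (x ω) ≠ 0)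
    (hTU : ∀ J K : MultiIndex, J.length + K.length ≤ I.length →
      (fun ω => frameNorm (x ω) (S₁ ω) (S₂ ω) famT famU (grad₂ (zPow₂ J (h ω)) (x ω)) *
        frameNorm (x ω) (S₁ ω) (S₂ ω) famT famU (grad₂ (zPow₂ K (h ω)) (x ω))) =O[⊤] g)
    (hgood : ∀ J K : MultiIndex, J.length + K.length ≤ I.length →
      (fun ω => norm₃ (goodGrad₂ (zPow₂ J (h ω)) (x ω)) * norm₃ (grad₂ (zPow₂ K (h ω)) (x ω)))
        =O[⊤] g)
    (hLL : ∀ J K : MultiIndex, J.length + K.length ≤ I.length → ∀ α,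
      (fun ω => contract (grad₂ (zPow₂ J (h ω)) (x ω)) (nullVec (x ω) (S₁ ω) (S₂ ω) .L)
      (nullVec (x ω) (S₁ ω) (S₂ ω) .L) α * norm₃ (grad₂ (zPow₂ K (h ω)) (x ω))) =O[⊤] g)
    (μ ν : Fin 4) :
    DerivBigO x I g fun ω y =>
      formP mink (grad₂ (h ω) y) μ ν + formQ mink (grad₂ (h ω) y) μ ν := by
  have reg : ∀ (b : Fin 4 × Fin 4 → Fin 4 × Fin 4 → ℝ) (N : Matrix (Fin 4) (Fin 4) ℝ) ω,
      ContDiffAt ℝ I.length (fun y => gradForm b N (fun i α => pd α (h ω i.1 i.2) y)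
        (fun j α => pd α (h ω j.1 j.2) y)) (x ω) := by
    intro b N ω
    simp only [gradForm, dotProduct, Matrix.mulVec]
    exact ContDiffAt.sum fun i _ => ContDiffAt.sum fun j _ => contDiffAt_const.mul <|
        ContDiffAt.sum fun α _ => (contDiffAt_pd (H.contDiff_h ω _ _) α).mul <|
        ContDiffAt.sum fun β _ => contDiffAt_const.mul (contDiffAt_pd (H.contDiff_h ω _ _) β)
  have hsym : ∀ (J : MultiIndex) ω μ ν α, grad₂ (zPow₂ J (h ω)) (x ω) μ ν α =
      grad₂ (zPow₂ J (h ω)) (x ω) ν μ α := fun J ω => grad₂_zPow₂_symm J fun μ ν =>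
    Filter.eventuallyEq_of_mem ((H.isOpen ω).mem_nhds (H.mem ω)) (H.symm ω μ ν)
  refine DerivBigO.add ?_ ?_
  · simp only [formP_mink]
    refine ⟨reg _ _, isBigO_zPow_gradForm coeffP (S := Set.univ) (fun _ _ _ => Set.mem_univ _) I
      (u := fun ω i => h ω i.1 i.2) (v := fun ω i => h ω i.1 i.2)
      (fun ω i => H.contDiff_h ω _ _) (fun ω i => H.contDiff_h ω _ _) (fun J K hJK N _ => ?_) _
      (Set.mem_univ _)⟩
    exact isBigO_gradForm_coeffP hS hr (hsym J) (hsym K) (hTU J K hJK) (hLL J K hJK)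
      (hLL K J (by lia)) N
  · have null : ∀ (N : Matrix (Fin 4) (Fin 4) ℝ), N ∈ nullForms → ∀ i₁ i₂ j₁ j₂ : Fin 4,
        DerivBigO x I g fun ω y =>
          grad₂ (h ω) y i₁ i₂ ⬝ᵥ N *ᵥ grad₂ (h ω) y j₁ j₂ := by
      intro N hN i₁ i₂ j₁ j₂
      set b : Fin 4 × Fin 4 → Fin 4 × Fin 4 → ℝ :=
        fun i j => if i = (i₁, i₂) then if j = (j₁, j₂) then 1 else 0 else 0 with hb
      have e : (fun (ω : Ω) y => grad₂ (h ω) y i₁ i₂ ⬝ᵥ N *ᵥ grad₂ (h ω) y j₁ j₂) =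
          fun ω y => gradForm b N (fun i α => pd α (h ω i.1 i.2) y)
            (fun j α => pd α (h ω j.1 j.2) y) := by
        funext ω y
        simp only [gradForm, hb, ite_mul, zero_mul, one_mul, Finset.sum_ite_eq',
          Finset.sum_ite_irrel, Finset.sum_const_zero, Finset.mem_univ, if_true]
        rfl
      rw [e]
      exact ⟨reg _ _, isBigO_zPow_gradForm b (fun _ h a => commutator_mem_nullForms h a) I
        (u := fun ω i => h ω i.1 i.2) (v := fun ω i => h ω i.1 i.2)
        (fun ω i => H.contDiff_h ω _ _) (fun ω i => H.contDiff_h ω _ _) (fun J K hJK N hN =>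
          isBigO_gradForm_nullForms (h := fun ω => zPow₂ J (h ω)) (k := fun ω => zPow₂ K (h ω))
            hr b hN (hgood J K hJK) (hgood K J (by lia))) N hN⟩
    have anti := fun a b => null _ (single_sub_single_mem_nullForms a b)
    simp only [formQ_mink]
    exact (DerivBigO.sum fun β _ => DerivBigO.sum fun β' _ =>
      (null _ mink_mem_nullForms _ _ _ _).const_mul _).add <|
      DerivBigO.sum fun α _ => DerivBigO.sum fun α' _ => DerivBigO.sum fun β _ =>
      DerivBigO.sum fun β' _ => DerivBigO.const_mul
        ((((((anti _ _ _ _ _ _).const_mul _).add (anti _ _ _ _ _ _)).add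
          (anti _ _ _ _ _ _)).add ((anti _ _ _ _ _ _).const_mul _)).add
          ((anti _ _ _ _ _ _).const_mul _)) _

/-- The remainder of the quadratic terms is cubic, one factor being `g⁻¹ g⁻¹ - m⁻¹ m⁻¹`. -/
theorem derivBigO_formG (H : IsSolutionFamily x U h A I.length)
    (hcub : ∀ J K L : MultiIndex, J.length + K.length + L.length ≤ I.length →
      (fun ω => norm₂ (val₂ (zPow₂ J (h ω)) (x ω)) * norm₃ (grad₂ (zPow₂ K (h ω)) (x ω)) *
        norm₃ (grad₂ (zPow₂ L (h ω)) (x ω))) =O[⊤] g) (μ ν : Fin 4) :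
    DerivBigO x I g fun ω y => formG (val₂ (h ω) y) (grad₂ (h ω) y) μ ν := by
  obtain ⟨T, hT⟩ : ∃ T : Fin 4 → Fin 4 → Fin 4 → Fin 4 → Fin 4 → Fin 4 → Fin 4 → Fin 4 → Fin 4 →
      Fin 4 → Ω → Spacetime → ℝ, T = fun α α' β β' i₁ i₂ i₃ j₁ j₂ j₃ ω y =>
        (gInv (val₂ (h ω) y) α α' * gInv (val₂ (h ω) y) β β' - mink α α' * mink β β') *
          (pd i₃ (h ω i₁ i₂) y * pd j₃ (h ω j₁ j₂) y) := ⟨_, rfl⟩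
  have t : ∀ α α' β β' i₁ i₂ i₃ j₁ j₂ j₃ : Fin 4,
      DerivBigO x I g fun ω y => T α α' β β' i₁ i₂ i₃ j₁ j₂ j₃ ω y := by
    intro α α' β β' i₁ i₂ i₃ j₁ j₂ j₃
    rw [hT]
    have rw' : ∀ ω, ContDiffAt ℝ I.length (fun y => gInv (val₂ (h ω) y) α α' *
        gInv (val₂ (h ω) y) β β' - mink α α' * mink β β') (x ω) :=
      fun ω => (H.contDiff_gInv_mul ω _ _ _ _).sub contDiffAt_const
    refine ⟨fun ω => (rw' ω).mul ((contDiffAt_pd (H.contDiff_h ω _ _) _).mul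
      (contDiffAt_pd (H.contDiff_h ω _ _) _)), isBigO_zPow_mul_pd_mul_pd I rw'
      (fun ω => H.contDiff_h ω _ _) (fun ω => H.contDiff_h ω _ _) (fun J K L hJKL a b => ?_) _ _⟩
    refine isBigO_zPow_gInv_mul_sub_mink_mul J
      (fun ω μ ν => (H.contDiff_h ω μ ν).of_le (by norm_cast; lia)) H.isUnit
      (fun K' hK' => H.bound_gInv K' (by lia)) (fun K' hK' μ' ν' => ?_) α α' β β'
    simp only [← mul_assoc]
    refine isBigO_mul_of_abs_le (c₁ := 1) (c₂ := 1) (fun ω => ?_) (fun ω => ?_)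
      (hcub K' K L (by lia))
    · rw [abs_mul, one_mul]
      exact mul_le_mul (abs_le_norm₂ (val₂ (zPow₂ K' (h ω)) (x ω)) μ' ν')
        (abs_le_norm₃ (grad₂ (zPow₂ K (h ω)) (x ω)) i₁ i₂ a) (abs_nonneg _) (Real.sqrt_nonneg _)
    · rw [one_mul]
      exact abs_le_norm₃ (grad₂ (zPow₂ L (h ω)) (x ω)) j₁ j₂ b
  have e : ∀ ω y, formG (val₂ (h ω) y) (grad₂ (h ω) y) μ ν = ∑ α, ∑ α', ∑ β, ∑ β',
      (1 / 4 * T α α' β β' β β' μ α α' ν ω y - 1 / 2 * T α α' β β' α β ν α' β' μ ω y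
       
        + T α α' β β' β μ α β' ν α' ω y
        - T α α' β β' β μ α α' ν β' ω y + T α α' β β' β μ β' α' ν α ω y
        + T α α' β β' α' β' μ β ν α ω y - T α α' β β' α' β' α β ν μ ω y
        + T α α' β β' α' β' ν β μ α ω y - T α α' β β' α' β' α β μ ν ω y
        + 1 / 2 * T α α' β β' α α' β' β ν μ ω y - 1 / 2 * T α α' β β' α α' μ β ν β' ω y
        + 1 / 2 * T α α' β β' α α' β' β μ ν ω y - 1 / 2 * T α α' β β' α α' ν β μ β' ω y) := by
    intro ω y
    simp only [formG, formP, formQ, ← Finset.sum_sub_distrib, ← Finset.sum_add_distrib]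
    exact Finset.sum_congr rfl fun α _ => Finset.sum_congr rfl fun α' _ =>
      Finset.sum_congr rfl fun β _ => Finset.sum_congr rfl fun β' _ => by
        simp only [grad₂, hT]; ring
  simp only [e]
  refine DerivBigO.sum fun α _ => DerivBigO.sum fun α' _ => DerivBigO.sum fun β _ =>
      DerivBigO.sum fun β' _ => ?_
  refine .sub (.add (.sub (.add (.sub (.add (.sub (.add (.add (.sub (.add (.sub ?_ ?_) ?_) ?_) ?_)
    ?_) ?_) ?_) ?_) ?_) ?_) ?_) ?_
  all_goals first
    | exact t _ _ _ _ _ _ _ _ _ _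
    | exact (t _ _ _ _ _ _ _ _ _ _).const_mul _

theorem derivBigO_fieldF (H : IsSolutionFamily x U h A I.length)
    (hPQ : ∀ μ ν, DerivBigO x I g fun ω y =>
      formP mink (grad₂ (h ω) y) μ ν + formQ mink (grad₂ (h ω) y) μ ν)
    (hG : ∀ μ ν, DerivBigO x I g fun ω y => formG (val₂ (h ω) y) (grad₂ (h ω) y) μ ν)
    (hA : ∀ J K : MultiIndex, J.length + K.length ≤ I.length →
      (fun ω => norm₂ (grad₁ (zPow₁ J (A ω)) (x ω)) * norm₂ (grad₁ (zPow₁ K (A ω)) (x ω)))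
        =O[⊤] g) (μ ν : Fin 4) :
    DerivBigO x I g fun ω y => fieldF (h ω) (A ω) μ ν y := by
  have hO : ∀ a b : Fin 4, ∀ K L : MultiIndex, K.length + L.length ≤ I.length → ∀ α β,
      (fun ω => pd α (zPow K (A ω a)) (x ω) * pd β (zPow L (A ω b)) (x ω)) =O[⊤] g :=
    fun a b K L hKL α β => isBigO_mul_of_abs_le (c₁ := 1) (c₂ := 1)
      (fun ω => by rw [one_mul]; exact abs_le_norm₂ (grad₁ (zPow₁ K (A ω)) (x ω)) a α)
      (fun ω => by rw [one_mul]; exact abs_le_norm₂ (grad₁ (zPow₁ L (A ω)) (x ω)) b β) (hA K L hKL)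
  have t1 : ∀ α β a i b j : Fin 4, DerivBigO x I g fun ω y =>
      gInv (val₂ (h ω) y) α β * (pd i (A ω a) y * pd j (A ω b) y) := fun α β a i b j =>
    DerivBigO.mul_pd_mul_pd (fun ω => H.contDiff_gInv ω α β) (fun J hJ => H.bound_gInv J hJ α β)
      (fun ω => H.contDiff_A ω a) (fun ω => H.contDiff_A ω b) (hO a b) i j
  have bm : ∀ J : MultiIndex, J.length ≤ I.length →
      (fun ω => zPow J (fun y => mink μ ν + h ω μ ν y) (x ω)) =O[⊤] fun _ => (1 : ℝ) := by
    intro J hJ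
    obtain ⟨d, hd⟩ := zPow_const_isConst J (mink μ ν)
    refine isBigO_zPow_add J (fun ω => contDiffAt_const)
      (fun ω => (H.contDiff_h ω μ ν).of_le (by norm_cast; lia)) ?_ (H.bound_h J hJ μ ν)
    simp only [hd]
    exact isBigO_const_const _ one_ne_zero _
  have t2 : ∀ α ρ β σ a i b j : Fin 4, DerivBigO x I g fun ω y =>
      ((mink μ ν + h ω μ ν y) * (gInv (val₂ (h ω) y) α ρ * gInv (val₂ (h ω) y) β σ)) *
        (pd i (A ω a) y * pd j (A ω b) y) := by
    intro α ρ β σ a i b j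
    refine DerivBigO.mul_pd_mul_pd (fun ω => (contDiffAt_const.add (H.contDiff_h' ω μ ν)).mul
      (H.contDiff_gInv_mul ω α ρ β σ)) (fun J hJ => isBigO_zPow_mul J
        (fun ω => contDiffAt_const.add ((H.contDiff_h' ω μ ν).of_le (by exact_mod_cast hJ)))
        (fun ω => (H.contDiff_gInv_mul ω α ρ β σ).of_le (by exact_mod_cast hJ))
        fun K L hKL => isBigO_one_mul (bm K (by lia)) ?_)
      (fun ω => H.contDiff_A ω a) (fun ω => H.contDiff_A ω b) (hO a b) i j
    exact isBigO_zPow_gInv_mul_gInv L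
      (fun ω μ ν => (H.contDiff_h ω μ ν).of_le (by norm_cast; lia)) H.isUnit
      (fun K' hK' => H.bound_gInv K' (by lia)) α ρ β σ
  have e : (fun ω y => fieldF (h ω) (A ω) μ ν y) = fun ω y =>
      formP mink (grad₂ (h ω) y) μ ν + formQ mink (grad₂ (h ω) y) μ ν
      + formG (val₂ (h ω) y) (grad₂ (h ω) y) μ ν
      + -2 * ∑ α, ∑ β, (gInv (val₂ (h ω) y) α β * (pd α (A ω μ) y * pd β (A ω ν) y)
        - gInv (val₂ (h ω) y) α β * (pd α (A ω μ) y * pd ν (A ω β) y)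
        - gInv (val₂ (h ω) y) α β * (pd μ (A ω α) y * pd β (A ω ν) y)
        + gInv (val₂ (h ω) y) α β * (pd μ (A ω α) y * pd ν (A ω β) y))
      + 1 / 2 * ∑ α, ∑ ρ, ∑ β, ∑ σ,
        (((mink μ ν + h ω μ ν y) * (gInv (val₂ (h ω) y) α ρ * gInv (val₂ (h ω) y) β σ)) *
            (pd α (A ω β) y * pd ρ (A ω σ) y)
        - ((mink μ ν + h ω μ ν y) * (gInv (val₂ (h ω) y) α ρ * gInv (val₂ (h ω) y) β σ)) *
            (pd α (A ω β) y * pd σ (A ω ρ) y)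
        - ((mink μ ν + h ω μ ν y) * (gInv (val₂ (h ω) y) α ρ * gInv (val₂ (h ω) y) β σ)) *
            (pd β (A ω α) y * pd ρ (A ω σ) y)
        + ((mink μ ν + h ω μ ν y) * (gInv (val₂ (h ω) y) α ρ * gInv (val₂ (h ω) y) β σ)) *
            (pd β (A ω α) y * pd σ (A ω ρ) y)) := by
    funext ω y
    rw [fieldF, sourceF_eq, formG, neg_mul, ← sub_eq_add_neg]
    congr 1
    · congr 1
      · ring
      · congr 1
        refine Finset.sum_congr rfl fun α _ => Finset.sum_congr rfl fun β _ => ?_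
        simp only [faraday, grad₁]; ring
    · congr 1
      simp only [Finset.mul_sum]
      refine Finset.sum_congr rfl fun α _ => Finset.sum_congr rfl fun ρ _ =>
        Finset.sum_congr rfl fun β _ => Finset.sum_congr rfl fun σ _ => ?_
      simp only [faraday, grad₁, val₂, Matrix.of_apply]; ring
  rw [e]
  refine (((hPQ μ ν).add (hG μ ν)).add (DerivBigO.const_mul (.sum fun α _ => .sum fun β _ =>
    .add (.sub (.sub ?_ ?_) ?_) ?_) _)).add (DerivBigO.const_mul (.sum fun α _ => .sum fun ρ _ =>
    .sum fun β _ => .sum fun σ _ => .add (.sub (.sub ?_ ?_) ?_) ?_) _)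
  all_goals first | exact t1 _ _ _ _ _ _ | exact t2 _ _ _ _ _ _ _ _

theorem derivBigO_fieldJ (H : IsSolutionFamily x U h A I.length)
    (hhA : ∀ J K : MultiIndex, J.length + K.length ≤ I.length →
      (fun ω => norm₃ (grad₂ (zPow₂ J (h ω)) (x ω)) * norm₂ (grad₁ (zPow₁ K (A ω)) (x ω)))
        =O[⊤] g) (β : Fin 4) :
    DerivBigO x I g fun ω y => fieldJ (h ω) (A ω) β y := by
  obtain ⟨T, hT⟩ : ∃ T : Fin 4 → Fin 4 → Fin 4 → Fin 4 → Fin 4 → Fin 4 → Fin 4 → Fin 4 → Fin 4 →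
      Ω → Spacetime → ℝ, T = fun α θ μ l i₁ i₂ i₃ j₁ j₂ ω y =>
        (gInv (val₂ (h ω) y) α θ * gInv (val₂ (h ω) y) μ l) *
          (pd i₃ (h ω i₁ i₂) y * pd j₂ (A ω j₁) y) := ⟨_, rfl⟩
  have t : ∀ α θ μ l i₁ i₂ i₃ j₁ j₂ : Fin 4,
      DerivBigO x I g fun ω y => T α θ μ l i₁ i₂ i₃ j₁ j₂ ω y := by
    intro α θ μ l i₁ i₂ i₃ j₁ j₂
    rw [hT]
    exact DerivBigO.mul_pd_mul_pd (fun ω => H.contDiff_gInv_mul ω α θ μ l)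
      (fun J hJ => isBigO_zPow_gInv_mul_gInv J
        (fun ω μ ν => (H.contDiff_h ω μ ν).of_le (by norm_cast; lia)) H.isUnit
        (fun K' hK' => H.bound_gInv K' (by lia)) α θ μ l)
      (fun ω => H.contDiff_h ω i₁ i₂) (fun ω => H.contDiff_A ω j₁)
      (fun K L hKL a b => isBigO_mul_of_abs_le (c₁ := 1) (c₂ := 1)
        (fun ω => by rw [one_mul]; exact abs_le_norm₃ (grad₂ (zPow₂ K (h ω)) (x ω)) i₁ i₂ a)
        (fun ω => by rw [one_mul]; exact abs_le_norm₂ (grad₁ (zPow₁ L (A ω)) (x ω)) j₁ b)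
        (hhA K L hKL)) i₃ j₂
  have e : (fun ω y => fieldJ (h ω) (A ω) β y) = fun ω y =>
      (∑ α, ∑ θ, ∑ μ, ∑ l, T α θ μ l θ μ β α l ω y)
      + 1 / 2 * ∑ α, ∑ l, ∑ θ, ∑ μ, (T α l θ μ μ β l θ α ω y + T α l θ μ μ l β θ α ω y
        - T α l θ μ l β μ θ α ω y - T α l θ μ μ β l α θ ω y - T α l θ μ μ l β α θ ω y
        + T α l θ μ l β μ α θ ω y) := by
    funext ω y
    rw [fieldJ, sourceJ_eq]
    congr 1
    · refine Finset.sum_congr rfl fun α _ => Finset.sum_congr rfl fun θ _ =>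
        Finset.sum_congr rfl fun μ _ => Finset.sum_congr rfl fun l _ => ?_
      simp only [grad₁, grad₂, hT]; ring
    · congr 1
      refine Finset.sum_congr rfl fun α _ => Finset.sum_congr rfl fun l _ =>
        Finset.sum_congr rfl fun θ _ => Finset.sum_congr rfl fun μ _ => ?_
      simp only [faraday, grad₁, grad₂, hT]; ring
  rw [e]
  refine DerivBigO.add (.sum fun α _ => .sum fun θ _ => .sum fun μ _ => .sum fun l _ =>
    t _ _ _ _ _ _ _ _ _) (DerivBigO.const_mul (.sum fun α _ => .sum fun l _ => .sum fun θ _ =>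
    .sum fun μ _ => .add (.sub (.sub (.sub (.add ?_ ?_) ?_) ?_) ?_) ?_) _)
  all_goals exact t _ _ _ _ _ _ _ _ _

end IsSolutionFamily

/-! ### Uniform constants -/

section Uniform

variable {Ω : Type*} {g : Ω → ℝ}

theorem isBigO_sqrt_sum_sq {ι : Type*} (s : Finset ι) {f : ι → Ω → ℝ}
    (hf : ∀ i ∈ s, f i =O[⊤] g) : (fun ω => √(∑ i ∈ s, f i ω ^ 2)) =O[⊤] g := by
  have h : (fun ω => ∑ i ∈ s, |f i ω|) =O[⊤] g := IsBigO.fun_sum fun i hi => (hf i hi).abs_left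
  refine IsBigO.trans (IsBigO.of_bound 1 (Eventually.of_forall fun ω => ?_)) h
  have h0 : 0 ≤ ∑ i ∈ s, |f i ω| := Finset.sum_nonneg fun _ _ => abs_nonneg _
  rw [Real.norm_of_nonneg (Real.sqrt_nonneg _), one_mul, Real.norm_of_nonneg h0]
  refine Real.sqrt_le_iff.2 ⟨h0, ?_⟩
  simp only [← sq_abs (f _ ω)]
  exact Finset.sum_sq_le_sq_sum_of_nonneg fun _ _ => abs_nonneg _

theorem isBigO_norm₁ {p : Ω → Fin 4 → ℝ} (hp : ∀ α, (fun ω => p ω α) =O[⊤] g) :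
    (fun ω => norm₁ (p ω)) =O[⊤] g :=
  isBigO_sqrt_sum_sq Finset.univ fun α _ => hp α

theorem isBigO_norm₂ {p : Ω → Fin 4 → Fin 4 → ℝ} (hp : ∀ α β, (fun ω => p ω α β) =O[⊤] g) :
    (fun ω => norm₂ (p ω)) =O[⊤] g := by
  have h := isBigO_sqrt_sum_sq (Finset.univ : Finset (Fin 4 × Fin 4))
    (f := fun i ω => p ω i.1 i.2) fun i _ => hp i.1 i.2
  simpa only [Fintype.sum_prod_type, norm₂] using h

/-- Bounds for finitely many families hold with a common constant. -/
theorem exists_uniform_bound {ι : Type*} (s : Finset ι) {F : ι → Ω → ℝ}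
    (hF : ∀ i ∈ s, F i =O[⊤] g) (hg : ∀ ω, 0 ≤ g ω) :
    ∃ C : ℝ, 0 ≤ C ∧ ∀ i ∈ s, ∀ ω, F i ω ≤ C * g ω := by
  have h : (fun ω => ∑ i ∈ s, |F i ω|) =O[⊤] g := IsBigO.fun_sum fun i hi => (hF i hi).abs_left
  obtain ⟨C, hC0, hC⟩ := h.exists_nonneg
  refine ⟨C, hC0, fun i hi ω => ?_⟩
  have h1 := isBigOWith_top.1 hC ω
  rw [Real.norm_of_nonneg (hg ω)] at h1
  exact (le_abs_self _).trans <| (Finset.single_le_sum (f := fun i => |F i ω|)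
    (fun _ _ => abs_nonneg _) hi).trans <| (le_abs_self _).trans h1

theorem isBigO_of_le_of_nonneg {f : Ω → ℝ} (h0 : ∀ ω, 0 ≤ f ω) (h : ∀ ω, f ω ≤ g ω) : f =O[⊤] g :=
  IsBigO.of_bound 1 (Eventually.of_forall fun ω => by
    rw [Real.norm_of_nonneg (h0 ω), one_mul, Real.norm_of_nonneg ((h0 ω).trans (h ω))]
    exact h ω)

end Uniform

/-! ### The estimates for the source terms -/

/-- The data of the estimates: fields satisfying the hypotheses, and a point of their domain. -/
structure Config (k : ℕ) (Ct : ℝ) where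
  /-- The domain. -/
  U : Set Spacetime
  /-- The perturbation of the metric. -/
  h : TwoTensorField
  /-- The electromagnetic potential. -/
  A : OneFormField
  /-- The point. -/
  x : Spacetime
  isOpen : IsOpen U
  mem : x ∈ U
  symm : ∀ μ ν, ∀ x ∈ U, h μ ν x = h ν μ x
  contDiff_h : ∀ μ ν, ContDiffOn ℝ (k + 1 : ℕ) (h μ ν) U
  contDiff_A : ∀ β, ContDiffOn ℝ (k + 1 : ℕ) (A β) U
  gauge : WaveGauge h U
  bound : ∀ J : MultiIndex, J.length ≤ k → ∀ x ∈ U, norm₂ (val₂ (zPow₂ J h) x) ≤ Ct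

theorem Config.isSolutionFamily {k : ℕ} {Ct : ℝ} (hCt : Ct < 1) {Ω : Type*}
    (c : Ω → Config k Ct) :
    IsSolutionFamily (fun ω => (c ω).x) (fun ω => (c ω).U) (fun ω => (c ω).h)
      (fun ω => (c ω).A) k := by
  have hh : ∀ ω μ ν, ContDiffAt ℝ (k + 1 : ℕ) ((c ω).h μ ν) (c ω).x := fun ω μ ν =>
    ((c ω).contDiff_h μ ν).contDiffAt ((c ω).isOpen.mem_nhds (c ω).mem)
  have h0 : ∀ ω, norm₂ (val₂ (c ω).h (c ω).x) ≤ Ct := fun ω =>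
    (c ω).bound [] (Nat.zero_le _) _ (c ω).mem
  have hu : ∀ ω, IsUnit (mink + val₂ (c ω).h (c ω).x).det := fun ω =>
    isUnit_det_mink_add ((h0 ω).trans_lt hCt)
  have hb : ∀ K : MultiIndex, K.length ≤ k → ∀ μ ν,
      (fun ω => zPow K ((c ω).h μ ν) (c ω).x) =O[⊤] fun _ => (1 : ℝ) := fun K hK μ ν =>
    isBigO_one_of_abs_le fun ω => (abs_le_norm₂ (val₂ (zPow₂ K (c ω).h) (c ω).x) μ ν).trans
      ((c ω).bound K hK _ (c ω).mem)
  exact {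
    isOpen := fun ω => (c ω).isOpen
    mem := fun ω => (c ω).mem
    symm := fun ω => (c ω).symm
    gauge := fun ω => (c ω).gauge
    contDiff_h := hh
    contDiff_A := fun ω β => ((c ω).contDiff_A β).contDiffAt ((c ω).isOpen.mem_nhds (c ω).mem)
    isUnit := hu
    bound_h := hb
    bound_gInv := fun K hK α β => isBigO_zPow_gInv
      (fun ω μ ν => (hh ω μ ν).of_le (by norm_cast; lia)) hu
      (fun α β => isBigO_one_of_abs_le fun ω => abs_gInv_le (h0 ω) hCt α β) hb K hK α β }

/-- The right side of the estimate of the Einstein source term. -/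
def boundF (k : ℕ) (x S₁ S₂ : Spacetime) (h : TwoTensorField) (A : OneFormField) : ℝ :=
  (∑ JK ∈ indexPairs k 0,
    (frameNorm x S₁ S₂ famT famU (grad₂ (zPow₂ JK.1 h) x) *
        frameNorm x S₁ S₂ famT famU (grad₂ (zPow₂ JK.2 h) x) +
      norm₃ (goodGrad₂ (zPow₂ JK.1 h) x) * norm₃ (grad₂ (zPow₂ JK.2 h) x)))
  + (∑ JK ∈ indexPairs k 1,
      frameNorm x S₁ S₂ famL famT (grad₂ (zPow₂ JK.1 h) x) *
        norm₃ (grad₂ (zPow₂ JK.2 h) x))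
  + (∑ JK ∈ indexPairs k 2,
      norm₃ (grad₂ (zPow₂ JK.1 h) x) * norm₃ (grad₂ (zPow₂ JK.2 h) x))
  + (∑ JJJ ∈ indexTriples k,
      norm₂ (val₂ (zPow₂ JJJ.2.2 h) x) *
        norm₃ (grad₂ (zPow₂ JJJ.2.1 h) x) * norm₃ (grad₂ (zPow₂ JJJ.1 h) x))
  + (∑ JJ ∈ indexPairs k 0,
      norm₂ (grad₁ (zPow₁ JJ.1 A) x) * norm₂ (grad₁ (zPow₁ JJ.2 A) x))

/-- The right side of the estimate of the Maxwell source term. -/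
def boundJ (k : ℕ) (x : Spacetime) (h : TwoTensorField) (A : OneFormField) : ℝ :=
  ∑ II ∈ indexPairs k 0, norm₃ (grad₂ (zPow₂ II.1 h) x) * norm₂ (grad₁ (zPow₁ II.2 A) x)

theorem mem_indexPairs {k s : ℕ} {J K : MultiIndex} :
    (J, K) ∈ indexPairs k s ↔ J.length + K.length + s ≤ k := by
  simp only [indexPairs, Finset.mem_filter, Finset.mem_product, mem_multiIndices]
  lia

theorem mem_indexTriples {k : ℕ} {J K L : MultiIndex} :
    (J, K, L) ∈ indexTriples k ↔ J.length + K.length + L.length ≤ k := by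
  simp only [indexTriples, Finset.mem_filter, Finset.mem_product, mem_multiIndices]
  lia

theorem norm₂_nonneg (p : Fin 4 → Fin 4 → ℝ) : 0 ≤ norm₂ p := Real.sqrt_nonneg _

section Terms

variable (k : ℕ) (x S₁ S₂ : Spacetime) (h : TwoTensorField) (A : OneFormField)

theorem boundJ_term_le {J K : MultiIndex} (hJK : J.length + K.length ≤ k) :
    norm₃ (grad₂ (zPow₂ J h) x) * norm₂ (grad₁ (zPow₁ K A) x) ≤ boundJ k x h A := by
  have p : ∀ i : MultiIndex × MultiIndex, 0 ≤ norm₃ (grad₂ (zPow₂ i.1 h) x) *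
      norm₂ (grad₁ (zPow₁ i.2 A) x) := fun i => mul_nonneg (norm₃_nonneg _) (norm₂_nonneg _)
  have := Finset.single_le_sum (fun i _ => p i) ((mem_indexPairs (s := 0)).2 hJK)
  unfold boundJ
  linarith

theorem boundJ_nonneg : 0 ≤ boundJ k x h A :=
  Finset.sum_nonneg fun _ _ => mul_nonneg (norm₃_nonneg _) (norm₂_nonneg _)

/-- Each summand of the right side is bounded by the whole, since all of them are nonnegative. -/
theorem boundF_terms :
    0 ≤ boundF k x S₁ S₂ h A ∧
    (∀ J K : MultiIndex, J.length + K.length ≤ k →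
      frameNorm x S₁ S₂ famT famU (grad₂ (zPow₂ J h) x) *
        frameNorm x S₁ S₂ famT famU (grad₂ (zPow₂ K h) x) ≤ boundF k x S₁ S₂ h A) ∧
    (∀ J K : MultiIndex, J.length + K.length ≤ k →
      norm₃ (goodGrad₂ (zPow₂ J h) x) * norm₃ (grad₂ (zPow₂ K h) x) ≤ boundF k x S₁ S₂ h A) ∧
    (∀ J K : MultiIndex, J.length + K.length + 1 ≤ k →
      frameNorm x S₁ S₂ famL famT (grad₂ (zPow₂ J h) x) *
        norm₃ (grad₂ (zPow₂ K h) x) ≤ boundF k x S₁ S₂ h A) ∧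
    (∀ J K : MultiIndex, J.length + K.length + 2 ≤ k →
      norm₃ (grad₂ (zPow₂ J h) x) * norm₃ (grad₂ (zPow₂ K h) x) ≤ boundF k x S₁ S₂ h A) ∧
    (∀ J K L : MultiIndex, J.length + K.length + L.length ≤ k →
      norm₂ (val₂ (zPow₂ J h) x) * norm₃ (grad₂ (zPow₂ K h) x) *
        norm₃ (grad₂ (zPow₂ L h) x) ≤ boundF k x S₁ S₂ h A) ∧
    (∀ J K : MultiIndex, J.length + K.length ≤ k →
      norm₂ (grad₁ (zPow₁ J A) x) * norm₂ (grad₁ (zPow₁ K A) x) ≤ boundF k x S₁ S₂ h A) := by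
  have p₁ : ∀ i : MultiIndex × MultiIndex, 0 ≤ frameNorm x S₁ S₂ famT famU (grad₂ (zPow₂ i.1 h) x) *
        frameNorm x S₁ S₂ famT famU (grad₂ (zPow₂ i.2 h) x) := fun i =>
    mul_nonneg (frameNorm_nonneg _ _ _) (frameNorm_nonneg _ _ _)
  have p₁' : ∀ i : MultiIndex × MultiIndex, 0 ≤ norm₃ (goodGrad₂ (zPow₂ i.1 h) x) *
      norm₃ (grad₂ (zPow₂ i.2 h) x) := fun i => mul_nonneg (norm₃_nonneg _) (norm₃_nonneg _)
  have p₂ : ∀ i : MultiIndex × MultiIndex, 0 ≤ frameNorm x S₁ S₂ famL famT (grad₂ (zPow₂ i.1 h) x) *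
        norm₃ (grad₂ (zPow₂ i.2 h) x) := fun i => mul_nonneg (frameNorm_nonneg _ _ _) (norm₃_nonneg _)
  have p₃ : ∀ i : MultiIndex × MultiIndex, 0 ≤ norm₃ (grad₂ (zPow₂ i.1 h) x) *
      norm₃ (grad₂ (zPow₂ i.2 h) x) := fun i => mul_nonneg (norm₃_nonneg _) (norm₃_nonneg _)
  have p₄ : ∀ i : MultiIndex × MultiIndex × MultiIndex, 0 ≤ norm₂ (val₂ (zPow₂ i.2.2 h) x) *
        norm₃ (grad₂ (zPow₂ i.2.1 h) x) * norm₃ (grad₂ (zPow₂ i.1 h) x) := fun i =>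
    mul_nonneg (mul_nonneg (norm₂_nonneg _) (norm₃_nonneg _)) (norm₃_nonneg _)
  have p₅ : ∀ i : MultiIndex × MultiIndex, 0 ≤ norm₂ (grad₁ (zPow₁ i.1 A) x) *
      norm₂ (grad₁ (zPow₁ i.2 A) x) := fun i => mul_nonneg (norm₂_nonneg _) (norm₂_nonneg _)
  have s₁ := Finset.sum_nonneg fun i (_ : i ∈ indexPairs k 0) => add_nonneg (p₁ i) (p₁' i)
  have s₂ := Finset.sum_nonneg fun i (_ : i ∈ indexPairs k 1) => p₂ i
  have s₃ := Finset.sum_nonneg fun i (_ : i ∈ indexPairs k 2) => p₃ i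
  have s₄ := Finset.sum_nonneg fun i (_ : i ∈ indexTriples k) => p₄ i
  have s₅ := Finset.sum_nonneg fun i (_ : i ∈ indexPairs k 0) => p₅ i
  refine ⟨?_, fun J K hJK => ?_, fun J K hJK => ?_, fun J K hJK => ?_, fun J K hJK => ?_,
    fun J K L hJKL => ?_, fun J K hJK => ?_⟩ <;> unfold boundF
  · positivity
  · have := Finset.single_le_sum (fun i _ => add_nonneg (p₁ i) (p₁' i))
      ((mem_indexPairs (s := 0)).2 hJK)
    have := p₁' (J, K)
    linarith
  · have := Finset.single_le_sum (fun i _ => add_nonneg (p₁ i) (p₁' i))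
      ((mem_indexPairs (s := 0)).2 hJK)
    have := p₁ (J, K)
    linarith
  · have := Finset.single_le_sum (fun i _ => p₂ i) (mem_indexPairs.2 hJK)
    linarith
  · have := Finset.single_le_sum (fun i _ => p₃ i) (mem_indexPairs.2 hJK)
    linarith
  · have := Finset.single_le_sum (fun i _ => p₄ i)
      (mem_indexTriples.2 (show L.length + K.length + J.length ≤ k by lia))
    linarith
  · have := Finset.single_le_sum (fun i _ => p₅ i) ((mem_indexPairs (s := 0)).2 hJK)
    linarith

end Terms

/-- The data of the estimate of the Einstein source term, with a null frame at the point. -/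
structure FramedConfig (k : ℕ) (Ct : ℝ) extends Config k Ct where
  /-- The first vector tangent to the sphere. -/
  S₁ : Spacetime
  /-- The second vector tangent to the sphere. -/
  S₂ : Spacetime
  rad_ne_zero : rad x ≠ 0
  isSphereFrame : IsSphereFrame x S₁ S₂

theorem isBigO_zPow_fieldF {k : ℕ} {Ct : ℝ} (hCt : Ct < 1) (I : MultiIndex) (hI : I.length = k) :
    (fun c : FramedConfig k Ct => norm₂ (val₂ (zPow₂ I (fieldF c.h c.A)) c.x)) =O[⊤]
      fun c => boundF k c.x c.S₁ c.S₂ c.h c.A := by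
  subst hI
  have H := Config.isSolutionFamily hCt fun c : FramedConfig I.length Ct => c.toConfig
  have T := fun c : FramedConfig I.length Ct => boundF_terms I.length c.x c.S₁ c.S₂ c.h c.A
  have hgood := fun (J K : MultiIndex) (hJK : J.length + K.length ≤ I.length) =>
    isBigO_of_le_of_nonneg (fun c : FramedConfig I.length Ct => mul_nonneg (norm₃_nonneg _)
      (norm₃_nonneg _)) (fun c => (T c).2.2.1 J K hJK)
  have hcub := fun (J K L : MultiIndex) (hJKL : J.length + K.length + L.length ≤ I.length) =>
    isBigO_of_le_of_nonneg (fun c : FramedConfig I.length Ct => mul_nonneg (mul_nonneg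
      (norm₂_nonneg _) (norm₃_nonneg _)) (norm₃_nonneg _)) (fun c => (T c).2.2.2.2.2.1 J K L hJKL)
  refine isBigO_norm₂ fun μ ν => (H.derivBigO_fieldF (H.derivBigO_formP_add_formQ
    (fun c => c.isSphereFrame) (fun c => c.rad_ne_zero) (fun J K hJK => ?_) hgood
    (H.isBigO_contract_LL_mul (fun c => c.isSphereFrame) (fun c => c.rad_ne_zero) hgood
      (fun J K hJK => ?_) (fun J K hJK => ?_) hcub)) (H.derivBigO_formG hcub)
    (fun J K hJK => ?_) μ ν).2
  · exact isBigO_of_le_of_nonneg (fun c => mul_nonneg (frameNorm_nonneg _ _ _)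
      (frameNorm_nonneg _ _ _)) (fun c => (T c).2.1 J K hJK)
  · exact isBigO_of_le_of_nonneg (fun c => mul_nonneg (frameNorm_nonneg _ _ _)
      (norm₃_nonneg _)) (fun c => (T c).2.2.2.1 J K hJK)
  · exact isBigO_of_le_of_nonneg (fun c => mul_nonneg (norm₃_nonneg _)
      (norm₃_nonneg _)) (fun c => (T c).2.2.2.2.1 J K hJK)
  · exact isBigO_of_le_of_nonneg (fun c => mul_nonneg (norm₂_nonneg _)
      (norm₂_nonneg _)) (fun c => (T c).2.2.2.2.2.2 J K hJK)

theorem isBigO_zPow_fieldJ {k : ℕ} {Ct : ℝ} (hCt : Ct < 1) (I : MultiIndex) (hI : I.length = k) :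
    (fun c : Config k Ct => norm₁ (fun β => zPow₁ I (fieldJ c.h c.A) β c.x)) =O[⊤]
      fun c => boundJ k c.x c.h c.A := by
  subst hI
  have H := Config.isSolutionFamily hCt fun c : Config I.length Ct => c
  exact isBigO_norm₁ fun β => (H.derivBigO_fieldJ (fun J K hJK =>
    isBigO_of_le_of_nonneg (fun c => mul_nonneg (norm₃_nonneg _) (norm₂_nonneg _))
      (fun c => boundJ_term_le I.length c.x c.h c.A hJK)) β).2

end EinsteinMaxwell

end

theorem proposition5p3 (k : ℕ) (Ct : ℝ) (hCt : Ct < 1) :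
    ∃ C : ℝ, ∀ (U : Set Spacetime) (h : TwoTensorField) (A : OneFormField),
      IsOpen U →
      (∀ μ ν, ∀ x ∈ U, h μ ν x = h ν μ x) →
      (∀ μ ν, ContDiffOn ℝ (k + 1 : ℕ) (h μ ν) U) →
      (∀ β, ContDiffOn ℝ (k + 1 : ℕ) (A β) U) →
      WaveGauge h U →
      (∀ J : MultiIndex, J.length ≤ k → ∀ x ∈ U, norm₂ (val₂ (zPow₂ J h) x) ≤ Ct) →
      ∀ I : MultiIndex, I.length = k → ∀ x ∈ U,
        (rad x ≠ 0 → ∀ S₁ S₂ : Spacetime, IsSphereFrame x S₁ S₂ →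
          norm₂ (val₂ (zPow₂ I (fieldF h A)) x) ≤
            C * (
              (∑ JK ∈ indexPairs k 0,
                (frameNorm x S₁ S₂ famT famU (grad₂ (zPow₂ JK.1 h) x) *
                    frameNorm x S₁ S₂ famT famU (grad₂ (zPow₂ JK.2 h) x) +
                  norm₃ (goodGrad₂ (zPow₂ JK.1 h) x) * norm₃ (grad₂ (zPow₂ JK.2 h) x)))
              + (∑ JK ∈ indexPairs k 1,
                  frameNorm x S₁ S₂ famL famT (grad₂ (zPow₂ JK.1 h) x) *
                    norm₃ (grad₂ (zPow₂ JK.2 h) x))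
              + (∑ JK ∈ indexPairs k 2,
                  norm₃ (grad₂ (zPow₂ JK.1 h) x) * norm₃ (grad₂ (zPow₂ JK.2 h) x))
              + (∑ JJJ ∈ indexTriples k,
                  norm₂ (val₂ (zPow₂ JJJ.2.2 h) x) *
                    norm₃ (grad₂ (zPow₂ JJJ.2.1 h) x) * norm₃ (grad₂ (zPow₂ JJJ.1 h) x))
              + (∑ JJ ∈ indexPairs k 0,
                  norm₂ (grad₁ (zPow₁ JJ.1 A) x) * norm₂ (grad₁ (zPow₁ JJ.2 A) x)))) ∧
        norm₁ (fun β => zPow₁ I (fieldJ h A) β x) ≤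
          C * ∑ II ∈ indexPairs k 0,
            norm₃ (grad₂ (zPow₂ II.1 h) x) * norm₂ (grad₁ (zPow₁ II.2 A) x) := by
  have hF := exists_uniform_bound ((multiIndices k).filter fun I => I.length = k)
    (fun I hI => isBigO_zPow_fieldF hCt I (Finset.mem_filter.1 hI).2)
    (fun c => (boundF_terms k c.x c.S₁ c.S₂ c.h c.A).1)
  have hJ := exists_uniform_bound ((multiIndices k).filter fun I => I.length = k)
    (fun I hI => isBigO_zPow_fieldJ hCt I (Finset.mem_filter.1 hI).2)
    (fun c => boundJ_nonneg k c.x c.h c.A)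
  obtain ⟨C₁, hC₁, h₁⟩ := hF
  obtain ⟨C₂, hC₂, h₂⟩ := hJ
  refine ⟨C₁ + C₂, fun U h A hU hs hh hA hg hb I hI x hx => ?_⟩
  have hI' : I ∈ (multiIndices k).filter fun I => I.length = k :=
    Finset.mem_filter.2 ⟨mem_multiIndices.2 hI.le, hI⟩
  let c : Config k Ct := ⟨U, h, A, x, hU, hx, hs, hh, hA, hg, hb⟩
  refine ⟨fun hr S₁ S₂ hS => ?_, ?_⟩
  · exact (h₁ I hI' ⟨c, S₁, S₂, hr, hS⟩).trans (mul_le_mul_of_nonneg_right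
      (le_add_of_nonneg_right hC₂) (boundF_terms k x S₁ S₂ h A).1)
  · exact (h₂ I hI' c).trans (mul_le_mul_of_nonneg_right
      (le_add_of_nonneg_left hC₁) (boundJ_nonneg k x h A))
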